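/- \textbf{Setting.} Let $\mathcal H$ be a real Hilbert space, $\mathcal Q=\mathbb R^p\times\mathcal H$, and let $\mathcal X$ be a sample space with a reference measure $dx$. For $\tau=(\theta,h)\in\mathcal Q$ let $f_\tau(x)=e^{\eta(x;\tau)}/\int_{\mathcal X} e^{\eta(y;\tau)}dy$, where $\eta$ is a known function. Let $\tau_0=(\theta_0,h_0)$ be the true parameter, $f_{\tau_0}$ being a density, and let $\eta:\mathcal Q\to L^2_0(\mathcal X)$, the space of functions with finite second moment under $f_{\tau_0}$ that are orthogonal to the constants. Write $\mu_\tau(\varphi)=\int\varphi f_\tau\,dx$, $V_\tau(\varphi_1,\varphi_2)=\mu_\tau(\varphi_1\varphi_2)-\mu_\tau(\varphi_1)\mu_\tau(\varphi_2)$, $V_\tau(\varphi)=V_\tau(\varphi,\varphi)$. For independent $X_1,\dots,X_n$ with density $f_{\tau_0}$ put $\mathfrak L_n(\tau)=-\frac1n\sum_{i=1}^n\eta(X_i;\tau)+\log\int_{\mathcal X} e^{\eta(x;\tau)}dx$ and $\mathfrak L_{n,\lambda}(\tau)=\mathfrak L_n(\tau)+\frac\lambda2J(h)$. \textbf{Assumptions.}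 Let $\mathcal N=\mathcal N_{\theta_0}\times\mathcal N_{h_0}$ be a product of convex open neighbourhoods of $\theta_0$ and $h_0$, and let $L_\theta:\mathbb R^p\to L^2_0(\mathcal X)$ and $L_h:\mathcal H\to L^2_0(\mathcal X)$ be bounded linear operators with zero null spaces. \begin{enumerate} \item $J(h)=J(h,h)$ is a square seminorm on $\mathcal H$ (finite on all of $\mathcal H$) with finite-dimensional null space. \item For every $\lambda>0$ there are $M_1,M_2>0$ with $M_1\|g\|^2\le V_{\tau_0}(L_hg)+\lambda J(g)\le M_2\|g\|^2$ for all $g\in\mathcal H$; and there is $c_\delta>0$ with $V_{\tau_0}(L_\theta\zeta-L_hg)>c_\delta$ for all $g\in\mathcal H$ and all $\zeta\in\mathbb R^p$ with $\|\zeta\|_{l^2}=1$. \item On $\mathcal N$, $\eta$ is one-to-one and three times continuously Fréchet differentiable as a map into $L^2_0(\mathcal X)$; for almost every $x$, $\tau\mapsto\eta(x;\tau)$ is differentiable on $\mathcal N$; and for every $n\ge1$, $\tau_0$ is the unique root in $\mathcal N$ of $E[D_\theta\mathfrak L_n(\tau)]=0$, $E[D_h\mathfrak L_n(\tau)]=0$.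 \item There are $C_1,C_2>0$ such that for all $\tau\in\mathcal N$, $(\zeta,g)\in\mathcal Q$: $C_1V_{\tau_0}(L_\theta\zeta+L_hg)\le V_{\tau_0}(D_\theta\eta(\tau)\zeta+D_h\eta(\tau)g)\le C_2V_{\tau_0}(L_\theta\zeta+L_hg)$. \item For all $\tau_1,\tau_2\in\mathcal N$ there is $0<C_d<2C_1$ such that $V_{\tau_0}[(D_\theta\eta(\tau_1)-D_\theta\eta(\tau_2))\zeta+(D_h\eta(\tau_1)-D_h\eta(\tau_2))g]\le C_dV_{\tau_0}(L_\theta\zeta+L_hg)$ for all $(\zeta,g)\in\mathcal N$. \item There are $C_3,C_4>0$ with $C_3V_{\tau_0}(f)\le V_\tau(f)\le C_4V_{\tau_0}(f)$ for all $\tau\in\mathcal N$, $f\in L^2_0(\mathcal X)$. \item $g\mapsto V_{\tau_0}(L_hg)$ is completely continuous with respect to $J$: for every $\varepsilon>0$ there are finitely many linear functionals on $\mathcal H$ on whose common null space $V_{\tau_0}(L_hg)\le\varepsilon J(g)$. \item There is a complete system $\phi_1,\phi_2,\dots$ in $\mathcal H$ (its span is dense) with $V_{\tau_0}(L_h\phi_\nu,L_h\phi_\mu)=\delta_{\nu\mu}$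 and $J(\phi_\nu,\phi_\mu)=\rho_\nu\delta_{\nu\mu}$, where, for some $r>1$ and $0<\beta_1<\beta_2<\infty$, $\beta_1\nu^r<\rho_\nu<\beta_2\nu^r$ for all large $\nu$. \item For every $n\ge1$, $\mathfrak L_n$ is almost surely convex on $\mathcal N$. \end{enumerate} \textbf{Conclusion.} Let $\|\zeta\|_{\mathbb R^p}=V_{\tau_0}^{1/2}(L_\theta\zeta)$. There are constants $c_1,c_2>0$ with $c_1\|\zeta\|_{l^2}\le\|\zeta\|_{\mathbb R^p}\le c_2\|\zeta\|_{l^2}$ for all $\zeta\in\mathbb R^p$. Moreover, let $\lambda=\lambda_n>0$ with $\lambda\to0$ and $n\lambda^{1/r}\to\infty$ as $n\to\infty$, and let $(\hat\theta,\hat h)=(\hat\theta_n,\hat h_n)$ be such that, with probability tending to one, $(\hat\theta,\hat h)$ is in $\mathcal N$ and is the unique local minimum of $\mathfrak L_{n,\lambda}$ in $\mathcal N$. Then $$\|\hat\theta-\theta_0\|_{l^2}\ \asymp\ \|\hat\theta-\theta_0\|_{\mathbb R^p}=V_{\tau_0}^{1/2}[L_\theta(\hat\theta-\theta_0)]=O_p\big(n^{-1/2}\lambda^{-1/(2r)}+\lambda^{1/2}\big),$$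 where $\asymp$ is the two-sided bound with the above $c_1,c_2$; that is, both norms of $\hat\theta-\theta_0$ are $O_p$ of this rate. -/

import Mathlib

open MeasureTheory ProbabilityTheory Filter Topology Set
open scoped ENNReal

noncomputable section

namespace SemiparDensity

/-- A single-sample semiparametric logistic density model with parameter `τ = (θ, h)` in
`ℝᵖ × H`: the density of an observation, with respect to the reference measure `base` (playing the
role of `dx`) on the sample space `𝒳`, is `exp (η τ x) / ∫ exp (η τ y) ∂base(y)`.
The function `η` is known and `τ₀` is the true parameter.  The fields say that `τ₀` does define a
density and that `η` maps the parameter space into the mean-zero square-integrable functions,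
where moments are taken with respect to the true density. -/
structure Model (p : ℕ) (H : Type*) [NormedAddCommGroup H] [InnerProductSpace ℝ H]
    (𝒳 : Type*) [MeasurableSpace 𝒳] where
  /-- reference measure on the sample space -/
  base : Measure 𝒳
  /-- logistic transform of the density -/
  η : EuclideanSpace ℝ (Fin p) × H → 𝒳 → ℝ
  /-- true parameter -/
  τ₀ : EuclideanSpace ℝ (Fin p) × H
  integrable_exp : Integrable (fun x => Real.exp (η τ₀ x)) base
  memLp_eta : ∀ τ, MemLp (η τ) 2 (base.tilted (η τ₀))
  integral_eta : ∀ τ, ∫ x, η τ x ∂(base.tilted (η τ₀)) = 0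

variable {p : ℕ} {H : Type*} [NormedAddCommGroup H] [InnerProductSpace ℝ H]
  {𝒳 : Type*} [MeasurableSpace 𝒳]

namespace Model

/-- The law of one observation under the parameter `τ`: density
`exp (η τ x) / ∫ exp (η τ y) ∂base(y)` with respect to `base`. -/
abbrev law (M : Model p H 𝒳) (τ : EuclideanSpace ℝ (Fin p) × H) : Measure 𝒳 :=
  M.base.tilted (M.η τ)

/-- The true law of one observation. -/
abbrev trueLaw (M : Model p H 𝒳) : Measure 𝒳 := M.law M.τ₀

/-- The mean functional `μ_τ(φ)`. -/
def mean (M : Model p H 𝒳) (τ : EuclideanSpace ℝ (Fin p) × H) (φ : 𝒳 → ℝ) : ℝ :=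
  ∫ x, φ x ∂(M.law τ)

/-- The space of functions with finite second moment under the true density that are orthogonal
to the constants. -/
abbrev L20 (M : Model p H 𝒳) : Submodule ℝ (Lp ℝ 2 M.trueLaw) :=
  (Submodule.span ℝ {Lp.const 2 M.trueLaw (1 : ℝ)})ᗮ

/-- The covariance functional `V_τ(φ₁, φ₂) = μ_τ(φ₁ φ₂) - μ_τ(φ₁) μ_τ(φ₂)`. -/
def cov (M : Model p H 𝒳) (τ : EuclideanSpace ℝ (Fin p) × H) (f g : M.L20) : ℝ :=
  M.mean τ (fun x => (f : Lp ℝ 2 M.trueLaw) x * (g : Lp ℝ 2 M.trueLaw) x)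
    - M.mean τ (fun x => (f : Lp ℝ 2 M.trueLaw) x) * M.mean τ (fun x => (g : Lp ℝ 2 M.trueLaw) x)

/-- The variance functional `V_τ(φ) = V_τ(φ, φ)`. -/
def var (M : Model p H 𝒳) (τ : EuclideanSpace ℝ (Fin p) × H) (f : M.L20) : ℝ :=
  M.cov τ f f

theorem toLp_mem_L20 (M : Model p H 𝒳) (τ : EuclideanSpace ℝ (Fin p) × H) :
    (M.memLp_eta τ).toLp (M.η τ) ∈ M.L20 := by
  rw [Submodule.mem_orthogonal_singleton_iff_inner_right]
  rw [MeasureTheory.L2.inner_def]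
  have h1 : (fun x => inner ℝ ((Lp.const 2 M.trueLaw (1 : ℝ) : Lp ℝ 2 M.trueLaw) x)
      (((M.memLp_eta τ).toLp (M.η τ) : Lp ℝ 2 M.trueLaw) x)) =ᵐ[M.trueLaw] M.η τ := by
    filter_upwards [Lp.coeFn_const (p := 2) (μ := M.trueLaw) (c := (1 : ℝ)),
      (M.memLp_eta τ).coeFn_toLp] with x hx hy
    have hy' : (((M.memLp_eta τ).toLp (M.η τ) : Lp ℝ 2 M.trueLaw) x) = M.η τ x := hy
    rw [hx, hy']
    simp
  rw [integral_congr_ae h1]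
  exact M.integral_eta τ

/-- `η` as a map from the parameter space to the Hilbert space of mean-zero square-integrable
functions. -/
def etaL2 (M : Model p H 𝒳) (τ : EuclideanSpace ℝ (Fin p) × H) : M.L20 :=
  ⟨(M.memLp_eta τ).toLp (M.η τ), M.toLp_mem_L20 τ⟩

/-- The partial Fréchet derivative `D_θ η(τ)`. -/
def Dθ (M : Model p H 𝒳) (τ : EuclideanSpace ℝ (Fin p) × H) :
    EuclideanSpace ℝ (Fin p) →L[ℝ] M.L20 :=
  fderiv ℝ (fun θ => M.etaL2 (θ, τ.2)) τ.1

/-- The partial Fréchet derivative `D_h η(τ)`. -/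
def Dh (M : Model p H 𝒳) (τ : EuclideanSpace ℝ (Fin p) × H) : H →L[ℝ] M.L20 :=
  fderiv ℝ (fun h => M.etaL2 (τ.1, h)) τ.2

/-- The negative log likelihood `-n⁻¹ ∑ η(xᵢ; τ) + log ∫ exp η(y; τ) dy` of a sample of
size `n`. -/
def loss (M : Model p H 𝒳) (n : ℕ) (x : Fin n → 𝒳) (τ : EuclideanSpace ℝ (Fin p) × H) : ℝ :=
  -((1 / (n : ℝ)) * ∑ i, M.η τ (x i)) + Real.log (∫ y, Real.exp (M.η τ y) ∂M.base)

/-- The penalized likelihood: negative log likelihood plus `(lam / 2) J(h)`. -/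
def penLoss (M : Model p H 𝒳) (J : LinearMap.BilinForm ℝ H) (lam : ℝ) (n : ℕ) (x : Fin n → 𝒳)
    (τ : EuclideanSpace ℝ (Fin p) × H) : ℝ :=
  M.loss n x τ + lam / 2 * J τ.2 τ.2

/-- `τ` is a root of `E[D_θ loss] = 0` and `E[D_h loss] = 0`, where `E` is the expectation over a
sample of `n` independent observations from the true law. -/
def IsScoreRoot (M : Model p H 𝒳) (n : ℕ) (τ : EuclideanSpace ℝ (Fin p) × H) : Prop :=
  (∀ ζ : EuclideanSpace ℝ (Fin p),
    ∫ x, fderiv ℝ (fun θ => M.loss n x (θ, τ.2)) τ.1 ζ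
      ∂(Measure.pi fun _ : Fin n => M.trueLaw) = 0) ∧
  (∀ g : H,
    ∫ x, fderiv ℝ (fun h => M.loss n x (τ.1, h)) τ.2 g
      ∂(Measure.pi fun _ : Fin n => M.trueLaw) = 0)

/-- The penalized likelihood has, in the neighbourhood `N`, the unique local minimum `τ`. -/
def IsEstimate (M : Model p H 𝒳) (J : LinearMap.BilinForm ℝ H)
    (N : Set (EuclideanSpace ℝ (Fin p) × H)) (lam : ℝ) (n : ℕ) (x : Fin n → 𝒳)
    (τ : EuclideanSpace ℝ (Fin p) × H) : Prop :=
  τ ∈ N ∧ IsLocalMin (M.penLoss J lam n x) τ ∧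
    ∀ τ' ∈ N, IsLocalMin (M.penLoss J lam n x) τ' → τ' = τ

/-- The norm `‖ζ‖_{ℝᵖ} = V_{τ₀}(L_θ ζ)^{1/2}` on the Euclidean parameter space. -/
def normRp (M : Model p H 𝒳) (Lθ : EuclideanSpace ℝ (Fin p) →L[ℝ] M.L20)
    (ζ : EuclideanSpace ℝ (Fin p)) : ℝ :=
  Real.sqrt (M.var M.τ₀ (Lθ ζ))

/-! ### The assumptions -/

/-- The penalty `J(h) = J(h, h)` is a square seminorm (a positive semidefinite symmetric form)
with a finite-dimensional null space. -/
def PenaltyAssumption (J : LinearMap.BilinForm ℝ H) : Prop :=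
  J.IsPosSemidef ∧ FiniteDimensional ℝ (Submodule.span ℝ {h : H | J h h = 0})

/-- The auxiliary operators have zero null spaces; the norm of `H` is, for each smoothing
parameter, equivalent to that given by `V_{τ₀}(L_h g) + lam J(g)`; the parametric and nonparametric
directions are uniformly separated. -/
def OperatorAssumption (M : Model p H 𝒳) (J : LinearMap.BilinForm ℝ H)
    (Lθ : EuclideanSpace ℝ (Fin p) →L[ℝ] M.L20) (Lh : H →L[ℝ] M.L20) : Prop :=
  Function.Injective Lθ ∧ Function.Injective Lh ∧
  (∀ lam : ℝ, 0 < lam → ∃ M₁ > 0, ∃ M₂ > 0, ∀ g : H,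
    M₁ * ‖g‖ ^ 2 ≤ M.var M.τ₀ (Lh g) + lam * J g g ∧
    M.var M.τ₀ (Lh g) + lam * J g g ≤ M₂ * ‖g‖ ^ 2) ∧
  (∃ c > 0, ∀ (ζ : EuclideanSpace ℝ (Fin p)) (g : H), ‖ζ‖ = 1 →
    c < M.var M.τ₀ (Lθ ζ - Lh g))

/-- In the neighbourhood `N` of `τ₀`, `η` is one-to-one and three times continuously Fréchet
differentiable as a map into the square-integrable functions, its values at almost every point of
the sample space are differentiable in the parameter (so that the sample likelihood has
derivatives), and `τ₀` is the unique root of the expected score equations. -/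
def SmoothnessAssumption (M : Model p H 𝒳) (N : Set (EuclideanSpace ℝ (Fin p) × H)) : Prop :=
  InjOn M.etaL2 N ∧ ContDiffOn ℝ 3 M.etaL2 N ∧
  (∀ᵐ x ∂M.base, DifferentiableOn ℝ (fun τ => M.η τ x) N) ∧
  (∀ n : ℕ, 0 < n → M.IsScoreRoot n M.τ₀ ∧ ∀ τ ∈ N, M.IsScoreRoot n τ → τ = M.τ₀)

/-- The derivative of `η` in `N` is comparable to the auxiliary operators. -/
def DerivativeAssumption (M : Model p H 𝒳) (N : Set (EuclideanSpace ℝ (Fin p) × H))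
    (Lθ : EuclideanSpace ℝ (Fin p) →L[ℝ] M.L20) (Lh : H →L[ℝ] M.L20) (C₁ C₂ : ℝ) : Prop :=
  ∀ τ ∈ N, ∀ (ζ : EuclideanSpace ℝ (Fin p)) (g : H),
    C₁ * M.var M.τ₀ (Lθ ζ + Lh g) ≤ M.var M.τ₀ (M.Dθ τ ζ + M.Dh τ g) ∧
    M.var M.τ₀ (M.Dθ τ ζ + M.Dh τ g) ≤ C₂ * M.var M.τ₀ (Lθ ζ + Lh g)

/-- The derivative of `η` does not vary too much in `N`. -/
def OscillationAssumption (M : Model p H 𝒳) (N : Set (EuclideanSpace ℝ (Fin p) × H))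
    (Lθ : EuclideanSpace ℝ (Fin p) →L[ℝ] M.L20) (Lh : H →L[ℝ] M.L20) (C₁ : ℝ) : Prop :=
  ∀ τ₁ ∈ N, ∀ τ₂ ∈ N, ∃ Cd > 0, Cd < 2 * C₁ ∧
    ∀ v ∈ N,
      M.var M.τ₀ ((M.Dθ τ₁ - M.Dθ τ₂) v.1 + (M.Dh τ₁ - M.Dh τ₂) v.2)
        ≤ Cd * M.var M.τ₀ (Lθ v.1 + Lh v.2)

/-- The variance functionals are equivalent, uniformly over `N`. -/
def VarianceAssumption (M : Model p H 𝒳) (N : Set (EuclideanSpace ℝ (Fin p) × H)) : Prop :=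
  ∃ C₃ > 0, ∃ C₄ > 0, ∀ τ ∈ N, ∀ f : M.L20,
    C₃ * M.var M.τ₀ f ≤ M.var τ f ∧ M.var τ f ≤ C₄ * M.var M.τ₀ f

/-- The quadratic functional `g ↦ V_{τ₀}(L_h g)` is completely continuous with respect to `J`:
for every `ε > 0` it is at most `ε J` on the common null space of finitely many linear
functionals. -/
def CompleteContinuityAssumption (M : Model p H 𝒳) (J : LinearMap.BilinForm ℝ H)
    (Lh : H →L[ℝ] M.L20) : Prop :=
  ∀ ε > 0, ∃ (k : ℕ) (ℓ : Fin k → Module.Dual ℝ H), ∀ g : H,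
    (∀ i, ℓ i g = 0) → M.var M.τ₀ (Lh g) ≤ ε * J g g

/-- `φ`, `ρ` are the eigenfunctions and eigenvalues of `J` relative to `g ↦ V_{τ₀}(L_h g)`: both
forms are diagonal in `φ`, which spans a dense subspace of `H`. -/
structure IsEigensystem (M : Model p H 𝒳) (J : LinearMap.BilinForm ℝ H) (Lh : H →L[ℝ] M.L20)
    (φ : ℕ → H) (ρ : ℕ → ℝ) : Prop where
  orthonormal : ∀ i j, M.cov M.τ₀ (Lh (φ i)) (Lh (φ j)) = if i = j then 1 else 0
  diagonal : ∀ i j, J (φ i) (φ j) = if i = j then ρ i else 0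
  complete : (Submodule.span ℝ (range φ)).topologicalClosure = ⊤

/-- The eigenvalues grow like `ν ^ r` (the index `ν` of the sequence starts at `1`). -/
def EigenvalueAssumption (M : Model p H 𝒳) (J : LinearMap.BilinForm ℝ H) (Lh : H →L[ℝ] M.L20)
    (r : ℝ) : Prop :=
  ∃ (φ : ℕ → H) (ρ : ℕ → ℝ), M.IsEigensystem J Lh φ ρ ∧
    ∃ β₁ > 0, ∃ β₂ > 0, ∀ᶠ ν : ℕ in atTop,
      β₁ * ((ν : ℝ) + 1) ^ r < ρ ν ∧ ρ ν < β₂ * ((ν : ℝ) + 1) ^ r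

/-- For every sample size, the negative log likelihood of almost every sample is convex in `N`. -/
def ConvexityAssumption (M : Model p H 𝒳) (N : Set (EuclideanSpace ℝ (Fin p) × H)) : Prop :=
  ∀ n : ℕ, 0 < n → ∀ᵐ x ∂(Measure.pi fun _ : Fin n => M.trueLaw), ConvexOn ℝ N (M.loss n x)

end Model

/-- `Y n = O_p(a n)` as `n → ∞`. -/
def IsBigOp {Ω : Type*} [MeasurableSpace Ω] (P : Measure Ω) (Y : ℕ → Ω → ℝ) (a : ℕ → ℝ) : Prop :=
  ∀ ε : ℝ, 0 < ε → ∃ K : ℝ, ∀ᶠ n in atTop, P {ω | K * a n < |Y n ω|} ≤ ENNReal.ofReal ε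

end SemiparDensity

end

open MeasureTheory ProbabilityTheory Filter Topology Set
open scoped ENNReal

noncomputable section

namespace SemiparDensity

/-! ### Gaussian shifts -/

/-! Put W(ζ, g) = ‖ζ‖² + ‖L_h g‖². Since the parametric and nonparametric directions are uniformly
separated, W is equivalent to V_{τ₀}(L_θ ζ + L_h g) (`exists_norm_sq_equiv`), so it suffices to
bound W(τ̂ − τ₀) by the squared rate. The penalized loss is convex on N, hence a local minimum
minimizes it over N; if W(τ̂ − τ₀) ≥ δ², the segment from τ₀ to τ̂ meets W = δ² at a point whose
penalized loss is at most that of τ₀ (`Model.form_lt_of_isEstimate`). This is impossible once, up to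
a fixed scaling, the empirical excess loss plus a quarter of the penalty exceeds c₀ δ² near that
surface and λ J(h₀) < c₀ δ². Both can be arranged, with probability close to one, when δ² is a large
multiple of n⁻¹ λ^(-1/r) + λ.

Population side. The variance equivalence, tested on indicators, bounds all density ratios on N
above and below (`exists_density_bound`), so the log-likelihood ratio `relLoss` is bounded. Its mean
under the truth is the log-normalizer `logZ`, a Kullback-Leibler divergence. Almost sure convexity
gives affine minorants of `relLoss` whose slopes involve the derivative of η; together with strong
convexity of the log-normalizer in η they give `logZ` ≥ const · W (`Model.mul_le_logZ`). The second
moment of `relLoss` is at most const · W, so a Bernstein argument yields an exponential moment.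
These facts are collected in `Model.RegularLoss`.

Empirical side (`exists_uniform_lower_bound`). In eigencoordinates, with constants independent of
their number, the points with moderate penalty form an ellipsoid. It has a net whose log-cardinality
is proportional to the effective dimension D = p + ∑ (1 + λ ρ_k)⁻¹ (`exists_net_of_ellipsoid`), and
D is of order λ^(-1/r) (`exists_sum_inv_le`). Chernoff bounds handle the net points. The increment
from a net point dominates its affine minorant, which has only second moments; it is therefore
truncated by `softClip` and controlled for all directions at once by a Gaussian PAC-Bayes argument
(`measure_exists_sum_softClip_lt_le`). Where the penalty is large, the linearization at τ₀ and
Markov's inequality suffice. Density of the span of the eigenfunctions and continuity of the loss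
then remove the restriction to finitely many rational coordinates. -/

theorem gaussianReal_lintegral_shift (a : ℝ) {f : ℝ → ℝ≥0∞} (hf : Measurable f) :
    ∫⁻ x, f (x + a) * ENNReal.ofReal (Real.exp (-(a * x) - a ^ 2 / 2)) ∂(gaussianReal 0 1)
      = ∫⁻ x, f x ∂(gaussianReal 0 1) := by
  rw [gaussianReal_of_var_ne_zero 0 (one_ne_zero),
    lintegral_withDensity_eq_lintegral_mul _ (measurable_gaussianPDF 0 1) (by fun_prop),
    lintegral_withDensity_eq_lintegral_mul _ (measurable_gaussianPDF 0 1) hf,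
    ← lintegral_add_right_eq_self (fun x => (gaussianPDF 0 1 * f) x) a]
  refine lintegral_congr fun x => ?_
  have : gaussianPDF 0 1 (x + a)
      = gaussianPDF 0 1 x * ENNReal.ofReal (Real.exp (-(a * x) - a ^ 2 / 2)) := by
    rw [gaussianPDF, gaussianPDF, ← ENNReal.ofReal_mul (gaussianPDFReal_nonneg _ _ _)]
    congr 1
    rw [gaussianPDFReal, gaussianPDFReal, mul_assoc _ (Real.exp _), ← Real.exp_add]
    congr 2
    simp
    ring
  simp only [Pi.mul_apply]
  rw [this]
  ring

section gaussian

variable {ι : Type*} [Fintype ι]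

/-- The standard Gaussian measure on `ι → ℝ`. -/
abbrev stdGauss (ι : Type*) [Fintype ι] : Measure (ι → ℝ) :=
  Measure.pi fun _ : ι => gaussianReal 0 1

theorem lintegral_pi_prod {α : ι → Type*} [∀ i, MeasurableSpace (α i)] (μ : ∀ i, Measure (α i))
    [∀ i, IsProbabilityMeasure (μ i)] (f : ∀ i, α i → ℝ≥0∞) (hf : ∀ i, Measurable (f i)) :
    ∫⁻ x, ∏ i, f i (x i) ∂(Measure.pi μ) = ∏ i, ∫⁻ x, f i x ∂(μ i) := by
  refine (lintegral_prod_eq_prod_lintegral_of_indepFun Finset.univ (fun i (x : ∀ i, α i) => f i (x i))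
    (iIndepFun_pi (μ := μ) fun i => (hf i).aemeasurable)
    (fun i => (hf i).comp (measurable_pi_apply i))).trans ?_
  refine Finset.prod_congr rfl fun i _ => ?_
  exact (measurePreserving_eval μ i).lintegral_comp (hf i)

/-- The Cameron-Martin formula. The density factors over coordinates, so it is enough to compare the
translated weighted measure with the product measure on rectangles, where the one-dimensional
formula applies. -/
theorem stdGauss_lintegral_shift (a : ι → ℝ) {F : (ι → ℝ) → ℝ≥0∞} (hF : Measurable F) :
    ∫⁻ g, F (g + a) * ENNReal.ofReal (Real.exp (-(∑ k, a k * g k) - (∑ k, a k ^ 2) / 2))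
      ∂(stdGauss ι) = ∫⁻ g, F g ∂(stdGauss ι) := by
  set d : (ι → ℝ) → ℝ≥0∞ := fun g =>
    ENNReal.ofReal (Real.exp (-(∑ k, a k * g k) - (∑ k, a k ^ 2) / 2)) with hd
  have hdm : Measurable d := by fun_prop
  have hT : Measurable fun g : ι → ℝ => g + a := by fun_prop
  have hprod : ∀ g, d g
      = ∏ k, ENNReal.ofReal (Real.exp (-(a k * g k) - a k ^ 2 / 2)) := by
    intro g
    rw [← ENNReal.ofReal_prod_of_nonneg (fun _ _ => (Real.exp_pos _).le), ← Real.exp_sum, hd]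
    simp only [Finset.sum_sub_distrib, Finset.sum_neg_distrib, Finset.sum_div]
  have key : ((stdGauss ι).withDensity d).map (fun g => g + a) = stdGauss ι := by
    symm
    refine Measure.pi_eq fun s hs => ?_
    rw [Measure.map_apply hT (MeasurableSet.univ_pi hs),
      withDensity_apply _ (hT (MeasurableSet.univ_pi hs)),
      ← lintegral_indicator (hT (MeasurableSet.univ_pi hs))]
    have h1 : ∀ g : ι → ℝ, ((fun g : ι → ℝ => g + a) ⁻¹' univ.pi s).indicator d g
        = ∏ k, ((s k).indicator (1 : ℝ → ℝ≥0∞) (g k + a k) *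
          ENNReal.ofReal (Real.exp (-(a k * g k) - a k ^ 2 / 2))) := by
      intro g
      rw [Finset.prod_mul_distrib, ← hprod]
      by_cases h : g + a ∈ univ.pi s
      · rw [indicator_of_mem (by exact h)]
        rw [Finset.prod_eq_one, one_mul]
        intro k _
        exact indicator_of_mem (h k trivial) _
      · rw [indicator_of_notMem (by exact h)]
        simp only [Set.mem_pi, mem_univ, true_implies, not_forall] at h
        obtain ⟨k, hk⟩ := h
        rw [Finset.prod_eq_zero (Finset.mem_univ k), zero_mul]
        exact indicator_of_notMem hk _
    rw [lintegral_congr h1, lintegral_pi_prod (fun _ : ι => gaussianReal 0 1) (fun k x =>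
      (s k).indicator (1 : ℝ → ℝ≥0∞) (x + a k) *
          ENNReal.ofReal (Real.exp (-(a k * x) - a k ^ 2 / 2)))]
    · refine Finset.prod_congr rfl fun k _ => ?_
      rw [gaussianReal_lintegral_shift (a k) (measurable_one.indicator (hs k)),
        lintegral_indicator_one (hs k)]
    · intro k
      have : Measurable ((s k).indicator (1 : ℝ → ℝ≥0∞)) := measurable_one.indicator (hs k)
      fun_prop
  conv_rhs => rw [← key]
  rw [lintegral_map hF hT, lintegral_withDensity_eq_lintegral_mul _ hdm (g := fun g => F (g + a))
    (hF.comp hT)]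
  refine lintegral_congr fun g => ?_
  simp only [Pi.mul_apply]
  ring

theorem stdGauss_memLp_apply (k : ι) : MemLp (fun g : ι → ℝ => g k) 2 (stdGauss ι) :=
  (memLp_id_gaussianReal (μ := 0) (v := 1) 2).comp_measurePreserving
    (measurePreserving_eval (fun _ : ι => gaussianReal 0 1) k)

theorem stdGauss_memLp_linear (a : ι → ℝ) :
    MemLp (fun g : ι → ℝ => ∑ k, a k * g k) 2 (stdGauss ι) :=
  memLp_finsetSum _ fun k _ => (stdGauss_memLp_apply k).const_mul (a k)

theorem stdGauss_integral_linear (a : ι → ℝ) : ∫ g, ∑ k, a k * g k ∂(stdGauss ι) = 0 := by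
  rw [integral_finsetSum _ fun k _ =>
    ((stdGauss_memLp_apply k).const_mul (a k)).integrable one_le_two]
  refine Finset.sum_eq_zero fun k _ => ?_
  rw [integral_const_mul]
  have h2 : ∫ g : ι → ℝ, g k ∂(stdGauss ι) = ∫ x, x ∂(gaussianReal 0 1) :=
    integral_comp_eval (μ := fun _ : ι => gaussianReal 0 1) (f := fun x : ℝ => x)
      (by fun_prop)
  rw [h2, integral_id_gaussianReal, mul_zero]

theorem stdGauss_integral_linear_sq (a : ι → ℝ) :
    ∫ g, (∑ k, a k * g k) ^ 2 ∂(stdGauss ι) = ∑ k, a k ^ 2 := by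
  have h : Var[fun g => ∑ k, a k * g k; stdGauss ι] = ∑ k, a k ^ 2 := by
    have := variance_sum_pi (μ := fun _ : ι => gaussianReal 0 1) (X := fun k x => a k * x)
      (fun k => (memLp_id_gaussianReal (μ := 0) (v := 1) 2).const_mul (a k))
    have h2 : (∑ k, fun ω : ι → ℝ => a k * ω k) = fun g => ∑ k, a k * g k := by
      ext g; simp
    rw [h2] at this
    rw [this]
    refine Finset.sum_congr rfl fun k _ => ?_
    rw [variance_const_mul, variance_fun_id_gaussianReal]
    simp
  rw [variance_eq_sub (stdGauss_memLp_linear a), stdGauss_integral_linear] at h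
  simpa using h

/-- Change of measure: an exponential moment bound under the Gaussian measure controls the mean
under every shifted Gaussian measure. -/
theorem stdGauss_integral_shift_le {M : (ι → ℝ) → ℝ} (hM : Measurable M) {x : ℝ}
    (hx : ∫⁻ g, ENNReal.ofReal (Real.exp (M g)) ∂(stdGauss ι) ≤ ENNReal.ofReal (Real.exp x))
    (a : ι → ℝ) (hint : Integrable (fun g => M (g + a)) (stdGauss ι)) :
    ∫ g, M (g + a) ∂(stdGauss ι) ≤ x + (∑ k, a k ^ 2) / 2 := by
  -- By Cameron-Martin, exp N has the same integral as exp M. Jensen's inequality bounds the mean of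
  -- N by x, and the linear term of N has mean zero, so only half the squared shift is lost.
  set N : (ι → ℝ) → ℝ := fun g => M (g + a) + (-(∑ k, a k * g k) - (∑ k, a k ^ 2) / 2) with hN
  have hlin : Integrable (fun g : ι → ℝ => ∑ k, a k * g k) (stdGauss ι) :=
    (stdGauss_memLp_linear a).integrable one_le_two
  have hlin' : Integrable (fun g : ι → ℝ => -(∑ k, a k * g k) - (∑ k, a k ^ 2) / 2)
      (stdGauss ι) := hlin.neg.sub (integrable_const _)
  have hNint : Integrable N (stdGauss ι) := hint.add hlin'
  have hNm : Measurable N := by fun_prop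
  have hexp : ∫⁻ g, ENNReal.ofReal (Real.exp (N g)) ∂(stdGauss ι)
      ≤ ENNReal.ofReal (Real.exp x) := by
    refine le_trans (le_of_eq ?_) hx
    rw [← stdGauss_lintegral_shift a (F := fun g => ENNReal.ofReal (Real.exp (M g)))
      (by fun_prop)]
    refine lintegral_congr fun g => ?_
    rw [← ENNReal.ofReal_mul (Real.exp_pos _).le, ← Real.exp_add]
  have hexpint : Integrable (fun g => Real.exp (N g)) (stdGauss ι) := by
    refine ⟨by fun_prop, ?_⟩
    rw [hasFiniteIntegral_iff_ofReal (ae_of_all _ fun _ => (Real.exp_pos _).le)]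
    exact hexp.trans_lt ENNReal.ofReal_lt_top
  have hJ : Real.exp (∫ g, N g ∂(stdGauss ι)) ≤ ∫ g, Real.exp (N g) ∂(stdGauss ι) :=
    convexOn_exp.map_integral_le Real.continuous_exp.continuousOn isClosed_univ
      (ae_of_all _ fun _ => mem_univ _) hNint hexpint
  have h2 : ∫ g, Real.exp (N g) ∂(stdGauss ι) ≤ Real.exp x := by
    rw [integral_eq_lintegral_of_nonneg_ae (ae_of_all _ fun _ => (Real.exp_pos _).le)
      (by fun_prop)]
    exact ENNReal.toReal_le_of_le_ofReal (Real.exp_pos _).le hexp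
  have h3 : ∫ g, N g ∂(stdGauss ι) ≤ x := Real.exp_le_exp.mp (hJ.trans h2)
  have h4 : ∫ g, N g ∂(stdGauss ι)
      = ∫ g, M (g + a) ∂(stdGauss ι) - (∑ k, a k ^ 2) / 2 := by
    rw [hN, integral_add hint hlin', integral_sub (f := fun g : ι → ℝ => -(∑ k, a k * g k)) hlin.neg
      (integrable_const _), integral_neg,
      stdGauss_integral_linear]
    simp
    ring
  linarith

end gaussian

/-! ### A smooth lower truncation -/

/-- A bounded function with bounded second derivative which is tangent to the identity at `0` and
lies below `max s (-1)`. -/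
def softClip (s : ℝ) : ℝ := (s - s ^ 2) / (1 + s ^ 2)

theorem measurable_softClip : Measurable softClip := by
  unfold softClip; fun_prop

/-- In the application z is an increment that is at least -1 and dominates its linearization s. The
truncated linearization is still a minorant of z, and it is bounded. -/
theorem softClip_le {s z : ℝ} (h1 : s ≤ z) (h2 : -1 ≤ z) : softClip s ≤ z := by
  unfold softClip
  rw [div_le_iff₀ (by positivity)]
  by_cases h : -1 ≤ s
  · nlinarith [mul_nonneg (sub_nonneg.2 h1) (sq_nonneg s),
      mul_nonneg (by linarith : 0 ≤ s + 1) (sq_nonneg s)]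
  · push Not at h
    nlinarith [mul_nonneg (by linarith : 0 ≤ z + 1) (sq_nonneg s)]

theorem abs_softClip_le (s : ℝ) : |softClip s| ≤ 2 := by
  unfold softClip
  rw [abs_div, abs_of_pos (by positivity : 0 < 1 + s ^ 2), div_le_iff₀ (by positivity), abs_le]
  constructor <;> nlinarith [sq_nonneg (s - 1), sq_nonneg (s + 1)]

theorem sub_softClip_le (s : ℝ) : s - softClip s ≤ 2 * s ^ 2 := by
  unfold softClip
  rw [sub_le_iff_le_add, ← sub_le_iff_le_add', le_div_iff₀ (by positivity)]
  nlinarith [sq_nonneg (s * (s - 1)), sq_nonneg s, sq_nonneg (s * s)]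

theorem softClip_sq_le (s : ℝ) : softClip s ^ 2 ≤ 2 * s ^ 2 := by
  unfold softClip
  rw [div_pow, div_le_iff₀ (by positivity)]
  nlinarith [sq_nonneg (s * (s + 1)), sq_nonneg (s * s), sq_nonneg (s * s * s)]

/-- Truncation makes an exponential moment available from two ordinary moments. The factor 1/2
brings the argument into [-1, 1], where exp x ≤ 1 + x + x². -/
theorem exp_neg_softClip_le (s : ℝ) :
    Real.exp (-(softClip s / 2)) ≤ 1 - s / 2 + 3 / 2 * s ^ 2 := by
  have h0 := abs_softClip_le s
  have h1 : |-(softClip s / 2)| ≤ 1 := by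
    rw [abs_neg, abs_div, abs_of_pos (by norm_num : (0 : ℝ) < 2)]; linarith
  have h2 := (abs_le.1 (Real.abs_exp_sub_one_sub_id_le h1)).2
  have h3 := sub_softClip_le s
  have h4 := softClip_sq_le s
  nlinarith

/-- The coefficient of h is the derivative of `softClip` at s, and the quotient of the remainder by
h² is at most 4. The linear term disappears when h is averaged over a centred law. -/
theorem softClip_add_le (s h : ℝ) :
    softClip (s + h) ≤ softClip s + (1 - 2 * s - s ^ 2) / (1 + s ^ 2) ^ 2 * h + 4 * h ^ 2 := by
  obtain ⟨t, rfl⟩ : ∃ t, h = t - s := ⟨s + h, by ring⟩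
  rw [add_sub_cancel]
  have hs : 0 < 1 + s ^ 2 := by positivity
  have htt : 0 < 1 + t ^ 2 := by positivity
  have key : softClip t - softClip s - (1 - 2 * s - s ^ 2) / (1 + s ^ 2) ^ 2 * (t - s)
      = (t - s) ^ 2 * ((s ^ 2 + 2 * s * t + s ^ 2 * t - 1 - 2 * s - t)
        / ((1 + t ^ 2) * (1 + s ^ 2) ^ 2)) := by
    unfold softClip
    field_simp
    ring
  have h2 : (s ^ 2 + 2 * s * t + s ^ 2 * t - 1 - 2 * s - t)
        / ((1 + t ^ 2) * (1 + s ^ 2) ^ 2) ≤ 4 := by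
    rw [div_le_iff₀ (by positivity)]
    have h3 : s ^ 2 + 2 * s * t + s ^ 2 * t - 1 - 2 * s - t ≤ 4 * ((1 + t ^ 2) * (1 + s ^ 2)) := by
      nlinarith [sq_nonneg (s - t), sq_nonneg (s * (t - 1)), sq_nonneg (s + 1), sq_nonneg (t + 1),
        sq_nonneg (s * t)]
    have h4 : (1 + t ^ 2) * (1 + s ^ 2) ≤ (1 + t ^ 2) * (1 + s ^ 2) ^ 2 := by
      apply mul_le_mul_of_nonneg_left _ htt.le
      nlinarith [sq_nonneg s]
    linarith
  nlinarith [mul_le_mul_of_nonneg_left h2 (sq_nonneg (t - s))]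

/-- Averaging the truncation over a centred Gaussian linear perturbation. -/
theorem integral_softClip_add_le {ι : Type*} [Fintype ι] (s : ℝ) (a : ι → ℝ) :
    ∫ g, softClip (s + ∑ k, a k * g k) ∂(stdGauss ι)
      ≤ softClip s + 4 * min 1 (∑ k, a k ^ 2) := by
  have hlin := (stdGauss_memLp_linear a).integrable one_le_two
  have hsq := (stdGauss_memLp_linear a).integrable_sq
  have hint : Integrable (fun g : ι → ℝ => softClip (s + ∑ k, a k * g k)) (stdGauss ι) := by
    refine Integrable.of_bound (C := 2) ?_ (ae_of_all _ fun g => abs_softClip_le _)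
    exact (measurable_softClip.comp (by fun_prop)).aestronglyMeasurable
  have h1 : ∫ g, softClip (s + ∑ k, a k * g k) ∂(stdGauss ι) ≤ softClip s + 4 := by
    calc _ ≤ ∫ _g : ι → ℝ, (2 : ℝ) ∂(stdGauss ι) :=
          integral_mono hint (integrable_const _) fun g => (abs_le.1 (abs_softClip_le _)).2
      _ = 2 := by simp
      _ ≤ _ := by linarith [(abs_le.1 (abs_softClip_le s)).1]
  have h2 : ∫ g, softClip (s + ∑ k, a k * g k) ∂(stdGauss ι)
      ≤ softClip s + 4 * ∑ k, a k ^ 2 := by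
    set d := (1 - 2 * s - s ^ 2) / (1 + s ^ 2) ^ 2
    have hi : Integrable (fun g : ι → ℝ => softClip s + d * ∑ k, a k * g k) (stdGauss ι) :=
      (integrable_const _).add (hlin.const_mul d)
    calc _ ≤ ∫ g : ι → ℝ, (softClip s + d * (∑ k, a k * g k) + 4 * (∑ k, a k * g k) ^ 2)
            ∂(stdGauss ι) :=
          integral_mono hint (hi.add (hsq.const_mul 4)) fun g => softClip_add_le _ _
      _ = _ := by
        rw [integral_add hi (hsq.const_mul 4), integral_add (integrable_const _)
          (hlin.const_mul d), integral_const_mul, integral_const_mul, stdGauss_integral_linear,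
          stdGauss_integral_linear_sq]
        simp
  rcases le_total 1 (∑ k, a k ^ 2) with h | h
  · rw [min_eq_left h]; linarith
  · rw [min_eq_right h]; exact h2

/-! ### Exponential moments of i.i.d. sums -/

section iid

variable {Ω 𝒳 : Type*} [MeasurableSpace Ω] [MeasurableSpace 𝒳] {P : Measure Ω} {μ : Measure 𝒳}
  {X : ℕ → Ω → 𝒳}

theorem lintegral_exp_sum_le (hX : ∀ i, Measurable (X i)) (hlaw : ∀ i, P.map (X i) = μ)
    (hind : iIndepFun X P) {f : 𝒳 → ℝ} (hf : Measurable f) {s : ℝ}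
    (hs : ∫⁻ x, ENNReal.ofReal (Real.exp (f x)) ∂μ ≤ ENNReal.ofReal (Real.exp s)) (n : ℕ) :
    ∫⁻ ω, ENNReal.ofReal (Real.exp (∑ i ∈ Finset.range n, f (X i ω))) ∂P
      ≤ ENNReal.ofReal (Real.exp (n * s)) := by
  have h1 : ∀ ω, ENNReal.ofReal (Real.exp (∑ i ∈ Finset.range n, f (X i ω)))
      = ∏ i ∈ Finset.range n, ENNReal.ofReal (Real.exp (f (X i ω))) := by
    intro ω
    rw [Real.exp_sum, ENNReal.ofReal_prod_of_nonneg fun _ _ => (Real.exp_pos _).le]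
  have hm : Measurable fun x => ENNReal.ofReal (Real.exp (f x)) := by fun_prop
  rw [lintegral_congr h1, lintegral_prod_eq_prod_lintegral_of_indepFun (Finset.range n)
    (fun i ω => ENNReal.ofReal (Real.exp (f (X i ω))))
    (hind.comp (fun _ x => ENNReal.ofReal (Real.exp (f x))) fun _ => hm)
    (fun i => hm.comp (hX i))]
  have h2 : ∀ i, ∫⁻ ω, ENNReal.ofReal (Real.exp (f (X i ω))) ∂P ≤ ENNReal.ofReal (Real.exp s) := by
    intro i
    rw [← lintegral_map hm (hX i), hlaw i]
    exact hs
  calc _ ≤ ∏ _i ∈ Finset.range n, ENNReal.ofReal (Real.exp s) :=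
        Finset.prod_le_prod' fun i _ => h2 i
    _ = _ := by
      rw [Finset.prod_const, Finset.card_range, ← ENNReal.ofReal_pow (Real.exp_pos _).le,
        ← Real.exp_nat_mul]

theorem measure_exp_ge_le {F : Ω → ℝ≥0∞} (hF : AEMeasurable F P) {t : ℝ}
    (ht : ∫⁻ ω, F ω ∂P ≤ ENNReal.ofReal (Real.exp t)) (x : ℝ) :
    P {ω | ENNReal.ofReal (Real.exp (t + x)) < F ω} ≤ ENNReal.ofReal (Real.exp (-x)) := by
  have h := meas_ge_le_lintegral_div hF (ε := ENNReal.ofReal (Real.exp (t + x)))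
    (by simp [Real.exp_pos]) ENNReal.ofReal_ne_top
  refine (measure_mono fun ω hω => ?_).trans (h.trans ?_)
  · exact le_of_lt (show _ < F ω from hω)
  · refine ENNReal.div_le_of_le_mul (ht.trans (le_of_eq ?_))
    rw [← ENNReal.ofReal_mul (Real.exp_pos _).le, ← Real.exp_add]
    congr 2; ring

theorem measure_sum_gt_le (hX : ∀ i, Measurable (X i)) (hlaw : ∀ i, P.map (X i) = μ)
    (hind : iIndepFun X P) {f : 𝒳 → ℝ} (hf : Measurable f) {s : ℝ}
    (hs : ∫⁻ x, ENNReal.ofReal (Real.exp (f x)) ∂μ ≤ ENNReal.ofReal (Real.exp s)) (n : ℕ)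
    (x : ℝ) :
    P {ω | n * s + x < ∑ i ∈ Finset.range n, f (X i ω)} ≤ ENNReal.ofReal (Real.exp (-x)) := by
  have hm : Measurable fun ω => ENNReal.ofReal (Real.exp (∑ i ∈ Finset.range n, f (X i ω))) := by
    have : Measurable fun ω => ∑ i ∈ Finset.range n, f (X i ω) :=
      Finset.measurable_fun_sum _ fun i _ => hf.comp (hX i)
    fun_prop
  refine le_trans (measure_mono fun ω hω => ?_)
    (measure_exp_ge_le hm.aemeasurable (lintegral_exp_sum_le hX hlaw hind hf hs n) x)
  have hω' : n * s + x < ∑ i ∈ Finset.range n, f (X i ω) := hω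
  change ENNReal.ofReal _ < ENNReal.ofReal _
  exact (ENNReal.ofReal_lt_ofReal_iff (Real.exp_pos _)).2 (Real.exp_lt_exp.2 hω')

end iid

/-! ### A uniform lower bound for truncated linear processes -/

theorem stdGauss_integral_sum_sq {ι : Type*} [Fintype ι] (s w : ι → ℝ) :
    Integrable (fun g : ι → ℝ => ∑ k, (w k + s k * g k) ^ 2) (stdGauss ι) ∧
    ∫ g, ∑ k, (w k + s k * g k) ^ 2 ∂(stdGauss ι) = ∑ k, w k ^ 2 + ∑ k, s k ^ 2 := by
  classical
  have hlin : ∀ k, Integrable (fun g : ι → ℝ => g k) (stdGauss ι) := fun k =>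
    (stdGauss_memLp_apply k).integrable one_le_two
  have hsq : ∀ k, Integrable (fun g : ι → ℝ => g k ^ 2) (stdGauss ι) := fun k =>
    (stdGauss_memLp_apply k).integrable_sq
  have h0 : ∀ k, ∫ g : ι → ℝ, g k ∂(stdGauss ι) = 0 := fun k => by
    simpa [Pi.single_apply] using stdGauss_integral_linear (Pi.single k (1 : ℝ))
  have h1 : ∀ k, ∫ g : ι → ℝ, g k ^ 2 ∂(stdGauss ι) = 1 := fun k => by
    simpa [Pi.single_apply] using stdGauss_integral_linear_sq (Pi.single k (1 : ℝ))
  have e : ∀ k, (fun g : ι → ℝ => (w k + s k * g k) ^ 2)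
      = fun g => (w k ^ 2 + (2 * w k * s k) * g k) + s k ^ 2 * g k ^ 2 := by
    intro k; ext g; ring
  have hi : ∀ k, Integrable (fun g : ι → ℝ => w k ^ 2 + (2 * w k * s k) * g k) (stdGauss ι) :=
    fun k => (integrable_const _).add ((hlin k).const_mul _)
  have hint : ∀ k, Integrable (fun g : ι → ℝ => (w k + s k * g k) ^ 2) (stdGauss ι) := by
    intro k; rw [e k]
    exact (hi k).add ((hsq k).const_mul _)
  refine ⟨integrable_finsetSum _ fun k _ => hint k, ?_⟩
  rw [integral_finsetSum _ fun k _ => hint k, ← Finset.sum_add_distrib]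
  refine Finset.sum_congr rfl fun k _ => ?_
  rw [e k, integral_add (hi k) ((hsq k).const_mul _), integral_add (integrable_const _)
    ((hlin k).const_mul _), integral_const_mul, integral_const_mul, h0, h1]
  simp

theorem one_add_two_mul_ge_exp {q : ℝ} (h0 : 0 ≤ q) (h1 : q ≤ 1) : Real.exp q ≤ 1 + 2 * q := by
  have h := (abs_le.1 (Real.abs_exp_sub_one_sub_id_le (x := q) (by rw [abs_of_nonneg h0]; exact h1))).2
  nlinarith

theorem lintegral_exp_le_of_le {𝒳 : Type*} [MeasurableSpace 𝒳] {μ : Measure 𝒳} {f g : 𝒳 → ℝ}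
    (hfg : ∀ x, Real.exp (f x) ≤ g x) (hg : Integrable g μ) {s : ℝ}
    (hs : ∫ x, g x ∂μ ≤ 1 + s) :
    ∫⁻ x, ENNReal.ofReal (Real.exp (f x)) ∂μ ≤ ENNReal.ofReal (Real.exp s) := by
  calc _ ≤ ∫⁻ x, ENNReal.ofReal (g x) ∂μ := lintegral_mono fun x => ENNReal.ofReal_le_ofReal (hfg x)
    _ = ENNReal.ofReal (∫ x, g x ∂μ) := by
      rw [ofReal_integral_eq_lintegral_ofReal hg
        (ae_of_all _ fun x => (Real.exp_pos _).le.trans (hfg x))]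
    _ ≤ _ := ENNReal.ofReal_le_ofReal (hs.trans (by linarith [Real.add_one_le_exp s]))

section pac

variable {Ω 𝒳 : Type*} [MeasurableSpace Ω] [MeasurableSpace 𝒳] {P : Measure Ω} {μ : Measure 𝒳}
  [IsProbabilityMeasure μ]
  {X : ℕ → Ω → 𝒳} {ι : Type*} [Fintype ι]

/-- The summands lie in [0, 1], where exp q ≤ 1 + 2q; hence second moments alone give the
exponential moment for Chernoff's bound. This sum is the price of replacing the value at a centre by
a Gaussian average around it. -/
theorem measure_sum_min_gt_le (hX : ∀ i, Measurable (X i)) (hlaw : ∀ i, P.map (X i) = μ)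
    (hind : iIndepFun X P) {y : ι → 𝒳 → ℝ} (hy : ∀ k, Measurable (y k))
    (hy2 : ∀ k, MemLp (y k) 2 μ) {C : ℝ} (hC : ∀ k, ∫ x, y k x ^ 2 ∂μ ≤ C) (s : ι → ℝ)
    (n : ℕ) (t : ℝ) :
    P {ω | n * (2 * (C * ∑ k, s k ^ 2)) + t
        < ∑ i ∈ Finset.range n, min 1 (∑ k, (s k * y k (X i ω)) ^ 2)}
      ≤ ENNReal.ofReal (Real.exp (-t)) := by
  have hint : ∀ k, Integrable (fun x => s k ^ 2 * y k x ^ 2) μ := fun k =>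
    (hy2 k).integrable_sq.const_mul _
  have hS : Integrable (fun x => 2 * ∑ k, s k ^ 2 * y k x ^ 2) μ :=
    (integrable_finsetSum _ fun k _ => hint k).const_mul 2
  refine measure_sum_gt_le hX hlaw hind (f := fun x => min 1 (∑ k, (s k * y k x) ^ 2))
    (by fun_prop) ?_ n t
  refine lintegral_exp_le_of_le (g := fun x => 1 + 2 * ∑ k, s k ^ 2 * y k x ^ 2) (fun x => ?_)
    ((integrable_const _).add hS) ?_
  · simp only [mul_pow]
    have h0 : 0 ≤ ∑ k, s k ^ 2 * y k x ^ 2 := Finset.sum_nonneg fun k _ => by positivity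
    refine (one_add_two_mul_ge_exp (le_min zero_le_one h0) (min_le_left _ _)).trans ?_
    linarith [min_le_right 1 (∑ k, s k ^ 2 * y k x ^ 2)]
  · rw [integral_add (integrable_const _) hS, integral_const_mul,
      integral_finsetSum _ fun k _ => hint k]
    simp only [integral_const_mul, integral_const, probReal_univ, smul_eq_mul, mul_one]
    have h : ∑ k, s k ^ 2 * ∫ x, y k x ^ 2 ∂μ ≤ C * ∑ k, s k ^ 2 := by
      rw [Finset.mul_sum]
      refine Finset.sum_le_sum fun k _ => ?_
      rw [mul_comm C]
      exact mul_le_mul_of_nonneg_left (hC k) (sq_nonneg _)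
    linarith

/-- PAC-Bayes with a Gaussian prior having standard deviations s k. The exponential process indexed
by the coefficients has mean at most one for each fixed index, so its prior average is at most exp t
outside an event of probability exp (-t). On the complement the change of measure applies to every
shift at once: centring the posterior at w costs half of ∑ (w/s)², and no union bound over w is
needed. The second exceptional event controls the error of smoothing the truncation over the
posterior. -/
theorem measure_exists_sum_softClip_lt_le [IsProbabilityMeasure P] (hX : ∀ i, Measurable (X i))
    (hlaw : ∀ i, P.map (X i) = μ) (hind : iIndepFun X P) {y : ι → 𝒳 → ℝ}
    (hy : ∀ k, Measurable (y k)) (hy2 : ∀ k, MemLp (y k) 2 μ) {C : ℝ}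
    (hC : ∀ w : ι → ℝ, ∫ x, (∑ k, w k * y k x) ^ 2 ∂μ ≤ C * ∑ k, w k ^ 2)
    (s : ι → ℝ) (hs : ∀ k, 0 < s k) (n : ℕ) (t : ℝ) :
    P {ω | ∃ w : ι → ℝ, ∑ i ∈ Finset.range n, softClip (∑ k, w k * y k (X i ω))
        < n * (∑ k, w k * ∫ x, y k x ∂μ) - n * C * (11 * ∑ k, s k ^ 2 + 3 * ∑ k, w k ^ 2)
          - ∑ k, (w k / s k) ^ 2 - 6 * t}
      ≤ 2 * ENNReal.ofReal (Real.exp (-t)) := by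
  classical
  set α : ι → ℝ := fun k => ∫ x, y k x ∂μ with hα
  have hCk : ∀ k, ∫ x, y k x ^ 2 ∂μ ≤ C := fun k => by
    simpa [Pi.single_apply] using hC (Pi.single k 1)
  have hlin : ∀ w : ι → ℝ, MemLp (fun x => ∑ k, w k * y k x) 2 μ := fun w =>
    memLp_finsetSum _ fun k _ => (hy2 k).const_mul _
  have hmean : ∀ w : ι → ℝ, ∫ x, ∑ k, w k * y k x ∂μ = ∑ k, w k * α k := fun w => by
    rw [integral_finsetSum _ fun k _ => ((hy2 k).const_mul _).integrable one_le_two]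
    simp only [integral_const_mul, hα]
  set cb : (ι → ℝ) → ℝ := fun w => -(∑ k, w k * α k) / 2 + 3 / 2 * (C * ∑ k, w k ^ 2) with hcb
  -- one-sample exponential moment
  have hone : ∀ w : ι → ℝ,
      ∫⁻ x, ENNReal.ofReal (Real.exp (-(softClip (∑ k, w k * y k x) / 2))) ∂μ
        ≤ ENNReal.ofReal (Real.exp (cb w)) := by
    intro w
    have hi := (hlin w).integrable one_le_two
    have hi2 := (hlin w).integrable_sq
    have hA : Integrable (fun x => 1 - (∑ k, w k * y k x) / 2) μ :=
      (integrable_const _).sub (hi.div_const 2)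
    refine lintegral_exp_le_of_le (fun x => exp_neg_softClip_le _)
      (hA.add (hi2.const_mul (3 / 2))) ?_
    rw [integral_add hA (hi2.const_mul (3 / 2)), integral_sub (integrable_const _)
      (hi.div_const 2), integral_const_mul, integral_div, hmean]
    have := hC w
    simp only [integral_const, probReal_univ, smul_eq_mul, mul_one, hcb]
    linarith
  set Φ : Ω → (ι → ℝ) → ℝ := fun ω w =>
    ∑ i ∈ Finset.range n, -(softClip (∑ k, w k * y k (X i ω)) / 2) with hΦ
  have hφ2 : ∀ w : ι → ℝ, Measurable fun x => -(softClip (∑ k, w k * y k x) / 2) := fun w =>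
    ((measurable_softClip.comp (by fun_prop)).div_const 2).neg
  have hΦw : ∀ w, Measurable fun ω => Φ ω w := fun w =>
    Finset.measurable_fun_sum _ fun i _ => (hφ2 w).comp (hX i)
  have hΦm : Measurable fun z : Ω × (ι → ℝ) => Φ z.1 (fun k => s k * z.2 k) := by
    refine Finset.measurable_fun_sum _ fun i _ => ((measurable_softClip.comp ?_).div_const 2).neg
    refine Finset.measurable_fun_sum _ fun k _ => ?_
    have h1 : Measurable fun z : Ω × (ι → ℝ) => y k (X i z.1) :=
      (hy k).comp ((hX i).comp measurable_fst)
    have h2 : Measurable fun z : Ω × (ι → ℝ) => z.2 k :=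
      (measurable_pi_apply k).comp measurable_snd
    exact (h2.const_mul (s k)).mul h1
  have hcbm : Measurable fun z : Ω × (ι → ℝ) => cb (fun k => s k * z.2 k) := by
    have : Measurable fun g : ι → ℝ => cb (fun k => s k * g k) := by
      simp only [hcb]; fun_prop
    exact this.comp measurable_snd
  -- The log-likelihood-type process, compensated by n times the bound `cb` on the one-sample log
  -- moment so that its exponential has expectation at most one.
  set Mf : Ω → (ι → ℝ) → ℝ := fun ω g =>
    Φ ω (fun k => s k * g k) - n * cb (fun k => s k * g k) with hMf
  have hMm : Measurable fun z : Ω × (ι → ℝ) => Mf z.1 z.2 := hΦm.sub (hcbm.const_mul _)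
  have hem : Measurable fun z : Ω × (ι → ℝ) => ENNReal.ofReal (Real.exp (Mf z.1 z.2)) :=
    (Real.measurable_exp.comp hMm).ennreal_ofReal
  have htot : ∫⁻ ω, ∫⁻ g, ENNReal.ofReal (Real.exp (Mf ω g)) ∂(stdGauss ι) ∂P
      ≤ ENNReal.ofReal (Real.exp 0) := by
    rw [lintegral_lintegral_swap hem.aemeasurable]
    have : ∀ g : ι → ℝ, ∫⁻ ω, ENNReal.ofReal (Real.exp (Mf ω g)) ∂P ≤ 1 := by
      intro g
      have h1 : ∫⁻ ω, ENNReal.ofReal (Real.exp (Φ ω fun k => s k * g k)) ∂P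
          ≤ ENNReal.ofReal (Real.exp (n * cb fun k => s k * g k)) :=
        lintegral_exp_sum_le hX hlaw hind (hφ2 fun k => s k * g k) (hone fun k => s k * g k) n
      have h2 : ∀ ω, ENNReal.ofReal (Real.exp (Mf ω g))
          = ENNReal.ofReal (Real.exp (Φ ω fun k => s k * g k))
            * ENNReal.ofReal (Real.exp (-(n * cb fun k => s k * g k))) := by
        intro ω
        rw [← ENNReal.ofReal_mul (Real.exp_pos _).le, ← Real.exp_add, ← sub_eq_add_neg]
      rw [lintegral_congr h2, lintegral_mul_const
        (f := fun ω => ENNReal.ofReal (Real.exp (Φ ω fun k => s k * g k))) _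
        (Real.measurable_exp.comp (hΦw fun k => s k * g k)).ennreal_ofReal]
      refine (mul_le_mul' h1 le_rfl).trans (le_of_eq ?_)
      rw [← ENNReal.ofReal_mul (Real.exp_pos _).le, ← Real.exp_add, add_neg_cancel, Real.exp_zero,
        ENNReal.ofReal_one]
    calc _ ≤ ∫⁻ _g : ι → ℝ, 1 ∂(stdGauss ι) := lintegral_mono this
      _ = _ := by simp
  have hE1 := measure_exp_ge_le (hem.lintegral_prod_right').aemeasurable htot t
  have hE2 := measure_sum_min_gt_le hX hlaw hind hy hy2 hCk s n t
  rw [zero_add] at hE1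
  rw [two_mul]
  refine le_trans (measure_mono ?_) ((measure_union_le _ _).trans (add_le_add hE1 hE2))
  intro ω hω
  by_contra hgood
  simp only [mem_union, not_or] at hgood
  have hg1 : ∫⁻ g, ENNReal.ofReal (Real.exp (Mf ω g)) ∂(stdGauss ι) ≤ ENNReal.ofReal (Real.exp t) :=
    not_lt.1 hgood.1
  have hg2 : ∑ i ∈ Finset.range n, min 1 (∑ k, (s k * y k (X i ω)) ^ 2)
      ≤ n * (2 * (C * ∑ k, s k ^ 2)) + t := not_lt.1 hgood.2
  obtain ⟨w, hw⟩ := hω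
  -- Translating the standard Gaussian by w/s before scaling by s turns the prior into the posterior
  -- centred at w.
  set a : ι → ℝ := fun k => w k / s k with ha
  have hsa : ∀ k (g : ι → ℝ), s k * (g + a) k = w k + s k * g k := by
    intro k g
    have := (hs k).ne'
    simp only [Pi.add_apply, ha]
    field_simp
    ring
  obtain ⟨hq1, hq2⟩ := stdGauss_integral_sum_sq s w
  have hsc : ∀ i, ∀ g : ι → ℝ, softClip (∑ k, s k * (g + a) k * y k (X i ω))
      = softClip ((∑ k, w k * y k (X i ω)) + ∑ k, (s k * y k (X i ω)) * g k) := by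
    intro i g
    congr 1
    rw [← Finset.sum_add_distrib]
    refine Finset.sum_congr rfl fun k _ => ?_
    rw [hsa]; ring
  have hi1 : ∀ i, Integrable (fun g : ι → ℝ => -(softClip (∑ k, s k * (g + a) k * y k (X i ω)) / 2))
      (stdGauss ι) := by
    intro i
    refine Integrable.of_bound (C := 2) ?_ (ae_of_all _ fun g => ?_)
    · exact ((measurable_softClip.comp (by fun_prop)).div_const 2).neg.aestronglyMeasurable
    · rw [norm_neg, Real.norm_eq_abs, abs_div, abs_of_pos (by norm_num : (0 : ℝ) < 2)]
      linarith [abs_softClip_le (∑ k, s k * (g + a) k * y k (X i ω))]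
  have hcbe : ∀ g : ι → ℝ, cb (fun k => s k * (g + a) k)
      = (-(∑ k, w k * α k) / 2 + ∑ k, (-(s k * α k) / 2) * g k)
        + 3 / 2 * (C * ∑ k, (w k + s k * g k) ^ 2) := by
    intro g
    simp only [hcb, hsa]
    congr 1
    simp only [add_mul, Finset.sum_add_distrib, neg_add, add_div]
    congr 1
    rw [← Finset.sum_neg_distrib, Finset.sum_div]
    exact Finset.sum_congr rfl fun k _ => by ring
  have hl1 : Integrable (fun g : ι → ℝ => -(∑ k, w k * α k) / 2 + ∑ k, (-(s k * α k) / 2) * g k)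
      (stdGauss ι) :=
    (integrable_const _).add ((stdGauss_memLp_linear _).integrable one_le_two)
  have hi2 : Integrable (fun g : ι → ℝ => cb (fun k => s k * (g + a) k)) (stdGauss ι) := by
    simp only [hcbe]
    exact hl1.add ((hq1.const_mul C).const_mul _)
  have hi2v : ∫ g, cb (fun k => s k * (g + a) k) ∂(stdGauss ι)
      = -(∑ k, w k * α k) / 2 + 3 / 2 * (C * (∑ k, w k ^ 2 + ∑ k, s k ^ 2)) := by
    simp only [hcbe]
    rw [integral_add hl1 ((hq1.const_mul C).const_mul _), integral_const_mul, integral_const_mul,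
      hq2, integral_add (integrable_const _) ((stdGauss_memLp_linear _).integrable one_le_two),
      stdGauss_integral_linear]
    simp
  have hsumint := integrable_finsetSum (Finset.range n) fun i _ => hi1 i
  have hint : Integrable (fun g => Mf ω (g + a)) (stdGauss ι) := hsumint.sub (hi2.const_mul _)
  have hMω : Measurable (Mf ω) := by
    have h := hMm.comp (measurable_prodMk_left (x := ω))
    exact h
  have hmain := stdGauss_integral_shift_le hMω hg1 a hint
  have hval : ∫ g, Mf ω (g + a) ∂(stdGauss ι)
      = ∑ i ∈ Finset.range n, ∫ g, -(softClip (∑ k, s k * (g + a) k * y k (X i ω)) / 2) ∂(stdGauss ι)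
        - n * (-(∑ k, w k * α k) / 2 + 3 / 2 * (C * (∑ k, w k ^ 2 + ∑ k, s k ^ 2))) := by
    rw [← hi2v, ← integral_finsetSum _ fun i _ => hi1 i, ← integral_const_mul,
      ← integral_sub hsumint (hi2.const_mul _)]
  -- The posterior average of the truncation exceeds its value at the centre by at most 4 times the
  -- clipped variance; the factor 1/2 in the exponent leaves 2.
  have hterm : ∀ i, -(softClip (∑ k, w k * y k (X i ω)) / 2)
        - 2 * min 1 (∑ k, (s k * y k (X i ω)) ^ 2)
      ≤ ∫ g, -(softClip (∑ k, s k * (g + a) k * y k (X i ω)) / 2) ∂(stdGauss ι) := by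
    intro i
    simp only [hsc]
    rw [integral_neg, integral_div]
    have := integral_softClip_add_le (∑ k, w k * y k (X i ω)) fun k => s k * y k (X i ω)
    linarith
  have hsum := Finset.sum_le_sum fun i (_ : i ∈ Finset.range n) => hterm i
  rw [Finset.sum_sub_distrib, Finset.sum_neg_distrib, ← Finset.sum_div, ← Finset.mul_sum] at hsum
  rw [hval] at hmain
  have hn : (0 : ℝ) ≤ n := n.cast_nonneg
  -- After doubling, the mean of `cb` contributes 3 to each of ∑ s² and ∑ w². The smoothing error, 4
  -- times the clipped sum, contributes 8 more to ∑ s² and 4t to the 2t already present, giving 11,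
  -- 3 and 6.
  nlinarith [hw, hmain, hsum, hg2]

end pac

/-! ### Nets of ellipsoids -/

theorem summable_exp_neg_abs_int : Summable fun z : ℤ => Real.exp (-|(z : ℝ)|) := by
  refine Summable.of_nat_of_neg ?_ ?_
  · simpa using Real.summable_exp_neg_nat
  · simpa using Real.summable_exp_neg_nat

/-- A set on which `∑ b v² ≤ δ²` has a `√κ δ`-net in the Euclidean norm whose cardinality is
exponential in `∑ b⁻¹`. -/
theorem exists_net_of_ellipsoid {κ : ℝ} (hκ : 0 < κ) :
    ∃ A : ℝ, 0 ≤ A ∧ ∀ (ι : Type) [Fintype ι] (b : ι → ℝ) (D δ : ℝ) (S : Set (ι → ℝ)),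
      (∀ k, 1 ≤ b k) → ∑ k, (b k)⁻¹ ≤ D → 1 ≤ D → 0 < δ → (∀ v ∈ S, ∑ k, b k * v k ^ 2 ≤ δ ^ 2) →
      ∃ F : Finset (ι → ℝ), ↑F ⊆ S ∧ (F.card : ℝ) ≤ Real.exp (A * D) ∧
        ∀ v ∈ S, ∃ u ∈ F, ∑ k, (v k - u k) ^ 2 ≤ κ * δ ^ 2 := by
  classical
  -- Coordinates with b ≥ B are so short that ignoring them costs at most κ δ²/2; at most B D
  -- coordinates remain.
  set B : ℝ := 8 / κ with hB
  have hB0 : 0 < B := by positivity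
  set R : ℝ := B * (4 / κ + 2) with hR
  have hR0 : 0 < R := by positivity
  set W : ℝ := ∑' z : ℤ, Real.exp (-|(z : ℝ)|) with hW
  have hW1 : 1 ≤ W := by
    have := summable_exp_neg_abs_int.le_tsum (0 : ℤ) fun z _ => (Real.exp_pos _).le
    simpa using this
  refine ⟨R + B * Real.log W, by have := Real.log_nonneg hW1; positivity, ?_⟩
  intro ι _ b D δ S hb hbD hD hδ hS
  have hDpos : 0 < D := by linarith
  -- The mesh for which rounding the remaining coordinates, at most B D of them, costs another κ
  -- δ²/2.
  set h : ℝ := Real.sqrt (κ * δ ^ 2 / (2 * B * D)) with hh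
  have hh2 : h ^ 2 = κ * δ ^ 2 / (2 * B * D) := Real.sq_sqrt (by positivity)
  have hhpos : 0 < h := Real.sqrt_pos.2 (by positivity)
  set L : Finset ι := Finset.univ.filter fun k => b k < B with hL
  have hLcard : (L.card : ℝ) ≤ B * D := by
    have h1 : ∑ _k ∈ L, B⁻¹ ≤ D := by
      calc ∑ _k ∈ L, B⁻¹ ≤ ∑ k ∈ L, (b k)⁻¹ := by
            refine Finset.sum_le_sum fun k hk => ?_
            have : b k < B := (Finset.mem_filter.1 hk).2
            have := hb k
            gcongr
        _ ≤ ∑ k, (b k)⁻¹ := Finset.sum_le_sum_of_subset_of_nonneg (Finset.subset_univ _)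
            fun k _ _ => inv_nonneg.2 (by linarith [hb k])
        _ ≤ D := hbD
    rw [Finset.sum_const, nsmul_eq_mul, ← div_eq_mul_inv, div_le_iff₀ hB0] at h1
    linarith
  set zm : (ι → ℝ) → ι → ℤ := fun v k => if b k < B then ⌊v k / h⌋ else 0 with hzm
  have hvS : ∀ v ∈ S, ∑ k, v k ^ 2 ≤ δ ^ 2 := fun v hv =>
    (Finset.sum_le_sum fun k _ => by nlinarith [hb k, sq_nonneg (v k)]).trans (hS v hv)
  have hzsq : ∀ v ∈ S, ∑ k, ((zm v k : ℤ) : ℝ) ^ 2 ≤ R * D := by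
    intro v hv
    have h1 : ∀ k, ((zm v k : ℤ) : ℝ) ^ 2 ≤ 2 * (v k ^ 2 / h ^ 2) + if b k < B then 2 else 0 := by
      intro k
      simp only [hzm]
      split_ifs with hk
      · have e1 := Int.floor_le (v k / h)
        have e2 := Int.lt_floor_add_one (v k / h)
        rw [← div_pow]
        nlinarith [sq_nonneg (((⌊v k / h⌋ : ℤ) : ℝ) - 2 * (v k / h))]
      · rw [Int.cast_zero, add_zero, zero_pow two_ne_zero]
        positivity
    calc _ ≤ ∑ k, (2 * (v k ^ 2 / h ^ 2) + if b k < B then (2 : ℝ) else 0) :=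
          Finset.sum_le_sum fun k _ => h1 k
      _ = 2 * ((∑ k, v k ^ 2) / h ^ 2) + 2 * L.card := by
          rw [Finset.sum_add_distrib, ← Finset.mul_sum, ← Finset.sum_div, ← Finset.sum_filter,
            Finset.sum_const, nsmul_eq_mul, mul_comm (2 : ℝ) (L.card : ℝ)]
      _ ≤ 2 * (δ ^ 2 / h ^ 2) + 2 * (B * D) := by
          have := hvS v hv
          gcongr
      _ = R * D := by
          rw [hh2, hR]
          field_simp
          ring
  -- For integers |z| ≤ z², so the Euclidean bound gives an ℓ¹ bound. That is the form needed for
  -- counting with the summable weights exp (-|z|).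
  have hzabs : ∀ v ∈ S, ∑ k, |((zm v k : ℤ) : ℝ)| ≤ R * D := by
    intro v hv
    refine (Finset.sum_le_sum fun k _ => ?_).trans (hzsq v hv)
    rw [← sq_abs]
    have h3 : ∀ z : ℤ, |(z : ℝ)| ≤ |(z : ℝ)| ^ 2 := by
      intro z
      have : |z| ≤ |z| ^ 2 := by
        rcases eq_or_ne z 0 with rfl | hz
        · simp
        · have := Int.one_le_abs hz
          nlinarith
      exact_mod_cast this
    exact h3 _
  obtain ⟨m, hm⟩ := exists_nat_ge (R * D)
  set box : Finset (ι → ℤ) :=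
    Fintype.piFinset fun k => if b k < B then Finset.Icc (-(m : ℤ)) m else {0} with hbox
  have hzbox : ∀ v ∈ S, zm v ∈ box := by
    intro v hv
    rw [hbox, Fintype.mem_piFinset]
    intro k
    split_ifs with hk
    · have h1 : |((zm v k : ℤ) : ℝ)| ≤ m :=
        (Finset.single_le_sum (f := fun k => |((zm v k : ℤ) : ℝ)|) (fun _ _ => abs_nonneg _)
          (Finset.mem_univ k)).trans ((hzabs v hv).trans hm)
      have h2 : |zm v k| ≤ (m : ℤ) := by exact_mod_cast h1
      exact Finset.mem_Icc.2 (abs_le.1 h2)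
    · simp [hzm, hk]
  set T : Finset (ι → ℤ) := box.filter fun z => ∃ v ∈ S, zm v = z with hT
  have hTcard : (T.card : ℝ) ≤ Real.exp ((R + B * Real.log W) * D) := by
    -- Every rounded vector has weight at least exp (-R D), while the total weight of the box
    -- factors into one geometric-type sum per active coordinate. This avoids a logarithmic factor
    -- in the entropy.
    have h1 : (T.card : ℝ) * Real.exp (-(R * D)) ≤ W ^ L.card := by
      calc (T.card : ℝ) * Real.exp (-(R * D)) = ∑ _z ∈ T, Real.exp (-(R * D)) := by
            rw [Finset.sum_const, nsmul_eq_mul]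
        _ ≤ ∑ z ∈ T, ∏ k, Real.exp (-|((z k : ℤ) : ℝ)|) := by
            refine Finset.sum_le_sum fun z hz => ?_
            obtain ⟨v, hv, rfl⟩ := (Finset.mem_filter.1 hz).2
            rw [← Real.exp_sum, Finset.sum_neg_distrib]
            exact Real.exp_le_exp.2 (neg_le_neg (hzabs v hv))
        _ ≤ ∑ z ∈ box, ∏ k, Real.exp (-|((z k : ℤ) : ℝ)|) :=
            Finset.sum_le_sum_of_subset_of_nonneg (Finset.filter_subset _ _)
              fun z _ _ => Finset.prod_nonneg fun k _ => (Real.exp_pos _).le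
        _ = ∏ k, ∑ z ∈ (if b k < B then Finset.Icc (-(m : ℤ)) m else {0}),
              Real.exp (-|((z : ℤ) : ℝ)|) := by
            rw [hbox, Finset.prod_univ_sum]
        _ ≤ ∏ k, (if b k < B then W else 1) := by
            refine Finset.prod_le_prod (fun k _ => Finset.sum_nonneg fun z _ => (Real.exp_pos _).le)
              fun k _ => ?_
            split_ifs with hk
            · exact summable_exp_neg_abs_int.sum_le_tsum _ fun z _ => (Real.exp_pos _).le
            · simp
        _ = W ^ L.card := by
            rw [← Finset.prod_filter, Finset.prod_const]
    have h2 : W ^ L.card ≤ Real.exp (B * D * Real.log W) := by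
      rw [← Real.rpow_natCast, Real.rpow_def_of_pos (by linarith), mul_comm]
      exact Real.exp_le_exp.2 (mul_le_mul_of_nonneg_right hLcard (Real.log_nonneg hW1))
    have h3 : (T.card : ℝ) = T.card * Real.exp (-(R * D)) * Real.exp (R * D) := by
      rw [mul_assoc, ← Real.exp_add, neg_add_cancel, Real.exp_zero, mul_one]
    rw [h3]
    calc _ ≤ Real.exp (B * D * Real.log W) * Real.exp (R * D) := by
          gcongr
          exact h1.trans h2
      _ = _ := by rw [← Real.exp_add]; congr 1; ring
  -- One representative of each nonempty cell is taken in S itself, so net points inherit the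
  -- ellipsoid bound and every other property defining S.
  refine ⟨T.image (Function.invFunOn zm S), ?_, ?_, ?_⟩
  · intro u hu
    obtain ⟨z, hz, rfl⟩ := Finset.mem_image.1 (Finset.mem_coe.1 hu)
    exact Function.invFunOn_mem (Finset.mem_filter.1 hz).2
  · exact le_trans (by exact_mod_cast Finset.card_image_le) hTcard
  · intro v hv
    have hex : ∃ u ∈ S, zm u = zm v := ⟨v, hv, rfl⟩
    refine ⟨Function.invFunOn zm S (zm v), Finset.mem_image_of_mem _
      (Finset.mem_filter.2 ⟨hzbox v hv, v, hv, rfl⟩), ?_⟩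
    have huS := Function.invFunOn_mem hex
    have hzu := Function.invFunOn_eq hex
    set u := Function.invFunOn zm S (zm v)
    have h1 : ∀ k, (v k - u k) ^ 2 ≤ (if b k < B then h ^ 2 else 0)
        + 2 / B * (b k * v k ^ 2 + b k * u k ^ 2) := by
      intro k
      have hbk := hb k
      split_ifs with hk
      · have e : ⌊u k / h⌋ = ⌊v k / h⌋ := by
          have := congrFun hzu k
          simpa [hzm, hk] using this
        have e3 : |v k / h - u k / h| < 1 := Int.abs_sub_lt_one_of_floor_eq_floor e.symm
        rw [← sub_div, abs_div, abs_of_pos hhpos, div_lt_one hhpos] at e3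
        have e4 : (v k - u k) ^ 2 ≤ h ^ 2 := sq_le_sq' (by linarith [(abs_lt.1 e3).1])
          (abs_lt.1 e3).2.le
        have : 0 ≤ 2 / B * (b k * v k ^ 2 + b k * u k ^ 2) := by positivity
        linarith
      · have e5 : 1 ≤ b k / B := by rw [le_div_iff₀ hB0]; linarith
        have e6 : 2 / B * (b k * v k ^ 2 + b k * u k ^ 2)
            = 2 * (b k / B) * (v k ^ 2 + u k ^ 2) := by ring
        rw [e6, zero_add]
        nlinarith [sq_nonneg (v k + u k), sq_nonneg (v k), sq_nonneg (u k),
          mul_nonneg (sub_nonneg.2 e5) (add_nonneg (sq_nonneg (v k)) (sq_nonneg (u k)))]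
    calc _ ≤ ∑ k, ((if b k < B then h ^ 2 else 0)
        + 2 / B * (b k * v k ^ 2 + b k * u k ^ 2)) := Finset.sum_le_sum fun k _ => h1 k
      _ = L.card * h ^ 2 + 2 / B * (∑ k, b k * v k ^ 2 + ∑ k, b k * u k ^ 2) := by
        rw [Finset.sum_add_distrib, ← Finset.sum_filter, Finset.sum_const, nsmul_eq_mul,
          ← Finset.mul_sum, Finset.sum_add_distrib]
      _ ≤ B * D * h ^ 2 + 2 / B * (δ ^ 2 + δ ^ 2) := by
        have := hS v hv
        have := hS u huS
        gcongr
      _ = κ * δ ^ 2 := by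
        rw [hh2, hB]
        field_simp
        ring

/-! ### The empirical lower bound in finitely many coordinates -/

section empirical

variable {Ω 𝒳 : Type*} [MeasurableSpace Ω] [MeasurableSpace 𝒳] {P : Measure Ω} {μ : Measure 𝒳}
  {X : ℕ → Ω → 𝒳}

theorem integral_sum_sq_le [IsProbabilityMeasure P] (hX : ∀ i, Measurable (X i))
    (hlaw : ∀ i, P.map (X i) = μ) (hind : iIndepFun X P) {f : 𝒳 → ℝ} (hf : Measurable f)
    (hf2 : MemLp f 2 μ) (hf0 : ∫ x, f x ∂μ = 0) (n : ℕ) :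
    MemLp (fun ω => ∑ i ∈ Finset.range n, f (X i ω)) 2 P ∧
    ∫ ω, (∑ i ∈ Finset.range n, f (X i ω)) ^ 2 ∂P ≤ n * ∫ x, f x ^ 2 ∂μ := by
  have hmp : ∀ i, MeasurePreserving (X i) P μ := fun i => ⟨hX i, hlaw i⟩
  have h2 : ∀ i, MemLp (fun ω => f (X i ω)) 2 P := fun i => hf2.comp_measurePreserving (hmp i)
  have hmean : ∀ i, ∫ ω, f (X i ω) ∂P = 0 := fun i => by
    rw [← hf0, ← hlaw i, integral_map (hX i).aemeasurable hf.aestronglyMeasurable]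
  have hsum : MemLp (fun ω => ∑ i ∈ Finset.range n, f (X i ω)) 2 P :=
    memLp_finsetSum _ fun i _ => h2 i
  refine ⟨hsum, ?_⟩
  have hv := IndepFun.variance_sum (μ := P) (X := fun i ω => f (X i ω)) (s := Finset.range n)
    (fun i _ => h2 i) (fun i _ j _ hij => (hind.indepFun hij).comp hf hf)
  have e : (∑ i ∈ Finset.range n, fun ω => f (X i ω))
      = fun ω => ∑ i ∈ Finset.range n, f (X i ω) := by ext ω; simp
  rw [e, variance_eq_sub hsum, integral_finsetSum _ fun i _ => (h2 i).integrable one_le_two] at hv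
  simp only [hmean, Finset.sum_const_zero, Pi.pow_apply] at hv
  have hvi : ∀ i, Var[fun ω => f (X i ω); P] = ∫ x, f x ^ 2 ∂μ := by
    intro i
    rw [variance_eq_sub (h2 i), hmean, ← hlaw i, integral_map (hX i).aemeasurable
      (hf.pow_const 2).aestronglyMeasurable]
    simp
  simp only [hvi, Finset.sum_const, Finset.card_range, nsmul_eq_mul] at hv
  linarith

set_option maxHeartbeats 1000000 in
/-- In finitely many coordinates: a stochastic lower bound for sums of i.i.d. copies of random
functions `Z v` which are bounded below relative to each other, have good exponential moments, and
dominate their linearizations `y u` at each point `u`. -/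
theorem exists_uniform_lower_bound [IsProbabilityMeasure P] [IsProbabilityMeasure μ]
    (hX : ∀ i, Measurable (X i)) (hlaw : ∀ i, P.map (X i) = μ) (hind : iIndepFun X P)
    {c C ε : ℝ} (hc : 0 < c) (hC : 0 < C) (hε : 0 < ε) :
    ∃ K > 0, ∃ c₀ > 0, ∀ (ι : Type) [Fintype ι] (U : Set (ι → ℝ)) (Z : (ι → ℝ) → 𝒳 → ℝ)
      (y : (ι → ℝ) → ι → 𝒳 → ℝ) (b : ι → ℝ) (D δ : ℝ) (n : ℕ),
      U.Countable → 0 ∈ U → Z 0 = 0 → (∀ v ∈ U, Measurable (Z v)) →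
      (∀ u ∈ U, ∀ k, Measurable (y u k)) → (∀ u ∈ U, ∀ k, MemLp (y u k) 2 μ) →
      (∀ u ∈ U, ∀ v ∈ U, ∀ᵐ x ∂μ, -1 ≤ Z v x - Z u x) →
      (∀ v ∈ U, ∫⁻ x, ENNReal.ofReal (Real.exp (-Z v x)) ∂μ
        ≤ ENNReal.ofReal (Real.exp (-(c * ∑ k, v k ^ 2)))) →
      (∀ u ∈ U, ∀ v ∈ U, ∀ᵐ x ∂μ, ∑ k, (v k - u k) * y u k x ≤ Z v x - Z u x) →
      (∀ u ∈ U, ∀ w : ι → ℝ, -(C * Real.sqrt (∑ k, u k ^ 2) * Real.sqrt (∑ k, w k ^ 2))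
        ≤ ∑ k, w k * ∫ x, y u k x ∂μ) →
      (∀ u ∈ U, ∀ w : ι → ℝ, ∫ x, (∑ k, w k * y u k x) ^ 2 ∂μ ≤ C * ∑ k, w k ^ 2) →
      (∀ k, 1 ≤ b k) → ∑ k, (b k)⁻¹ ≤ D → 1 ≤ D → 0 < δ → K * D ≤ n * δ ^ 2 →
      P {ω | ∃ v ∈ U, δ ^ 2 / 4 < ∑ k, v k ^ 2 ∧ ∑ k, v k ^ 2 < 4 * δ ^ 2 ∧
        ∑ i ∈ Finset.range n, Z v (X i ω) + n / 4 * ∑ k, (b k - 1) * v k ^ 2 ≤ n * (c₀ * δ ^ 2)}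
        ≤ ENNReal.ofReal ε := by
  classical
  -- The net radius relative to δ: small enough that the mean and variance terms of an increment are
  -- negligible against the curvature c.
  set q : ℝ := min 1 (c / (200 * C)) with hq
  have hq0 : 0 < q := lt_min one_pos (by positivity)
  have hq1 : q ≤ 1 := min_le_left _ _
  have hqC : C * q ≤ c / 200 := by
    have := mul_le_mul_of_nonneg_left (min_le_right 1 (c / (200 * C))) hC.le
    calc C * q ≤ C * (c / (200 * C)) := this
      _ = c / 200 := by field_simp
  set κ₁ : ℝ := c / (1000 * C) with hκ₁
  have hκ₁0 : 0 < κ₁ := by positivity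
  have hκ₁C : C * κ₁ = c / 1000 := by rw [hκ₁]; field_simp
  set τ : ℝ := c / 1000 with hτ
  have hτ0 : 0 < τ := by positivity
  obtain ⟨A, hA0, hA⟩ := exists_net_of_ellipsoid (κ := q ^ 2 / 8) (by positivity)
  -- The three terms pay, in order, for the union bound over the net, for the cost of the Gaussian
  -- shift, and for Markov's inequality in the large-penalty case.
  set K : ℝ := (A + |Real.log (6 / ε)|) / τ + 32 * 1000 / (κ₁ * c) + 64 * C / ε with hK
  have hKa : A + |Real.log (6 / ε)| ≤ τ * K := by
    have : τ * ((A + |Real.log (6 / ε)|) / τ) = A + |Real.log (6 / ε)| := by field_simp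
    have h2 : 0 ≤ τ * (32 * 1000 / (κ₁ * c) + 64 * C / ε) := by positivity
    rw [hK]; linarith
  have hab : 0 ≤ (A + |Real.log (6 / ε)|) / τ := by positivity
  have hKb : 32 * 1000 / (κ₁ * c) ≤ K := by
    have : 0 ≤ 64 * C / ε := by positivity
    rw [hK]; linarith
  have hKc : 64 * C / ε ≤ K := by
    have : 0 ≤ 32 * 1000 / (κ₁ * c) := by positivity
    rw [hK]; linarith
  have hK0 : 0 < K := lt_of_lt_of_le (by positivity) hKc
  set c₀ : ℝ := min (c / 8) (1 / 4) with hc₀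
  have hc₀0 : 0 < c₀ := lt_min (by positivity) (by norm_num)
  have hc₀a : c₀ ≤ c / 8 := min_le_left _ _
  have hc₀b : c₀ ≤ 1 / 4 := min_le_right _ _
  refine ⟨K, hK0, c₀, hc₀0, ?_⟩
  intro ι _ U Z y b D δ n hUc h0U hZ0 hZm hym hy2 hlow hexp hlin hmean hsq hb hbD hD hδ hKD
  have hDpos : 0 < D := by linarith
  have hδ2 : 0 < δ ^ 2 := by positivity
  have hnpos : (0 : ℝ) < n := by
    by_contra h
    have : (n : ℝ) = 0 := le_antisymm (not_lt.1 h) n.cast_nonneg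
    rw [this, zero_mul] at hKD
    linarith [mul_pos hK0 hDpos]
  have hnδ : 0 < n * δ ^ 2 := by positivity
  -- the linear term at the origin
  have hα0 : ∀ k, ∫ x, y 0 k x ∂μ = 0 := by
    intro k
    have h1 := hmean 0 h0U (Pi.single k 1)
    have h2 := hmean 0 h0U (Pi.single k (-1))
    simp [Pi.single_apply] at h1 h2
    linarith
  have hy0sq : ∀ k, ∫ x, y 0 k x ^ 2 ∂μ ≤ C := fun k => by
    simpa [Pi.single_apply] using hsq 0 h0U (Pi.single k 1)
  set S : ι → Ω → ℝ := fun k ω => ∑ i ∈ Finset.range n, y 0 k (X i ω) with hS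
  have hSint : ∀ k, MemLp (S k) 2 P ∧ ∫ ω, S k ω ^ 2 ∂P ≤ n * C := fun k => by
    obtain ⟨h1, h2⟩ := integral_sum_sq_le hX hlaw hind (hym 0 h0U k) (hy2 0 h0U k) (hα0 k) n
    exact ⟨h1, h2.trans (mul_le_mul_of_nonneg_left (hy0sq k) hnpos.le)⟩
  -- The score at the origin is centred, so the dual ellipsoid norm of its sum has expectation at
  -- most n C D: the effective dimension enters instead of the number of coordinates.
  have hE0 : P {ω | 2 * (n * C * D) / ε < ∑ k, (b k)⁻¹ * S k ω ^ 2} ≤ ENNReal.ofReal (ε / 2) := by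
    have hbk : ∀ k, 0 ≤ (b k)⁻¹ := fun k => inv_nonneg.2 (by linarith [hb k])
    have hi : ∀ k, Integrable (fun ω => (b k)⁻¹ * S k ω ^ 2) P := fun k =>
      (hSint k).1.integrable_sq.const_mul _
    have hI : ∫ ω, ∑ k, (b k)⁻¹ * S k ω ^ 2 ∂P ≤ n * C * D := by
      rw [integral_finsetSum _ fun k _ => hi k]
      simp only [integral_const_mul]
      calc _ ≤ ∑ k, (b k)⁻¹ * (n * C) :=
            Finset.sum_le_sum fun k _ => mul_le_mul_of_nonneg_left (hSint k).2 (hbk k)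
        _ = (∑ k, (b k)⁻¹) * (n * C) := by rw [Finset.sum_mul]
        _ ≤ D * (n * C) := by gcongr
        _ = _ := by ring
    have hM := mul_meas_ge_le_integral_of_nonneg (μ := P)
      (f := fun ω => ∑ k, (b k)⁻¹ * S k ω ^ 2)
      (ae_of_all _ fun ω => Finset.sum_nonneg fun k _ => mul_nonneg (hbk k) (sq_nonneg _))
      (integrable_finsetSum _ fun k _ => hi k) (2 * (n * C * D) / ε)
    have hpos : 0 < 2 * (n * C * D) / ε := by positivity
    have h3 : P.real {ω | 2 * (n * C * D) / ε ≤ ∑ k, (b k)⁻¹ * S k ω ^ 2} ≤ ε / 2 := by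
      have h4 := hM.trans hI
      rw [mul_comm, ← le_div_iff₀ hpos] at h4
      refine h4.trans (le_of_eq ?_)
      field_simp
    calc _ ≤ P {ω | 2 * (n * C * D) / ε ≤ ∑ k, (b k)⁻¹ * S k ω ^ 2} :=
          measure_mono fun ω hω => le_of_lt (show _ < ∑ k, (b k)⁻¹ * S k ω ^ 2 from hω)
      _ ≤ _ := by
        rw [← ofReal_measureReal]
        exact ENNReal.ofReal_le_ofReal h3
  -- the net
  set V : Set (ι → ℝ) := {v | v ∈ U ∧ δ ^ 2 / 4 < ∑ k, v k ^ 2 ∧ ∑ k, v k ^ 2 < 4 * δ ^ 2 ∧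
    ∑ k, b k * v k ^ 2 ≤ 8 * δ ^ 2} with hV
  obtain ⟨F, hFV, hFcard, hFnet⟩ := hA ι b D (Real.sqrt 8 * δ) V hb hbD hD (by positivity)
    (fun v hv => by rw [mul_pow, Real.sq_sqrt (by norm_num)]; exact hv.2.2.2)
  -- Posterior variances proportional to b⁻¹: their sum is at most κ₁ δ², while the shift cost ∑
  -- (w/s)² is of order D on the ellipsoid, negligible against n δ².
  set s : ι → ℝ := fun k => Real.sqrt (κ₁ * δ ^ 2 / D * (b k)⁻¹) with hs
  have hbpos : ∀ k, 0 < b k := fun k => by linarith [hb k]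
  have hspos : ∀ k, 0 < s k := fun k =>
    Real.sqrt_pos.2 (mul_pos (by positivity) (inv_pos.2 (hbpos k)))
  have hs2 : ∀ k, s k ^ 2 = κ₁ * δ ^ 2 / D * (b k)⁻¹ := fun k =>
    Real.sq_sqrt (mul_nonneg (by positivity) (inv_nonneg.2 (hbpos k).le))
  have hssum : ∑ k, s k ^ 2 ≤ κ₁ * δ ^ 2 := by
    simp only [hs2]
    rw [← Finset.mul_sum]
    calc _ ≤ κ₁ * δ ^ 2 / D * D := by gcongr
      _ = _ := by field_simp
  set t : ℝ := τ * (n * δ ^ 2) with ht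
  set E1 : (ι → ℝ) → Set Ω := fun u =>
    {ω | n * (-(c * ∑ k, u k ^ 2)) + t < ∑ i ∈ Finset.range n, -Z u (X i ω)} with hE1
  set E2 : (ι → ℝ) → Set Ω := fun u =>
    {ω | ∃ w : ι → ℝ, ∑ i ∈ Finset.range n, softClip (∑ k, w k * y u k (X i ω))
        < n * (∑ k, w k * ∫ x, y u k x ∂μ) - n * C * (11 * ∑ k, s k ^ 2 + 3 * ∑ k, w k ^ 2)
          - ∑ k, (w k / s k) ^ 2 - 6 * t} with hE2
  have hPE1 : ∀ u ∈ F, P (E1 u) ≤ ENNReal.ofReal (Real.exp (-t)) := fun u hu =>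
    measure_sum_gt_le hX hlaw hind (hZm u (hFV hu).1).neg (hexp u (hFV hu).1) n t
  have hPE2 : ∀ u ∈ F, P (E2 u) ≤ 2 * ENNReal.ofReal (Real.exp (-t)) := fun u hu =>
    measure_exists_sum_softClip_lt_le hX hlaw hind (hym u (hFV hu).1) (hy2 u (hFV hu).1)
      (hsq u (hFV hu).1) s hspos n t
  have hPF : P (⋃ u ∈ F, (E1 u ∪ E2 u)) ≤ ENNReal.ofReal (ε / 2) := by
    calc _ ≤ ∑ u ∈ F, P (E1 u ∪ E2 u) := measure_biUnion_finset_le _ _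
      _ ≤ ∑ _u ∈ F, ENNReal.ofReal (3 * Real.exp (-t)) := by
        refine Finset.sum_le_sum fun u hu => ?_
        refine (measure_union_le _ _).trans ((add_le_add (hPE1 u hu) (hPE2 u hu)).trans ?_)
        rw [ENNReal.ofReal_mul (by norm_num), ENNReal.ofReal_ofNat]
        apply le_of_eq; ring
      _ = ENNReal.ofReal (F.card * (3 * Real.exp (-t))) := by
        rw [Finset.sum_const, nsmul_eq_mul, ENNReal.ofReal_mul (Nat.cast_nonneg F.card),
          ENNReal.ofReal_natCast]
      _ ≤ _ := by
        refine ENNReal.ofReal_le_ofReal ?_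
        calc _ ≤ Real.exp (A * D) * (3 * Real.exp (-t)) := by gcongr
          _ = 3 * Real.exp (A * D - t) := by rw [sub_eq_add_neg, Real.exp_add]; ring
          _ ≤ 3 * Real.exp (-Real.log (6 / ε)) := by
            gcongr
            have h1 : (A + |Real.log (6 / ε)|) * D ≤ t := by
              calc _ ≤ τ * K * D := by gcongr
                _ = τ * (K * D) := by ring
                _ ≤ t := by rw [ht]; gcongr
            have h2 := le_mul_of_one_le_right (abs_nonneg (Real.log (6 / ε))) hD
            linarith [le_abs_self (Real.log (6 / ε))]
          _ = ε / 2 := by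
            rw [Real.exp_neg, Real.exp_log (by positivity)]
            field_simp
            norm_num
  -- almost sure relations along the sample
  have hae : ∀ {p : 𝒳 → Prop}, (∀ᵐ x ∂μ, p x) → ∀ᵐ ω ∂P, ∀ i, p (X i ω) := by
    intro p hp
    rw [ae_all_iff]
    intro i
    rw [← hlaw i] at hp
    exact ae_of_ae_map (hX i).aemeasurable hp
  have hN : ∀ᵐ ω ∂P, ∀ u ∈ U, ∀ v ∈ U, ∀ i, -1 ≤ Z v (X i ω) - Z u (X i ω) ∧
      ∑ k, (v k - u k) * y u k (X i ω) ≤ Z v (X i ω) - Z u (X i ω) := by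
    rw [ae_ball_iff hUc]
    intro u hu
    rw [ae_ball_iff hUc]
    intro v hv
    exact hae ((hlow u hu v hv).and (hlin u hu v hv))
  have hsub : {ω | ∃ v ∈ U, δ ^ 2 / 4 < ∑ k, v k ^ 2 ∧ ∑ k, v k ^ 2 < 4 * δ ^ 2 ∧
        ∑ i ∈ Finset.range n, Z v (X i ω) + n / 4 * ∑ k, (b k - 1) * v k ^ 2 ≤ n * (c₀ * δ ^ 2)}
      ≤ᵐ[P] ({ω | 2 * (n * C * D) / ε < ∑ k, (b k)⁻¹ * S k ω ^ 2} ∪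
        ⋃ u ∈ F, (E1 u ∪ E2 u) : Set Ω) := by
    filter_upwards [hN] with ω hω
    rintro ⟨v, hvU, hv1, hv2, hv3⟩
    by_contra hgood
    replace hgood : ω ∉ ({ω | 2 * (n * C * D) / ε < ∑ k, (b k)⁻¹ * S k ω ^ 2} ∪
        ⋃ u ∈ F, (E1 u ∪ E2 u) : Set Ω) := hgood
    simp only [mem_union, mem_iUnion, not_or, not_exists] at hgood
    obtain ⟨hg0, hgF⟩ := hgood
    replace hg0 : ∑ k, (b k)⁻¹ * S k ω ^ 2 ≤ 2 * (n * C * D) / ε := not_lt.1 hg0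
    set G : ℝ := ∑ k, (b k - 1) * v k ^ 2 with hG
    have hG0 : 0 ≤ G := Finset.sum_nonneg fun k _ =>
      mul_nonneg (by linarith [hb k]) (sq_nonneg _)
    have hbv : ∑ k, b k * v k ^ 2 = ∑ k, v k ^ 2 + G := by
      rw [hG, ← Finset.sum_add_distrib]
      exact Finset.sum_congr rfl fun k _ => by ring
    -- A penalty below 4 δ², together with ∑ v² < 4 δ², places v in the ellipsoid of squared radius
    -- 8 δ² on which the net was built; otherwise the penalty itself dominates the score.
    rcases le_total (4 * δ ^ 2) G with hcase | hcase
    · -- large penalty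
      have h1 : ∑ k, v k * S k ω ≤ ∑ i ∈ Finset.range n, Z v (X i ω) := by
        have h2 : ∀ i, ∑ k, v k * y 0 k (X i ω) ≤ Z v (X i ω) := fun i => by
          have := (hω 0 h0U v hvU i).2
          simpa [hZ0] using this
        refine le_trans (le_of_eq ?_) (Finset.sum_le_sum fun i _ => h2 i)
        rw [Finset.sum_comm]
        refine Finset.sum_congr rfl fun k _ => ?_
        rw [hS, Finset.mul_sum]
      -- Young's inequality with weight b. The factor 1/16 makes the quadratic part at most n G/8,
      -- half of the available penalty n G/4.
      have h3 : ∀ k, -(v k * S k ω) ≤ n / 16 * (b k * v k ^ 2) + 4 / n * ((b k)⁻¹ * S k ω ^ 2) := by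
        intro k
        have hbk := hbpos k
        have e : n / 16 * (b k * v k ^ 2) + 4 / n * ((b k)⁻¹ * S k ω ^ 2) + v k * S k ω
            = (n * b k * v k + 8 * S k ω) ^ 2 / (16 * n * b k) := by
          field_simp
          ring
        have : 0 ≤ (n * b k * v k + 8 * S k ω) ^ 2 / (16 * n * b k) := by positivity
        linarith
      have h4 := Finset.sum_le_sum fun k (_ : k ∈ Finset.univ) => h3 k
      rw [Finset.sum_neg_distrib, Finset.sum_add_distrib, ← Finset.mul_sum, ← Finset.mul_sum,
        hbv] at h4
      have h5 : 4 / n * (∑ k, (b k)⁻¹ * S k ω ^ 2) ≤ n * δ ^ 2 / 8 := by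
        calc _ ≤ 4 / n * (2 * (n * C * D) / ε) := by gcongr
          _ = (64 * C / ε) * D / 8 := by field_simp; ring
          _ ≤ K * D / 8 := by gcongr
          _ ≤ _ := by linarith
      have h6 : c₀ * (n * δ ^ 2) ≤ 1 / 4 * (n * δ ^ 2) := by gcongr
      have h7 : n / 16 * (∑ k, v k ^ 2 + G) ≤ n / 16 * (2 * G) := by
        gcongr; linarith
      have h8 : n * (4 * δ ^ 2) ≤ n * G := by gcongr
      linarith
    · -- small penalty
      have hvV : v ∈ V := ⟨hvU, hv1, hv2, by rw [hbv]; linarith⟩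
      obtain ⟨u, huF, hu⟩ := hFnet v hvV
      have hu' : ∑ k, (v k - u k) ^ 2 ≤ q ^ 2 * δ ^ 2 := by
        rw [mul_pow, Real.sq_sqrt (by norm_num)] at hu
        linarith
      obtain ⟨huU, hu1, hu2, hu3⟩ := hFV huF
      have hgu : ω ∉ E1 u ∧ ω ∉ E2 u := hgF u huF
      have hg1 : ∑ i ∈ Finset.range n, -Z u (X i ω) ≤ n * (-(c * ∑ k, u k ^ 2)) + t :=
        not_lt.1 hgu.1
      set w : ι → ℝ := fun k => v k - u k with hw
      have hg2 : n * (∑ k, w k * ∫ x, y u k x ∂μ)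
          - n * C * (11 * ∑ k, s k ^ 2 + 3 * ∑ k, w k ^ 2) - ∑ k, (w k / s k) ^ 2 - 6 * t
          ≤ ∑ i ∈ Finset.range n, softClip (∑ k, w k * y u k (X i ω)) := by
        by_contra hlt
        exact hgu.2 ⟨w, not_le.1 hlt⟩
      -- The increment is bounded below by -1 and by its linearization at u, hence by the truncated
      -- linearization.
      have h1 : ∑ i ∈ Finset.range n, softClip (∑ k, w k * y u k (X i ω))
          ≤ ∑ i ∈ Finset.range n, (Z v (X i ω) - Z u (X i ω)) :=
        Finset.sum_le_sum fun i _ => softClip_le (hω u huU v hvU i).2 (hω u huU v hvU i).1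
      rw [Finset.sum_sub_distrib] at h1
      rw [Finset.sum_neg_distrib] at hg1
      have h2 : -(c / 100 * δ ^ 2) ≤ ∑ k, w k * ∫ x, y u k x ∂μ := by
        refine le_trans ?_ (hmean u huU w)
        have a1 : Real.sqrt (∑ k, u k ^ 2) ≤ 2 * δ :=
          Real.sqrt_le_iff.2 ⟨by positivity, by linarith⟩
        have a2 : Real.sqrt (∑ k, w k ^ 2) ≤ q * δ :=
          Real.sqrt_le_iff.2 ⟨by positivity, by rw [mul_pow]; exact hu'⟩
        have a3 : C * Real.sqrt (∑ k, u k ^ 2) * Real.sqrt (∑ k, w k ^ 2)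
            ≤ C * (2 * δ) * (q * δ) := by gcongr
        have a4 : C * q * (2 * δ ^ 2) ≤ c / 200 * (2 * δ ^ 2) := by gcongr
        linarith
      have h3 : C * (11 * ∑ k, s k ^ 2 + 3 * ∑ k, w k ^ 2) ≤ c * (26 / 1000) * δ ^ 2 := by
        have a1 : C * (11 * ∑ k, s k ^ 2 + 3 * ∑ k, w k ^ 2)
            ≤ C * (11 * (κ₁ * δ ^ 2) + 3 * (q ^ 2 * δ ^ 2)) := by gcongr
        have a2 : C * q * q * δ ^ 2 ≤ c / 200 * 1 * δ ^ 2 := by gcongr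
        have a3 : C * κ₁ * δ ^ 2 = c / 1000 * δ ^ 2 := by rw [hκ₁C]
        linarith
      have h4 : ∑ k, (w k / s k) ^ 2 ≤ c / 1000 * (n * δ ^ 2) := by
        have a1 : ∀ k, (w k / s k) ^ 2 ≤ D / (κ₁ * δ ^ 2) * (2 * (b k * v k ^ 2) + 2 * (b k * u k ^ 2)) := by
          intro k
          have hbk := hbpos k
          have e : (w k / s k) ^ 2 = D / (κ₁ * δ ^ 2) * (b k * w k ^ 2) := by
            rw [div_pow, hs2]
            field_simp
          rw [e]
          have : w k ^ 2 ≤ 2 * v k ^ 2 + 2 * u k ^ 2 := by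
            simp only [hw]; linarith [sq_nonneg (v k + u k)]
          have : b k * w k ^ 2 ≤ 2 * (b k * v k ^ 2) + 2 * (b k * u k ^ 2) := by
            linarith [mul_le_mul_of_nonneg_left this hbk.le]
          gcongr
        have a2 := Finset.sum_le_sum fun k (_ : k ∈ Finset.univ) => a1 k
        rw [← Finset.mul_sum, Finset.sum_add_distrib, ← Finset.mul_sum, ← Finset.mul_sum] at a2
        calc _ ≤ _ := a2
          _ ≤ D / (κ₁ * δ ^ 2) * (2 * (8 * δ ^ 2) + 2 * (8 * δ ^ 2)) := by
            have := hvV.2.2.2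
            gcongr
          _ = c / 1000 * (32 * 1000 / (κ₁ * c) * D) := by field_simp; ring
          _ ≤ c / 1000 * (K * D) := by gcongr
          _ ≤ _ := by gcongr
      have h5 : n * (c * (δ ^ 2 / 4)) ≤ n * (c * ∑ k, u k ^ 2) := by gcongr
      have h6 : c₀ * (n * δ ^ 2) ≤ c / 8 * (n * δ ^ 2) := by gcongr
      have h7 : n * -(c / 100 * δ ^ 2) ≤ n * ∑ k, w k * ∫ x, y u k x ∂μ := by gcongr
      have h8 : n * (C * (11 * ∑ k, s k ^ 2 + 3 * ∑ k, w k ^ 2)) ≤ n * (c * (26 / 1000) * δ ^ 2) := by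
        gcongr
      have h9 : 0 ≤ n / 4 * G := by positivity
      have h10 : t = c / 1000 * (n * δ ^ 2) := rfl
      have h11 : 0 < c * (n * δ ^ 2) := by positivity
      -- In units of c n δ², the net point gains at least 1/4 and the errors add up to 44/1000,
      -- leaving more than the 1/8 allowed by c₀.
      linarith
  refine (measure_mono_ae hsub).trans ((measure_union_le _ _).trans ?_)
  refine (add_le_add hE0 hPF).trans (le_of_eq ?_)
  rw [← ENNReal.ofReal_add (by positivity) (by positivity), add_halves]

end empirical

/-! ### Density ratios -/

section density

variable {𝒳 : Type*} [MeasurableSpace 𝒳] {μ : Measure 𝒳}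

theorem tilted_real_apply (f : 𝒳 → ℝ) {s : Set 𝒳} (hs : MeasurableSet s) :
    (μ.tilted f).real s = ∫ x in s, Real.exp (f x) / ∫ y, Real.exp (f y) ∂μ ∂μ := by
  rw [Measure.real, tilted_apply_eq_ofReal_integral' f hs, ENNReal.toReal_ofReal]
  exact setIntegral_nonneg hs fun x _ =>
    div_nonneg (Real.exp_pos _).le (integral_nonneg fun y => (Real.exp_pos _).le)

/-- If the variances of indicator functions under `μ.tilted f` and `μ` are comparable, then the
density of `μ.tilted f` is bounded above and below. -/
theorem exists_density_bound [IsProbabilityMeasure μ] {G : Set 𝒳} (hG : MeasurableSet G)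
    (hG0 : 0 < μ.real G) (hG1 : μ.real G < 1) {C₃ C₄ : ℝ} (hC₃ : 0 < C₃) (hC₄ : 0 < C₄) :
    ∃ K : ℝ, 1 ≤ K ∧ ∀ f : 𝒳 → ℝ, Measurable f → Integrable (fun x => Real.exp (f x)) μ →
      (∀ s, MeasurableSet s → C₃ * (μ.real s * (1 - μ.real s))
          ≤ (μ.tilted f).real s * (1 - (μ.tilted f).real s) ∧
        (μ.tilted f).real s * (1 - (μ.tilted f).real s) ≤ C₄ * (μ.real s * (1 - μ.real s))) →
      ∀ᵐ x ∂μ, K⁻¹ ≤ Real.exp (f x) / ∫ y, Real.exp (f y) ∂μ ∧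
        Real.exp (f x) / ∫ y, Real.exp (f y) ∂μ ≤ K := by
  set e : ℝ := min (μ.real G) (1 - μ.real G) with he
  have he0 : 0 < e := lt_min hG0 (by linarith)
  have he1 : e ≤ μ.real G := min_le_left _ _
  have he2 : e ≤ 1 - μ.real G := min_le_right _ _
  set κ : ℝ := C₃ * (e / 2 * e) with hκ
  have hκ0 : 0 < κ := by positivity
  set K : ℝ := 1 + 2 / e + 2 / κ + 2 * C₄ / κ + 2 / (C₃ * e) with hK
  have p1 : 0 < 2 / e := by positivity
  have p2 : 0 < 2 / κ := by positivity
  have p3 : 0 < 2 * C₄ / κ := by positivity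
  have p4 : 0 < 2 / (C₃ * e) := by positivity
  have hK1 : 1 ≤ K := by rw [hK]; linarith
  have hK0 : 0 < K := by linarith
  have q1 : K⁻¹ ≤ e / 2 := by
    rw [inv_le_comm₀ hK0 (by positivity), inv_div]; rw [hK]; linarith
  have q2 : K⁻¹ ≤ κ / 2 := by
    rw [inv_le_comm₀ hK0 (by positivity), inv_div]; rw [hK]; linarith
  have q3 : C₄ * K⁻¹ ≤ κ / 2 := by
    rw [← div_eq_mul_inv, div_le_iff₀ hK0]
    have : 2 * C₄ / κ ≤ K := by rw [hK]; linarith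
    rw [div_le_iff₀ hκ0] at this
    linarith
  have q4 : K⁻¹ ≤ C₃ * (e / 2) := by
    rw [inv_le_comm₀ hK0 (by positivity)]
    have : (C₃ * (e / 2))⁻¹ = 2 / (C₃ * e) := by field_simp
    rw [this, hK]; linarith
  refine ⟨K, hK1, fun f hf hfi hvar => ?_⟩
  have hprob : IsProbabilityMeasure (μ.tilted f) := isProbabilityMeasure_tilted hfi
  set ν := μ.tilted f with hν
  set R : 𝒳 → ℝ := fun x => Real.exp (f x) / ∫ y, Real.exp (f y) ∂μ with hR
  have hRm : Measurable R := by fun_prop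
  have hRi : Integrable R μ := hfi.div_const _
  have hνs : ∀ s, MeasurableSet s → ν.real s = ∫ x in s, R x ∂μ := fun s hs =>
    tilted_real_apply f hs
  -- The lower variance comparison prevents a set of intermediate μ-mass from having small ν-mass.
  have hsmall : ∀ s, MeasurableSet s → e / 2 ≤ μ.real s → μ.real s ≤ 1 - e → κ ≤ ν.real s := by
    intro s hs h1 h2
    have h3 := (hvar s hs).1
    have h4 : κ ≤ C₃ * (μ.real s * (1 - μ.real s)) := by
      rw [hκ]; gcongr; linarith
    have h5 : 0 ≤ ν.real s := measureReal_nonneg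
    nlinarith
  -- If the density exceeds K on E, then μ E is at most ν E / K, and the upper comparison forces ν E
  -- to be nearly one. But G \ E still has intermediate μ-mass, hence ν-mass at least κ, which
  -- leaves no room.
  have hup : μ {x | K < R x} = 0 := by
    by_contra hne
    have hE : MeasurableSet {x | K < R x} := measurableSet_lt measurable_const hRm
    set E := {x | K < R x}
    have hμE : 0 < μ.real E := by
      rw [Measure.real, ENNReal.toReal_pos_iff]
      exact ⟨pos_iff_ne_zero.2 hne, measure_lt_top _ _⟩
    have h1 : K * μ.real E ≤ ν.real E := by
      rw [hνs E hE]
      calc K * μ.real E = ∫ _x in E, K ∂μ := by rw [setIntegral_const, smul_eq_mul, mul_comm]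
        _ ≤ _ := setIntegral_mono_on (integrable_const _) hRi.integrableOn hE fun x hx => le_of_lt hx
    have h2 : ν.real E ≤ 1 := measureReal_le_one
    have h3 : μ.real E ≤ K⁻¹ * ν.real E := by
      rw [inv_mul_eq_div, le_div_iff₀ hK0]; linarith
    have h3' : μ.real E ≤ K⁻¹ := h3.trans (mul_le_of_le_one_right (inv_nonneg.2 hK0.le) h2)
    have h4 : μ.real G - μ.real E ≤ μ.real (G \ E) := le_measureReal_sdiff
    have h5 : μ.real (G \ E) ≤ μ.real G := measureReal_mono sdiff_subset
    have h6 := hsmall (G \ E) (hG.diff hE) (by linarith) (by linarith)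
    have h7 : ν.real (G \ E) + ν.real E ≤ 1 := by
      rw [← measureReal_union disjoint_sdiff_left hE]
      exact measureReal_le_one
    have h8 := (hvar E hE).2
    have hνE : 0 < ν.real E := lt_of_lt_of_le (by positivity) h1
    have h9 : ν.real E * (1 - ν.real E) ≤ ν.real E * (C₄ * K⁻¹) := by
      calc _ ≤ C₄ * (μ.real E * (1 - μ.real E)) := h8
        _ ≤ C₄ * (K⁻¹ * ν.real E) := by
          have h10 : μ.real E * (1 - μ.real E) ≤ μ.real E := by nlinarith
          exact mul_le_mul_of_nonneg_left (h10.trans h3) hC₄.le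
        _ = _ := by ring
    have h10 := le_of_mul_le_mul_left h9 hνE
    linarith
  -- If the density is below 1/K on E, the lower comparison forces μ E to be nearly one, so G ∩ E
  -- has intermediate μ-mass. Its ν-mass would then be at least κ, although ν E ≤ 1/K.
  have hlo : μ {x | R x < K⁻¹} = 0 := by
    by_contra hne
    have hE : MeasurableSet {x | R x < K⁻¹} := measurableSet_lt hRm measurable_const
    set E := {x | R x < K⁻¹}
    have hμE : 0 < μ.real E := by
      rw [Measure.real, ENNReal.toReal_pos_iff]
      exact ⟨pos_iff_ne_zero.2 hne, measure_lt_top _ _⟩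
    have h1 : ν.real E ≤ K⁻¹ * μ.real E := by
      rw [hνs E hE]
      calc _ ≤ ∫ _x in E, K⁻¹ ∂μ :=
            setIntegral_mono_on hRi.integrableOn (integrable_const _) hE fun x hx => le_of_lt hx
        _ = _ := by rw [setIntegral_const, smul_eq_mul, mul_comm]
    have hμ1 : μ.real E ≤ 1 := measureReal_le_one
    have h1' : ν.real E ≤ K⁻¹ := h1.trans (mul_le_of_le_one_right (inv_nonneg.2 hK0.le) hμ1)
    have hν0 : 0 ≤ ν.real E := measureReal_nonneg
    have h2 := (hvar E hE).1
    have h3 : μ.real E * (C₃ * (1 - μ.real E)) ≤ μ.real E * K⁻¹ := by nlinarith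
    have h4 := le_of_mul_le_mul_left h3 hμE
    have h5 : 1 - μ.real E ≤ e / 2 := by
      have := h4.trans q4
      exact le_of_mul_le_mul_left this hC₃
    have h6 : μ.real G ≤ μ.real (G ∩ E) + (1 - μ.real E) := by
      rw [← probReal_compl_eq_one_sub hE, ← measureReal_inter_add_sdiff (s := G) (t := E) hE]
      gcongr
      · exact measure_ne_top _ _
      · exact fun x hx => hx.2
    have h7 : μ.real (G ∩ E) ≤ μ.real G := measureReal_mono inter_subset_left
    have h8 := hsmall (G ∩ E) (hG.inter hE) (by linarith) (by linarith)
    have h9 : ν.real (G ∩ E) ≤ ν.real E := measureReal_mono inter_subset_right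
    linarith
  have a1 : ∀ᵐ x ∂μ, ¬ K < R x := measure_eq_zero_iff_ae_notMem.1 hup
  have a2 : ∀ᵐ x ∂μ, ¬ R x < K⁻¹ := measure_eq_zero_iff_ae_notMem.1 hlo
  filter_upwards [a1, a2] with x h1 h2
  exact ⟨not_lt.1 h2, not_lt.1 h1⟩

end density

/-! ### Elementary facts on the model -/

namespace Model

variable {p : ℕ} {H : Type*} [NormedAddCommGroup H] [InnerProductSpace ℝ H]
  {𝒳 : Type*} [MeasurableSpace 𝒳]

theorem isProbabilityMeasure_trueLaw (M : Model p H 𝒳) (h : M.trueLaw ≠ 0) :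
    IsProbabilityMeasure M.trueLaw := by
  have : NeZero M.base := ⟨fun h0 => h (by
    change M.base.tilted _ = 0
    rw [h0, tilted_zero_measure])⟩
  exact isProbabilityMeasure_tilted M.integrable_exp

theorem trueLaw_ne_zero_of_var_ne_zero (M : Model p H 𝒳) {f : M.L20} (hf : M.var M.τ₀ f ≠ 0) :
    M.trueLaw ≠ 0 := by
  intro h
  have h0 : ∀ g : 𝒳 → ℝ, ∫ x, g x ∂(M.law M.τ₀) = 0 := fun g => by
    change ∫ x, g x ∂M.trueLaw = 0
    rw [h, integral_zero_measure]
  apply hf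
  simp only [var, cov, mean, h0, mul_zero, sub_zero]

theorem measurable_L20 (M : Model p H 𝒳) (f : M.L20) :
    Measurable ((f : Lp ℝ 2 M.trueLaw) : 𝒳 → ℝ) :=
  (Lp.stronglyMeasurable _).measurable

theorem memLp_L20 (M : Model p H 𝒳) (f : M.L20) :
    MemLp ((f : Lp ℝ 2 M.trueLaw) : 𝒳 → ℝ) 2 M.trueLaw := Lp.memLp _

variable (M : Model p H 𝒳) [IsProbabilityMeasure M.trueLaw]

omit [IsProbabilityMeasure M.trueLaw] in
theorem integral_L20 (f : M.L20) : ∫ x, (f : Lp ℝ 2 M.trueLaw) x ∂M.trueLaw = 0 := by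
  have h := (Submodule.mem_orthogonal_singleton_iff_inner_right).1 f.2
  rw [MeasureTheory.L2.inner_def] at h
  rw [← h]
  refine integral_congr_ae ?_
  filter_upwards [Lp.coeFn_const (p := 2) (μ := M.trueLaw) (c := (1 : ℝ))] with x hx
  rw [hx]
  simp

omit [IsProbabilityMeasure M.trueLaw] in
theorem cov_true (f g : M.L20) : M.cov M.τ₀ f g = inner ℝ f g := by
  rw [cov, mean, mean, mean]
  change ∫ x, _ ∂M.trueLaw - (∫ x, _ ∂M.trueLaw) * (∫ x, _ ∂M.trueLaw) = _
  rw [M.integral_L20 f, zero_mul, sub_zero, Submodule.coe_inner, MeasureTheory.L2.inner_def]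
  refine integral_congr_ae (ae_of_all _ fun x => ?_)
  simp [mul_comm]

omit [IsProbabilityMeasure M.trueLaw] in
theorem var_true (f : M.L20) : M.var M.τ₀ f = ‖f‖ ^ 2 := by
  rw [var, cov_true, real_inner_self_eq_norm_sq]

omit [IsProbabilityMeasure M.trueLaw] in
theorem norm_sq_L20 (f : M.L20) :
    ‖f‖ ^ 2 = ∫ x, ((f : Lp ℝ 2 M.trueLaw) x) ^ 2 ∂M.trueLaw := by
  rw [← real_inner_self_eq_norm_sq, Submodule.coe_inner, MeasureTheory.L2.inner_def]
  refine integral_congr_ae (ae_of_all _ fun x => ?_)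
  simp

/-- A square-integrable function with mean zero as an element of `L20`. -/
def toL20 {f : 𝒳 → ℝ} (hf : MemLp f 2 M.trueLaw) (h0 : ∫ x, f x ∂M.trueLaw = 0) : M.L20 :=
  ⟨hf.toLp f, by
    rw [Submodule.mem_orthogonal_singleton_iff_inner_right, MeasureTheory.L2.inner_def, ← h0]
    refine integral_congr_ae ?_
    filter_upwards [Lp.coeFn_const (p := 2) (μ := M.trueLaw) (c := (1 : ℝ)),
      hf.coeFn_toLp] with x hx hy
    rw [hx, hy]
    simp⟩

omit [IsProbabilityMeasure M.trueLaw] in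
theorem coeFn_toL20 {f : 𝒳 → ℝ} (hf : MemLp f 2 M.trueLaw) (h0 : ∫ x, f x ∂M.trueLaw = 0) :
    ((M.toL20 hf h0 : Lp ℝ 2 M.trueLaw) : 𝒳 → ℝ) =ᵐ[M.trueLaw] f := hf.coeFn_toLp

/-- The log-density ratio, up to normalization. -/
def psi (τ : EuclideanSpace ℝ (Fin p) × H) (x : 𝒳) : ℝ :=
  (M.etaL2 τ : Lp ℝ 2 M.trueLaw) x - (M.etaL2 M.τ₀ : Lp ℝ 2 M.trueLaw) x

omit [IsProbabilityMeasure M.trueLaw] in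
theorem measurable_psi (τ : EuclideanSpace ℝ (Fin p) × H) : Measurable (M.psi τ) :=
  (M.measurable_L20 _).sub (M.measurable_L20 _)

omit [IsProbabilityMeasure M.trueLaw] in
theorem memLp_psi (τ : EuclideanSpace ℝ (Fin p) × H) : MemLp (M.psi τ) 2 M.trueLaw :=
  (M.memLp_L20 _).sub (M.memLp_L20 _)

omit [IsProbabilityMeasure M.trueLaw] in
theorem psi_ae (τ : EuclideanSpace ℝ (Fin p) × H) :
    M.psi τ =ᵐ[M.trueLaw] fun x => M.η τ x - M.η M.τ₀ x := by
  filter_upwards [(M.memLp_eta τ).coeFn_toLp, (M.memLp_eta M.τ₀).coeFn_toLp] with x h1 h2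
  exact congrArg₂ (· - ·) h1 h2

omit [IsProbabilityMeasure M.trueLaw] in
theorem law_eq_tilted (τ : EuclideanSpace ℝ (Fin p) × H) :
    M.law τ = M.trueLaw.tilted (M.psi τ) := by
  rw [tilted_congr (M.psi_ae τ)]
  change M.base.tilted _ = (M.base.tilted (M.η M.τ₀)).tilted _
  rw [tilted_tilted M.integrable_exp]
  congr 1
  ext x
  simp

/-- Centring does not change a variance, so the centred indicator turns statements on variance
functionals into statements on probabilities of sets. One element of `L20` serves for all parameters
because every law is absolutely continuous with respect to the true one. -/
theorem var_toL20_indicator {s : Set 𝒳} (hs : MeasurableSet s) :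
    ∃ f : M.L20, ∀ τ, IsProbabilityMeasure (M.law τ) →
      M.var τ f = (M.law τ).real s * (1 - (M.law τ).real s) := by
  set m := M.trueLaw.real s with hm
  have hmem : MemLp (fun x => s.indicator (1 : 𝒳 → ℝ) x - m) 2 M.trueLaw :=
    (memLp_indicator_const 2 hs (1 : ℝ) (Or.inr (measure_ne_top _ _))).sub (memLp_const _)
  have h0 : ∫ x, (s.indicator (1 : 𝒳 → ℝ) x - m) ∂M.trueLaw = 0 := by
    have hI : Integrable (s.indicator (1 : 𝒳 → ℝ)) M.trueLaw :=
      (integrable_const (1 : ℝ)).indicator hs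
    rw [integral_sub hI (integrable_const _), integral_indicator_one hs]
    simp [hm]
  refine ⟨M.toL20 hmem h0, fun τ hτ => ?_⟩
  have hac : M.law τ ≪ M.trueLaw := by
    rw [M.law_eq_tilted]; exact tilted_absolutelyContinuous _ _
  have hae := hac.ae_eq (M.coeFn_toL20 hmem h0)
  have hI : Integrable (s.indicator (1 : 𝒳 → ℝ)) (M.law τ) := (integrable_const (1 : ℝ)).indicator hs
  have e1 : M.mean τ (fun x => (M.toL20 hmem h0 : Lp ℝ 2 M.trueLaw) x) = (M.law τ).real s - m := by
    rw [mean, integral_congr_ae hae, integral_sub hI (integrable_const _),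
      integral_indicator_one hs]
    simp
  have e2 : M.mean τ (fun x => (M.toL20 hmem h0 : Lp ℝ 2 M.trueLaw) x
      * (M.toL20 hmem h0 : Lp ℝ 2 M.trueLaw) x) = (1 - 2 * m) * (M.law τ).real s + m ^ 2 := by
    have : ∀ᵐ x ∂(M.law τ), (M.toL20 hmem h0 : Lp ℝ 2 M.trueLaw) x
        * (M.toL20 hmem h0 : Lp ℝ 2 M.trueLaw) x
        = (1 - 2 * m) * s.indicator (1 : 𝒳 → ℝ) x + m ^ 2 := by
      filter_upwards [hae] with x hx
      rw [hx]
      by_cases h : x ∈ s <;> simp [h] <;> ring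
    rw [mean, integral_congr_ae this, integral_add (hI.const_mul _) (integrable_const _),
      integral_const_mul, integral_indicator_one hs]
    simp
  rw [var, cov, e1, e2]
  ring

/-- The density ratios are uniformly bounded above and below. -/
theorem exists_ratio_bound {N : Set (EuclideanSpace ℝ (Fin p) × H)}
    (hvar : M.VarianceAssumption N) {f₀ : M.L20} (hf₀ : M.var M.τ₀ f₀ = 1) :
    ∃ K : ℝ, 1 ≤ K ∧ ∀ τ ∈ N, Integrable (fun x => Real.exp (M.psi τ x)) M.trueLaw ∧
      ∀ᵐ x ∂M.trueLaw, K⁻¹ ≤ Real.exp (M.psi τ x) / ∫ y, Real.exp (M.psi τ y) ∂M.trueLaw ∧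
        Real.exp (M.psi τ x) / ∫ y, Real.exp (M.psi τ y) ∂M.trueLaw ≤ K := by
  obtain ⟨C₃, hC₃, C₄, hC₄, hV⟩ := hvar
  have hfm := M.measurable_L20 f₀
  have hf1 : ∫ x, ((f₀ : Lp ℝ 2 M.trueLaw) x) ^ 2 ∂M.trueLaw = 1 := by
    rw [← M.norm_sq_L20, ← M.var_true, hf₀]
  have hnot : ¬ (((f₀ : Lp ℝ 2 M.trueLaw) : 𝒳 → ℝ) =ᵐ[M.trueLaw] 0) := by
    intro h
    have : ∫ x, ((f₀ : Lp ℝ 2 M.trueLaw) x) ^ 2 ∂M.trueLaw = 0 := by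
      rw [integral_eq_zero_of_ae]
      filter_upwards [h] with x hx
      simp [hx]
    linarith
  have hfi := (M.memLp_L20 f₀).integrable one_le_two
  -- A nonzero function of mean zero takes both signs, so its positivity set has probability
  -- strictly between 0 and 1.
  set G : Set 𝒳 := {x | 0 < (f₀ : Lp ℝ 2 M.trueLaw) x} with hGdef
  have hG : MeasurableSet G := measurableSet_lt measurable_const hfm
  have hG0 : 0 < M.trueLaw.real G := by
    rw [Measure.real, ENNReal.toReal_pos_iff]
    refine ⟨pos_iff_ne_zero.2 fun h => hnot ?_, measure_lt_top _ _⟩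
    have h1 : ∀ᵐ x ∂M.trueLaw, x ∉ G := measure_eq_zero_iff_ae_notMem.1 h
    have h2 : 0 ≤ᵐ[M.trueLaw] fun x => -(f₀ : Lp ℝ 2 M.trueLaw) x := by
      filter_upwards [h1] with x hx
      have : ¬ 0 < (f₀ : Lp ℝ 2 M.trueLaw) x := hx
      simp only [Pi.zero_apply]
      linarith
    have h3 := (integral_eq_zero_iff_of_nonneg_ae h2 hfi.neg).1
      (by rw [integral_neg, M.integral_L20, neg_zero])
    filter_upwards [h3] with x hx
    simpa using hx
  have hG1 : M.trueLaw.real G < 1 := by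
    refine lt_of_le_of_ne measureReal_le_one fun h => hnot ?_
    have h1 : M.trueLaw Gᶜ = 0 := by
      have := probReal_compl_eq_one_sub (μ := M.trueLaw) hG
      rw [h, sub_self] at this
      exact (measureReal_eq_zero_iff (measure_ne_top _ _)).1 this
    have h2 : 0 ≤ᵐ[M.trueLaw] ((f₀ : Lp ℝ 2 M.trueLaw) : 𝒳 → ℝ) := by
      filter_upwards [measure_eq_zero_iff_ae_notMem.1 h1] with x hx
      have : 0 < (f₀ : Lp ℝ 2 M.trueLaw) x := by
        by_contra hc
        exact hx hc
      exact this.le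
    exact (integral_eq_zero_iff_of_nonneg_ae h2 hfi).1 (M.integral_L20 f₀)
  obtain ⟨K, hK1, hK⟩ := exists_density_bound hG hG0 hG1 hC₃ hC₄
  have hlaw0 : M.law M.τ₀ = M.trueLaw := rfl
  refine ⟨K, hK1, fun τ hτ => ?_⟩
  -- Without integrability the tilted measure is zero by convention; all its variances vanish,
  -- contradicting the lower comparison at f₀.
  have hint : Integrable (fun x => Real.exp (M.psi τ x)) M.trueLaw := by
    by_contra hn
    have hz : M.law τ = 0 := by rw [M.law_eq_tilted, tilted_of_not_integrable hn]
    have h0 : ∀ g : 𝒳 → ℝ, ∫ x, g x ∂(M.law τ) = 0 := fun g => by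
      rw [hz, integral_zero_measure]
    have h1 : M.var τ f₀ = 0 := by simp only [var, cov, mean, h0, mul_zero, sub_zero]
    have h2 := (hV τ hτ f₀).1
    rw [h1, hf₀] at h2
    linarith
  refine ⟨hint, hK _ (M.measurable_psi τ) hint fun s hs => ?_⟩
  rw [← M.law_eq_tilted]
  have hP : IsProbabilityMeasure (M.law τ) := by
    rw [M.law_eq_tilted]; exact isProbabilityMeasure_tilted hint
  obtain ⟨f, hf⟩ := M.var_toL20_indicator hs
  have h1 := hf τ hP
  have h2 := hf M.τ₀ (hlaw0 ▸ inferInstance)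
  rw [hlaw0] at h2
  rw [← h1, ← h2]
  exact hV τ hτ f

end Model

/-! ### Log-density ratios -/

/-- The left factor 1/(2L) is forced by large positive d, where the right side grows only linearly.
It converts a divergence into a squared distance for bounded log-ratios. -/
theorem sq_div_le_exp_neg_sub {d L : ℝ} (hd : |d| ≤ L) (hL : 2 ≤ L) :
    d ^ 2 / (2 * L) ≤ Real.exp (-d) - 1 + d := by
  obtain ⟨h1, h2⟩ := abs_le.1 hd
  rw [div_le_iff₀ (by linarith)]
  rcases le_total d 0 with h | h
  · have := Real.quadratic_le_exp_of_nonneg (neg_nonneg.2 h)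
    nlinarith [sq_nonneg d]
  rcases le_total d 2 with h' | h'
  · have e1 := Real.add_one_le_exp (-(d / 2))
    have e2 : Real.exp (-d) = Real.exp (-(d / 2)) ^ 2 := by
      rw [← Real.exp_nat_mul]; congr 1; push_cast; ring
    have e3 : (1 - d / 2) ^ 2 ≤ Real.exp (-d) := by
      rw [e2]
      exact pow_le_pow_left₀ (by linarith) (by linarith) 2
    nlinarith [sq_nonneg d]
  · have := Real.exp_pos (-d)
    nlinarith

namespace Model

variable {p : ℕ} {H : Type*} [NormedAddCommGroup H] [InnerProductSpace ℝ H]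
  {𝒳 : Type*} [MeasurableSpace 𝒳] (M : Model p H 𝒳)

/-- The log-normalizer relative to the true law. -/
def logZ (τ : EuclideanSpace ℝ (Fin p) × H) : ℝ :=
  Real.log (∫ x, Real.exp (M.psi τ x) ∂M.trueLaw)

/-- The loss of one observation relative to the true parameter, the negative logarithm of the
density ratio. -/
def relLoss (τ : EuclideanSpace ℝ (Fin p) × H) (x : 𝒳) : ℝ := M.logZ τ - M.psi τ x

/-- The density ratio of `τ` to the true parameter lies in `[K⁻¹, K]`. -/
def RatioBound (K : ℝ) (τ : EuclideanSpace ℝ (Fin p) × H) : Prop :=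
  Integrable (fun x => Real.exp (M.psi τ x)) M.trueLaw ∧
    ∀ᵐ x ∂M.trueLaw, K⁻¹ ≤ Real.exp (-M.relLoss τ x) ∧ Real.exp (-M.relLoss τ x) ≤ K

theorem measurable_relLoss (τ : EuclideanSpace ℝ (Fin p) × H) : Measurable (M.relLoss τ) :=
  measurable_const.sub (M.measurable_psi τ)

theorem psi_trueParam : M.psi M.τ₀ = 0 := by
  ext x
  simp [psi]

variable [IsProbabilityMeasure M.trueLaw]

theorem logZ_trueParam : M.logZ M.τ₀ = 0 := by
  simp [logZ, psi_trueParam]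

theorem relLoss_trueParam : M.relLoss M.τ₀ = 0 := by
  ext x
  simp [relLoss, logZ_trueParam, psi_trueParam]

theorem exp_neg_relLoss {τ : EuclideanSpace ℝ (Fin p) × H}
    (h : Integrable (fun x => Real.exp (M.psi τ x)) M.trueLaw) (x : 𝒳) :
    Real.exp (-M.relLoss τ x)
      = Real.exp (M.psi τ x) / ∫ y, Real.exp (M.psi τ y) ∂M.trueLaw := by
  rw [relLoss, neg_sub, Real.exp_sub, logZ, Real.exp_log (integral_exp_pos h)]

theorem exists_ratioBound {N : Set (EuclideanSpace ℝ (Fin p) × H)}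
    (hvar : M.VarianceAssumption N) {f₀ : M.L20} (hf₀ : M.var M.τ₀ f₀ = 1) :
    ∃ K : ℝ, 1 ≤ K ∧ ∀ τ ∈ N, M.RatioBound K τ := by
  obtain ⟨K, hK, h⟩ := M.exists_ratio_bound hvar hf₀
  refine ⟨K, hK, fun τ hτ => ⟨(h τ hτ).1, ?_⟩⟩
  filter_upwards [(h τ hτ).2] with x hx
  rwa [M.exp_neg_relLoss (h τ hτ).1]

omit [IsProbabilityMeasure M.trueLaw] in
theorem integral_psi (τ : EuclideanSpace ℝ (Fin p) × H) : ∫ x, M.psi τ x ∂M.trueLaw = 0 := by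
  simp only [psi]
  rw [integral_sub ((M.memLp_L20 _).integrable one_le_two)
    ((M.memLp_L20 _).integrable one_le_two), M.integral_L20, M.integral_L20, sub_zero]

omit [IsProbabilityMeasure M.trueLaw] in
theorem memLp_relLoss (τ : EuclideanSpace ℝ (Fin p) × H) :
    MemLp (M.relLoss τ) 2 M.trueLaw := (memLp_const _).sub (M.memLp_psi τ)

/-- Since η is centred under the true law, the Kullback-Leibler divergence of the law of τ from the
truth is exactly the log-normalizer. -/
theorem integral_relLoss (τ : EuclideanSpace ℝ (Fin p) × H) :
    ∫ x, M.relLoss τ x ∂M.trueLaw = M.logZ τ := by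
  simp only [relLoss]
  rw [integral_sub (integrable_const _) ((M.memLp_psi τ).integrable one_le_two), M.integral_psi]
  simp

namespace RatioBound

variable {M} {K : ℝ} {τ σ : EuclideanSpace ℝ (Fin p) × H}

theorem mean_eq (hb : M.RatioBound K τ) (f : 𝒳 → ℝ) :
    M.mean τ f = ∫ x, Real.exp (-M.relLoss τ x) * f x ∂M.trueLaw := by
  rw [mean, M.law_eq_tilted, integral_tilted]
  refine integral_congr_ae (ae_of_all _ fun x => ?_)
  simp only [smul_eq_mul]
  rw [M.exp_neg_relLoss hb.1]

omit [IsProbabilityMeasure M.trueLaw] in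
theorem integrable_mul (hb : M.RatioBound K τ) {f : 𝒳 → ℝ} (hf : Integrable f M.trueLaw) :
    Integrable (fun x => Real.exp (-M.relLoss τ x) * f x) M.trueLaw := by
  refine hf.bdd_mul (c := K) ((M.measurable_relLoss τ).neg.exp.aestronglyMeasurable) ?_
  filter_upwards [hb.2] with x hx
  rw [Real.norm_of_nonneg (Real.exp_pos _).le]
  exact hx.2

theorem integral_exp_neg (hb : M.RatioBound K τ) :
    ∫ x, Real.exp (-M.relLoss τ x) ∂M.trueLaw = 1 := by
  simp only [M.exp_neg_relLoss hb.1]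
  rw [integral_div, div_self (integral_exp_pos hb.1).ne']

omit [IsProbabilityMeasure M.trueLaw] in
theorem integrable_exp_neg (hb : M.RatioBound K τ) :
    Integrable (fun x => Real.exp (-M.relLoss τ x)) M.trueLaw := by
  simpa using hb.integrable_mul (integrable_const 1)

theorem mean_le_mul_integral (hb : M.RatioBound K τ) {f : 𝒳 → ℝ} (hf : Integrable f M.trueLaw)
    (h0 : ∀ᵐ x ∂M.trueLaw, 0 ≤ f x) : M.mean τ f ≤ K * ∫ x, f x ∂M.trueLaw := by
  rw [hb.mean_eq, ← integral_const_mul]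
  refine integral_mono_ae (hb.integrable_mul hf) (hf.const_mul K) ?_
  filter_upwards [hb.2, h0] with x hx hx0
  exact mul_le_mul_of_nonneg_right hx.2 hx0

omit [IsProbabilityMeasure M.trueLaw] in
theorem abs_relLoss_le (hb : M.RatioBound K τ) (hK : 1 ≤ K) :
    ∀ᵐ x ∂M.trueLaw, |M.relLoss τ x| ≤ Real.log K := by
  have hK0 : 0 < K := by linarith
  filter_upwards [hb.2] with x hx
  rw [abs_le]
  constructor
  · have := (Real.le_log_iff_exp_le hK0).2 hx.2
    linarith
  · have := (Real.log_le_iff_le_exp (inv_pos.2 hK0)).2 hx.1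
    rw [Real.log_inv] at this
    linarith

theorem integral_abs_L20_le (f : M.L20) :
    ∫ x, |(f : Lp ℝ 2 M.trueLaw) x| ∂M.trueLaw ≤ ‖f‖ := by
  have h1 : (∫ x, |(f : Lp ℝ 2 M.trueLaw) x| ∂M.trueLaw) ^ 2
      ≤ ∫ x, |(f : Lp ℝ 2 M.trueLaw) x| ^ 2 ∂M.trueLaw := by
    have := variance_nonneg (fun x => |(f : Lp ℝ 2 M.trueLaw) x|) M.trueLaw
    have hm : MemLp (fun x => |(f : Lp ℝ 2 M.trueLaw) x|) 2 M.trueLaw := (M.memLp_L20 f).abs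
    rw [variance_eq_sub hm] at this
    simp only [Pi.pow_apply] at this
    linarith
  simp only [sq_abs] at h1
  rw [← M.norm_sq_L20] at h1
  exact le_of_sq_le_sq h1 (norm_nonneg _)

/-- The mean under `τ` as a continuous linear functional on the space of functions that are square
integrable and have mean zero under the true law. -/
def meanL (hb : M.RatioBound K τ) : M.L20 →L[ℝ] ℝ :=
  LinearMap.mkContinuous
    { toFun := fun f => M.mean τ (fun x => (f : Lp ℝ 2 M.trueLaw) x)
      map_add' := fun f g => by
        rw [hb.mean_eq, hb.mean_eq, hb.mean_eq, ← integral_add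
          (hb.integrable_mul ((M.memLp_L20 f).integrable one_le_two))
          (hb.integrable_mul ((M.memLp_L20 g).integrable one_le_two))]
        refine integral_congr_ae ?_
        filter_upwards [Lp.coeFn_add (f : Lp ℝ 2 M.trueLaw) (g : Lp ℝ 2 M.trueLaw)] with x hx
        rw [Submodule.coe_add, hx, Pi.add_apply, mul_add]
      map_smul' := fun c f => by
        rw [hb.mean_eq, hb.mean_eq, RingHom.id_apply, smul_eq_mul, ← integral_const_mul]
        refine integral_congr_ae ?_
        filter_upwards [Lp.coeFn_smul c (f : Lp ℝ 2 M.trueLaw)] with x hx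
        rw [Submodule.coe_smul, hx, Pi.smul_apply, smul_eq_mul]
        ring }
    K fun f => by
      have hi := (M.memLp_L20 f).integrable one_le_two
      have hK : 0 ≤ K := by
        obtain ⟨x, hx⟩ := hb.2.exists
        exact (Real.exp_pos _).le.trans hx.2
      change ‖M.mean τ (fun x => (f : Lp ℝ 2 M.trueLaw) x)‖ ≤ _
      calc ‖M.mean τ (fun x => (f : Lp ℝ 2 M.trueLaw) x)‖
          ≤ M.mean τ (fun x => ‖(f : Lp ℝ 2 M.trueLaw) x‖) := norm_integral_le_integral_norm _
        _ ≤ K * ∫ x, ‖(f : Lp ℝ 2 M.trueLaw) x‖ ∂M.trueLaw :=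
          hb.mean_le_mul_integral hi.norm (ae_of_all _ fun x => norm_nonneg _)
        _ ≤ K * ‖f‖ := mul_le_mul_of_nonneg_left (integral_abs_L20_le f) hK

theorem meanL_apply (hb : M.RatioBound K τ) (f : M.L20) :
    hb.meanL f = M.mean τ (fun x => (f : Lp ℝ 2 M.trueLaw) x) := rfl

theorem abs_meanL_le (hb : M.RatioBound K τ) (f : M.L20) : |hb.meanL f| ≤ K * ‖f‖ := by
  have hK : 0 ≤ K := by
    obtain ⟨x, hx⟩ := hb.2.exists
    exact (Real.exp_pos _).le.trans hx.2
  exact hb.meanL.le_of_opNorm_le (LinearMap.mkContinuous_norm_le _ hK _) f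

omit [IsProbabilityMeasure M.trueLaw] in
theorem psi_sub_ae (τ σ : EuclideanSpace ℝ (Fin p) × H) :
    ∀ᵐ x ∂M.trueLaw, ((M.etaL2 τ - M.etaL2 σ : M.L20) : Lp ℝ 2 M.trueLaw) x
      = M.psi τ x - M.psi σ x := by
  filter_upwards [Lp.coeFn_sub (M.etaL2 τ : Lp ℝ 2 M.trueLaw) (M.etaL2 σ : Lp ℝ 2 M.trueLaw)]
    with x hx
  rw [Submodule.coe_sub, hx, Pi.sub_apply, psi, psi]
  ring

theorem integral_sq_add_L20 (c : ℝ) (f : M.L20) :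
    ∫ x, (c - (f : Lp ℝ 2 M.trueLaw) x) ^ 2 ∂M.trueLaw = c ^ 2 + ‖f‖ ^ 2 := by
  have hi := (M.memLp_L20 f).integrable one_le_two
  have h1 : ∀ x, (c - (f : Lp ℝ 2 M.trueLaw) x) ^ 2
      = c ^ 2 - 2 * c * (f : Lp ℝ 2 M.trueLaw) x + (f : Lp ℝ 2 M.trueLaw) x ^ 2 := fun x => by ring
  simp only [h1]
  have hi2 : Integrable (fun x => c ^ 2 - 2 * c * (f : Lp ℝ 2 M.trueLaw) x) M.trueLaw :=
    (integrable_const _).sub (hi.const_mul _)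
  rw [integral_add hi2 (M.memLp_L20 f).integrable_sq,
    integral_sub (integrable_const _) (hi.const_mul _), integral_const_mul, M.integral_L20,
    M.norm_sq_L20]
  simp

/-- Strong convexity of the log-normalizer with respect to `η`. -/
theorem logZ_bregman (hK : 1 ≤ K) (hσ : M.RatioBound K σ) (hτ : M.RatioBound K τ) :
    (4 * (1 + Real.log K) * K)⁻¹ * ‖M.etaL2 τ - M.etaL2 σ‖ ^ 2
      ≤ M.logZ τ - M.logZ σ - hσ.meanL (M.etaL2 τ - M.etaL2 σ) := by
  have hlog := Real.log_nonneg hK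
  set f := M.etaL2 τ - M.etaL2 σ with hf
  set c := M.logZ τ - M.logZ σ with hc
  set d : 𝒳 → ℝ := fun x => c - (f : Lp ℝ 2 M.trueLaw) x with hd
  have hfi := (M.memLp_L20 f).integrable one_le_two
  have hd2 : MemLp d 2 M.trueLaw := (memLp_const _).sub (M.memLp_L20 f)
  have hdae : ∀ᵐ x ∂M.trueLaw, d x = M.relLoss τ x - M.relLoss σ x := by
    filter_upwards [psi_sub_ae τ σ] with x hx
    simp only [hd, hx, hf, hc, relLoss]
    ring
  have hdi := hd2.integrable one_le_two
  -- Here d is the logarithm of the density ratio of σ to τ, so this Bregman remainder is the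
  -- Kullback-Leibler divergence between the two laws.
  have e1 : M.mean σ d = c - hσ.meanL f := by
    have := hσ.mean_eq d
    rw [this, meanL_apply, hσ.mean_eq]
    simp only [hd, mul_sub]
    rw [integral_sub (hσ.integrable_exp_neg.mul_const c) (hσ.integrable_mul hfi),
      integral_mul_const, hσ.integral_exp_neg, one_mul]
  have h1 : ∀ᵐ x ∂M.trueLaw, Real.exp (-M.relLoss τ x) - Real.exp (-M.relLoss σ x)
      + Real.exp (-M.relLoss σ x) * d x
      = Real.exp (-M.relLoss σ x) * (Real.exp (-d x) - 1 + d x) := by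
    filter_upwards [hdae] with x hx
    have : Real.exp (-M.relLoss τ x) = Real.exp (-M.relLoss σ x) * Real.exp (-d x) := by
      rw [← Real.exp_add, hx]; congr 1; ring
    rw [this]; ring
  have hi3 : Integrable (fun x => Real.exp (-M.relLoss τ x) - Real.exp (-M.relLoss σ x))
      M.trueLaw := hτ.integrable_exp_neg.sub hσ.integrable_exp_neg
  -- Both densities integrate to one, so exp (-d) - 1 may be added at no cost. The integrand becomes
  -- nonnegative and quadratic in d.
  have e2 : M.mean σ d = ∫ x, Real.exp (-M.relLoss σ x) * (Real.exp (-d x) - 1 + d x)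
      ∂M.trueLaw := by
    rw [← integral_congr_ae h1, integral_add hi3 (hσ.integrable_mul hdi),
      integral_sub hτ.integrable_exp_neg hσ.integrable_exp_neg, hτ.integral_exp_neg,
      hσ.integral_exp_neg, sub_self, zero_add, hσ.mean_eq]
  have h3 : ∀ᵐ x ∂M.trueLaw, K⁻¹ * (d x ^ 2 / (2 * (2 * (1 + Real.log K))))
      ≤ Real.exp (-M.relLoss σ x) * (Real.exp (-d x) - 1 + d x) := by
    filter_upwards [hdae, hσ.abs_relLoss_le hK, hτ.abs_relLoss_le hK, hσ.2] with x hx h1 h2 h4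
    have : |d x| ≤ 2 * (1 + Real.log K) := by
      rw [hx]
      exact (abs_sub _ _).trans (by linarith)
    have h5 := sq_div_le_exp_neg_sub this (by linarith)
    have h6 : 0 ≤ d x ^ 2 / (2 * (2 * (1 + Real.log K))) := by positivity
    exact mul_le_mul h4.1 h5 h6 (Real.exp_pos _).le
  have h4 : Integrable (fun x => Real.exp (-M.relLoss σ x) * (Real.exp (-d x) - 1 + d x))
      M.trueLaw := (hi3.add (hσ.integrable_mul hdi)).congr h1
  have h5 := integral_mono_ae ((hd2.integrable_sq.div_const _).const_mul _) h4 h3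
  rw [← e2, e1, integral_const_mul, integral_div, integral_sq_add_L20] at h5
  refine le_trans ?_ h5
  rw [mul_inv, mul_comm _ K⁻¹, mul_assoc]
  have hK0 : 0 < K := by linarith
  gcongr
  rw [inv_mul_eq_div]
  have : 4 * (1 + Real.log K) = 2 * (2 * (1 + Real.log K)) := by ring
  rw [this]
  gcongr
  nlinarith [sq_nonneg c]

theorem meanL_sub_le_logZ_sub (hK : 1 ≤ K) (hσ : M.RatioBound K σ) (hτ : M.RatioBound K τ) :
    hσ.meanL (M.etaL2 τ - M.etaL2 σ) ≤ M.logZ τ - M.logZ σ := by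
  have h := logZ_bregman hK hσ hτ
  have hlog := Real.log_nonneg hK
  have : 0 ≤ (4 * (1 + Real.log K) * K)⁻¹ * ‖M.etaL2 τ - M.etaL2 σ‖ ^ 2 := by positivity
  linarith

theorem abs_logZ_sub_le (hK : 1 ≤ K) (hσ : M.RatioBound K σ) (hτ : M.RatioBound K τ) :
    |M.logZ τ - M.logZ σ| ≤ K * ‖M.etaL2 τ - M.etaL2 σ‖ := by
  have h1 := meanL_sub_le_logZ_sub hK hσ hτ
  have h2 := meanL_sub_le_logZ_sub hK hτ hσ
  have h3 := abs_le.1 (hσ.abs_meanL_le (M.etaL2 τ - M.etaL2 σ))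
  have h4 := abs_le.1 (hτ.abs_meanL_le (M.etaL2 σ - M.etaL2 τ))
  rw [norm_sub_rev] at h4
  rw [abs_le]
  constructor <;> linarith

end RatioBound

end Model

/-! ### Convexity of the loss -/

/-- Continuous induction: the supremum of the points where the bound holds is such a point by
monotonicity, which replaces continuity of m, and the local growth moves past it unless it is T. -/
theorem mul_le_of_eventually_add_mul_le {m : ℝ → ℝ} {q T : ℝ} (hT : 0 ≤ T) (hq : 0 ≤ q)
    (hmono : ∀ s t, 0 ≤ s → s ≤ t → t ≤ T → m s ≤ m t) (h0 : 0 ≤ m 0)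
    (hder : ∀ t, 0 ≤ t → t < T → ∀ᶠ s in 𝓝[>] (0 : ℝ), m t + q * s ≤ m (t + s)) :
    q * T ≤ m T := by
  set A : Set ℝ := {t | 0 ≤ t ∧ t ≤ T ∧ q * t ≤ m t} with hA
  have hA0 : (0 : ℝ) ∈ A := ⟨le_rfl, hT, by simpa using h0⟩
  have hbdd : BddAbove A := ⟨T, fun t ht => ht.2.1⟩
  set u := sSup A with hu
  have hu0 : 0 ≤ u := le_csSup hbdd hA0
  have huT : u ≤ T := csSup_le ⟨0, hA0⟩ fun t ht => ht.2.1
  have huA : q * u ≤ m u := by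
    refine le_of_forall_pos_sub_le fun ε hε => ?_
    have h1 : 0 < ε / (q + 1) := by positivity
    obtain ⟨t, ht, htu⟩ := exists_lt_of_lt_csSup ⟨0, hA0⟩ (show u - ε / (q + 1) < sSup A by linarith)
    have h2 := hmono t u ht.1 (le_csSup hbdd ht) huT
    have h3 : q * (ε / (q + 1)) ≤ ε := by
      rw [← mul_div_assoc, div_le_iff₀ (by linarith)]
      nlinarith
    nlinarith [ht.2.2]
  rcases huT.eq_or_lt with h | h
  · rwa [h] at huA
  exfalso
  have h1 : ∀ᶠ s in 𝓝[>] (0 : ℝ), s < T - u :=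
    nhdsWithin_le_nhds (eventually_lt_nhds (by linarith))
  obtain ⟨s, hs, hs1, hs0⟩ := ((hder u hu0 h).and (h1.and self_mem_nhdsWithin)).exists
  have hs0' : 0 < s := hs0
  have : u + s ∈ A := ⟨by linarith, by linarith, by nlinarith⟩
  have := le_csSup hbdd this
  linarith

namespace Model

variable {p : ℕ} {H : Type*} [NormedAddCommGroup H] [InnerProductSpace ℝ H]
  {𝒳 : Type*} [MeasurableSpace 𝒳] (M : Model p H 𝒳)

variable {M} [IsProbabilityMeasure M.trueLaw]

theorem log_integral_sub {τ : EuclideanSpace ℝ (Fin p) × H}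
    (h : Integrable (fun x => Real.exp (M.psi τ x)) M.trueLaw) :
    Real.log (∫ y, Real.exp (M.η τ y) ∂M.base) - Real.log (∫ y, Real.exp (M.η M.τ₀ y) ∂M.base)
      = M.logZ τ := by
  have h0 : M.trueLaw ≠ 0 := IsProbabilityMeasure.ne_zero _
  have : NeZero M.base := ⟨fun hb => h0 (by
    change M.base.tilted _ = 0
    rw [hb, tilted_zero_measure])⟩
  have h1 := integral_exp_pos M.integrable_exp
  have h2 : ∫ x, Real.exp (M.psi τ x) ∂M.trueLaw
      = (∫ y, Real.exp (M.η τ y) ∂M.base) / ∫ y, Real.exp (M.η M.τ₀ y) ∂M.base := by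
    have : (fun x => Real.exp (M.psi τ x)) =ᵐ[M.trueLaw]
        fun x => Real.exp ((M.η τ - M.η M.τ₀) x) := by
      filter_upwards [M.psi_ae τ] with x hx
      rw [hx, Pi.sub_apply]
    rw [integral_congr_ae this]
    change ∫ x, _ ∂(M.base.tilted (M.η M.τ₀)) = _
    rw [integral_exp_tilted]
    simp
  have h3 := integral_exp_pos h
  rw [logZ, h2, Real.log_div _ h1.ne']
  intro h4
  rw [h2, h4, zero_div] at h3
  exact lt_irrefl _ h3

theorem loss_sub {τ : EuclideanSpace ℝ (Fin p) × H}
    (h : Integrable (fun x => Real.exp (M.psi τ x)) M.trueLaw) {n : ℕ} (hn : 0 < n)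
    (x : Fin n → 𝒳) :
    M.loss n x τ - M.loss n x M.τ₀
      = (1 / (n : ℝ)) * ∑ i, (M.logZ τ - (M.η τ (x i) - M.η M.τ₀ (x i))) := by
  have hn' : (n : ℝ) ≠ 0 := by positivity
  rw [loss, loss, ← log_integral_sub h]
  simp only [Finset.sum_sub_distrib, Finset.sum_const, Finset.card_univ, Fintype.card_fin,
    nsmul_eq_mul]
  field_simp
  ring

variable {N : Set (EuclideanSpace ℝ (Fin p) × H)} {K : ℝ}
  {σ τ : EuclideanSpace ℝ (Fin p) × H}

omit [IsProbabilityMeasure M.trueLaw] in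
theorem relLoss_ae (τ : EuclideanSpace ℝ (Fin p) × H) :
    ∀ᵐ x ∂M.trueLaw, M.relLoss τ x = M.logZ τ - (M.η τ x - M.η M.τ₀ x) := by
  filter_upwards [M.psi_ae τ] with x hx
  rw [relLoss, hx]

/-- Convexity for samples of size one, transferred from the one-fold product measure. The
exceptional null set may depend on the three parameters. -/
theorem relLoss_convex_ae (hconv : M.ConvexityAssumption N) (hb : ∀ τ ∈ N, M.RatioBound K τ)
    (hσ : σ ∈ N) (hτ : τ ∈ N) {s : ℝ} (hs0 : 0 ≤ s) (hs1 : s ≤ 1) :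
    ∀ᵐ x ∂M.trueLaw, M.relLoss (σ + s • (τ - σ)) x
      ≤ (1 - s) * M.relLoss σ x + s * M.relLoss τ x := by
  have hmp := (measurePreserving_funUnique M.trueLaw (Fin 1)).symm
  have h1 := hmp.quasiMeasurePreserving.ae (hconv 1 one_pos)
  filter_upwards [h1, relLoss_ae σ, relLoss_ae τ, relLoss_ae (σ + s • (τ - σ))]
    with x hx h2 h3 h4
  have e : σ + s • (τ - σ) = (1 - s) • σ + s • τ := by module
  have hmem : σ + s • (τ - σ) ∈ N := by
    rw [e]; exact hx.1 hσ hτ (by linarith) hs0 (by ring)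
  have h5 := hx.2 hσ hτ (by linarith : 0 ≤ 1 - s) hs0 (by ring)
  rw [← e] at h5
  have l1 := loss_sub (hb _ hσ).1 one_pos (fun _ : Fin 1 => x)
  have l2 := loss_sub (hb _ hτ).1 one_pos (fun _ : Fin 1 => x)
  have l3 := loss_sub (hb _ hmem).1 one_pos (fun _ : Fin 1 => x)
  simp only [Finset.univ_unique, Finset.sum_singleton, Nat.cast_one, div_one, one_mul,
    ← h2, ← h3, ← h4] at l1 l2 l3
  have h6 : M.loss 1 (fun _ => x) (σ + s • (τ - σ)) ≤ (1 - s) * M.loss 1 (fun _ => x) σ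
      + s * M.loss 1 (fun _ => x) τ := h5
  rw [← l1, ← l2, ← l3]
  linarith

/-- Convexity bounds the increment below by its difference quotients. In each quotient the
log-normalizer lies above its tangent as a function of η, leaving the mean minus the value of the
slope of η. Letting the step tend to zero gives a subgradient inequality with the L² derivative. -/
theorem relLoss_linearization (hconv : M.ConvexityAssumption N)
    (hNc : Convex ℝ N) (hK : 1 ≤ K)
    (hb : ∀ τ ∈ N, M.RatioBound K τ) (hσ : σ ∈ N) (hτ : τ ∈ N)
    (hd : DifferentiableAt ℝ M.etaL2 σ) :
    ∀ᵐ x ∂M.trueLaw, (hb σ hσ).meanL (fderiv ℝ M.etaL2 σ (τ - σ))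
      - ((fderiv ℝ M.etaL2 σ (τ - σ) : M.L20) : Lp ℝ 2 M.trueLaw) x
      ≤ M.relLoss τ x - M.relLoss σ x := by
  set ξ := fderiv ℝ M.etaL2 σ (τ - σ) with hξ
  have hlim := (hd.hasFDerivAt.hasLineDerivAt (τ - σ)).tendsto_slope_zero_right
  set s : ℕ → ℝ := fun n => 1 / ((n : ℝ) + 1) with hs
  have hs0 : ∀ n, 0 < s n := fun n => by simp only [hs]; positivity
  have hs1 : ∀ n, s n ≤ 1 := fun n => by
    simp only [hs]
    rw [div_le_one (by positivity)]
    linarith [Nat.cast_nonneg (α := ℝ) n]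
  have hst : Tendsto s atTop (𝓝[>] 0) :=
    tendsto_nhdsWithin_iff.2 ⟨tendsto_one_div_add_atTop_nhds_zero_nat,
      Eventually.of_forall hs0⟩
  have hlim' := hlim.comp hst
  set f : ℕ → M.L20 := fun n => (s n)⁻¹ • (M.etaL2 (σ + s n • (τ - σ)) - M.etaL2 σ) with hf
  have hft : Tendsto f atTop (𝓝 ξ) := hlim'
  have hmem : ∀ n, σ + s n • (τ - σ) ∈ N := fun n =>
    hNc.add_smul_sub_mem hσ hτ ⟨(hs0 n).le, hs1 n⟩
  have hft' : Tendsto (fun n => ((f n : M.L20) : Lp ℝ 2 M.trueLaw)) atTop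
      (𝓝 (ξ : Lp ℝ 2 M.trueLaw)) := (continuous_subtype_val.tendsto _).comp hft
  -- The slopes converge in L² only; an almost everywhere convergent subsequence is enough for the
  -- inequality.
  obtain ⟨k, hk, hkae⟩ := (tendstoInMeasure_of_tendsto_Lp hft').exists_seq_tendsto_ae
  have hmean := (((hb σ hσ).meanL.continuous.tendsto ξ).comp hft).comp hk.tendsto_atTop
  have hpt : ∀ n, ∀ᵐ x ∂M.trueLaw, (hb σ hσ).meanL (f n) - ((f n : M.L20) : Lp ℝ 2 M.trueLaw) x
      ≤ M.relLoss τ x - M.relLoss σ x := by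
    intro n
    have h1 := relLoss_convex_ae hconv hb hσ hτ (hs0 n).le (hs1 n)
    have h2 := RatioBound.meanL_sub_le_logZ_sub hK (hb σ hσ) (hb _ (hmem n))
    filter_upwards [h1, RatioBound.psi_sub_ae (σ + s n • (τ - σ)) σ,
      Lp.coeFn_smul (s n)⁻¹ ((M.etaL2 (σ + s n • (τ - σ)) - M.etaL2 σ : M.L20) :
        Lp ℝ 2 M.trueLaw)] with x hx hx2 hx3
    have e1 : ((f n : M.L20) : Lp ℝ 2 M.trueLaw) x
        = (s n)⁻¹ * (M.psi (σ + s n • (τ - σ)) x - M.psi σ x) := by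
      simp only [hf]
      rw [Submodule.coe_smul, hx3, Pi.smul_apply, hx2, smul_eq_mul]
    rw [e1]
    simp only [hf, map_smul, smul_eq_mul]
    rw [← mul_sub, inv_mul_le_iff₀ (hs0 n)]
    simp only [relLoss] at hx ⊢
    nlinarith
  filter_upwards [ae_all_iff.2 hpt, hkae] with x hx hx2
  exact le_of_tendsto (hmean.sub hx2) (Eventually.of_forall fun n => hx (k n))

/-- The difference g between the increment of `relLoss` and its affine minorant is nonnegative. Its
mean under σ is the Bregman remainder, bounded below by strong convexity; its mean under the truth
is the increment of `logZ` minus its tangent. As g ≥ 0 and the density ratio is at most K, the two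
means compare up to K. No second derivative of η enters. -/
theorem meanL_fderiv_le (hconv : M.ConvexityAssumption N) (hNc : Convex ℝ N) (hK : 1 ≤ K)
    (hb : ∀ τ ∈ N, M.RatioBound K τ) (hσ : σ ∈ N) (hτ : τ ∈ N)
    (hd : DifferentiableAt ℝ M.etaL2 σ) :
    (hb σ hσ).meanL (fderiv ℝ M.etaL2 σ (τ - σ))
      + (4 * (1 + Real.log K) * K ^ 2)⁻¹ * ‖M.etaL2 τ - M.etaL2 σ‖ ^ 2
      ≤ M.logZ τ - M.logZ σ := by
  have hlin := relLoss_linearization hconv hNc hK hb hσ hτ hd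
  have hbr := RatioBound.logZ_bregman hK (hb σ hσ) (hb τ hτ)
  set ξ := fderiv ℝ M.etaL2 σ (τ - σ)
  set a := (hb σ hσ).meanL ξ with ha
  set f := M.etaL2 τ - M.etaL2 σ with hf
  set c := M.logZ τ - M.logZ σ with hc
  have hξi := (M.memLp_L20 ξ).integrable one_le_two
  have hfi := (M.memLp_L20 f).integrable one_le_two
  set g : 𝒳 → ℝ := fun x => (c - a) + ((ξ - f : M.L20) : Lp ℝ 2 M.trueLaw) x with hg
  have hgi0 := (M.memLp_L20 (ξ - f)).integrable one_le_two
  have hgi : Integrable g M.trueLaw := (integrable_const _).add hgi0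
  have hg0 : ∀ᵐ x ∂M.trueLaw, 0 ≤ g x := by
    filter_upwards [hlin, RatioBound.psi_sub_ae τ σ,
      Lp.coeFn_sub (ξ : Lp ℝ 2 M.trueLaw) (f : Lp ℝ 2 M.trueLaw)] with x h1 h2 h3
    simp only [hg]
    rw [Submodule.coe_sub, h3, Pi.sub_apply, h2]
    simp only [relLoss] at h1
    linarith
  have h1 := (hb σ hσ).mean_le_mul_integral hgi hg0
  have e1 : ∫ x, g x ∂M.trueLaw = c - a := by
    simp only [hg]
    rw [integral_add (integrable_const _) hgi0, M.integral_L20]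
    simp
  have e2 : M.mean σ g = c - (hb σ hσ).meanL f := by
    rw [(hb σ hσ).mean_eq]
    simp only [hg, mul_add]
    rw [integral_add ((hb σ hσ).integrable_exp_neg.mul_const _) ((hb σ hσ).integrable_mul hgi0),
      integral_mul_const, (hb σ hσ).integral_exp_neg, ← (hb σ hσ).mean_eq,
      ← (hb σ hσ).meanL_apply, map_sub]
    ring
  rw [e1, e2] at h1
  have hK0 : 0 < K := by linarith
  have h2 : K⁻¹ * ((4 * (1 + Real.log K) * K)⁻¹ * ‖f‖ ^ 2) ≤ c - a := by
    rw [inv_mul_le_iff₀ hK0]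
    exact hbr.trans h1
  have e3 : (4 * (1 + Real.log K) * K ^ 2)⁻¹ = K⁻¹ * (4 * (1 + Real.log K) * K)⁻¹ := by
    rw [← mul_inv]; congr 1; ring
  rw [e3]
  linarith

end Model

/-! ### Curvature of the loss -/

theorem abs_exp_sub_one_le_mul {u K : ℝ} (hK : 1 ≤ K) (h : Real.exp u ≤ K) :
    |Real.exp u - 1| ≤ K * |u| := by
  have h1 := Real.add_one_le_exp u
  have h2 := Real.add_one_le_exp (-u)
  have h3 : Real.exp u * Real.exp (-u) = 1 := by rw [← Real.exp_add]; simp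
  have h4 := Real.exp_pos u
  have h5 := neg_abs_le u
  have h6 := le_abs_self u
  have h7 := abs_nonneg u
  rw [abs_le]
  constructor
  · nlinarith
  · nlinarith

namespace Model

variable {p : ℕ} {H : Type*} [NormedAddCommGroup H] [InnerProductSpace ℝ H]
  {𝒳 : Type*} [MeasurableSpace 𝒳] {M : Model p H 𝒳}

theorem Dθ_add_Dh {τ : EuclideanSpace ℝ (Fin p) × H} (hd : DifferentiableAt ℝ M.etaL2 τ)
    (ζ : EuclideanSpace ℝ (Fin p)) (g : H) :
    M.Dθ τ ζ + M.Dh τ g = fderiv ℝ M.etaL2 τ (ζ, g) := by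
  have h1 : HasFDerivAt (fun θ => M.etaL2 (θ, τ.2))
      ((fderiv ℝ M.etaL2 τ).comp (ContinuousLinearMap.inl ℝ _ H)) τ.1 :=
    HasFDerivAt.comp (f := fun θ => (θ, τ.2)) (g := M.etaL2) τ.1 hd.hasFDerivAt
      (hasFDerivAt_prodMk_left τ.1 τ.2)
  have h2 : HasFDerivAt (fun h => M.etaL2 (τ.1, h))
      ((fderiv ℝ M.etaL2 τ).comp (ContinuousLinearMap.inr ℝ (EuclideanSpace ℝ (Fin p)) H)) τ.2 :=
    HasFDerivAt.comp (f := fun h => (τ.1, h)) (g := M.etaL2) τ.2 hd.hasFDerivAt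
      (hasFDerivAt_prodMk_right τ.1 τ.2)
  rw [Dθ, Dh, h1.fderiv, h2.fderiv, ContinuousLinearMap.comp_apply,
    ContinuousLinearMap.comp_apply, ← map_add]
  simp

variable [IsProbabilityMeasure M.trueLaw]
variable {N : Set (EuclideanSpace ℝ (Fin p) × H)} {K : ℝ}
  {σ τ : EuclideanSpace ℝ (Fin p) × H}

theorem meanL_trueParam (hb : M.RatioBound K M.τ₀) (f : M.L20) : hb.meanL f = 0 := by
  rw [hb.meanL_apply]
  exact M.integral_L20 f

/-- Along the segment from τ₀, m(t) is a subgradient of `logZ` vanishing at t = 0. The quadratic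
gain in `meanL_fderiv_le` makes m grow at a rate proportional to c, and integrating the subgradient
over the second half of the segment gives the bound. -/
theorem mul_le_logZ (hconv : M.ConvexityAssumption N) (hNc : Convex ℝ N) (hK : 1 ≤ K)
    (hb : ∀ τ ∈ N, M.RatioBound K τ) (h0 : M.τ₀ ∈ N) (hτ : τ ∈ N)
    (hd : ∀ τ ∈ N, DifferentiableAt ℝ M.etaL2 τ) {c : ℝ} (hc : 0 ≤ c)
    (hlow : ∀ σ ∈ N, c ≤ ‖fderiv ℝ M.etaL2 σ (τ - M.τ₀)‖ ^ 2) :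
    (64 * (1 + Real.log K) * K ^ 2)⁻¹ * c ≤ M.logZ τ := by
  have hlog := Real.log_nonneg hK
  set κ := (4 * (1 + Real.log K) * K ^ 2)⁻¹ with hκ
  have hκ0 : 0 < κ := by positivity
  set v := τ - M.τ₀ with hv
  set s : ℝ → EuclideanSpace ℝ (Fin p) × H := fun t => M.τ₀ + t • v with hs
  have hmem : ∀ t, 0 ≤ t → t ≤ 1 → s t ∈ N := fun t h1 h2 =>
    hNc.add_smul_sub_mem h0 hτ ⟨h1, h2⟩
  set m : ℝ → ℝ := fun t =>
    M.mean (s t) (fun x => ((fderiv ℝ M.etaL2 (s t) v : M.L20) : Lp ℝ 2 M.trueLaw) x) with hm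
  have key : ∀ t u, 0 ≤ t → t ≤ 1 → 0 ≤ u → u ≤ 1 →
      (u - t) * m t + κ * ‖M.etaL2 (s u) - M.etaL2 (s t)‖ ^ 2 ≤ M.logZ (s u) - M.logZ (s t) := by
    intro t u ht0 ht1 hu0 hu1
    have h := meanL_fderiv_le hconv hNc hK hb (hmem t ht0 ht1) (hmem u hu0 hu1)
      (hd _ (hmem t ht0 ht1))
    have e : s u - s t = (u - t) • v := by simp only [hs]; module
    rw [e, map_smul, map_smul, smul_eq_mul] at h
    exact h
  have key' : ∀ t u, 0 ≤ t → t ≤ 1 → 0 ≤ u → u ≤ 1 →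
      (u - t) * m t ≤ M.logZ (s u) - M.logZ (s t) := fun t u h1 h2 h3 h4 =>
    le_trans (le_add_of_nonneg_right (by positivity)) (key t u h1 h2 h3 h4)
  have hs0 : s 0 = M.τ₀ := by simp [hs]
  have hs1 : s 1 = τ := by simp [hs, hv]
  have hm0 : m 0 = 0 := by
    simp only [hm]
    rw [hs0, ← (hb _ h0).meanL_apply, meanL_trueParam]
  -- Adding the subgradient inequalities at t and t + a shows that m gains κ ‖Δη‖²/a over the step
  -- a. For small a, ‖Δη‖² ≥ c a²/4, the factor 1/4 being slack for the limit of the slope.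
  have hhalf := mul_le_of_eventually_add_mul_le (m := m) (q := κ * (c / 4)) (T := 1 / 2)
    (by norm_num) (by positivity) (fun t u ht htu hu => by
      rcases htu.eq_or_lt with h | h
      · rw [h]
      have h1 := key' t u ht (by linarith) (by linarith) (by linarith)
      have h2 := key' u t (by linarith) (by linarith) ht (by linarith)
      nlinarith) hm0.ge (fun t ht0 ht1 => by
      have hmt := hmem t ht0 (by linarith)
      have hlim := ((hd _ hmt).hasFDerivAt.hasLineDerivAt v).tendsto_slope_zero_right
      have hlim2 := (hlim.norm).pow 2
      have hev : ∀ᶠ a in 𝓝[>] (0 : ℝ),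
          c / 4 ≤ ‖a⁻¹ • (M.etaL2 (s t + a • v) - M.etaL2 (s t))‖ ^ 2 := by
        rcases hc.eq_or_lt with h | h
        · exact Eventually.of_forall fun a => by rw [← h]; simp
        · have h3 : c / 4 < ‖fderiv ℝ M.etaL2 (s t) v‖ ^ 2 :=
            lt_of_lt_of_le (by linarith) (hlow _ hmt)
          exact (hlim2.eventually (lt_mem_nhds h3)).mono fun a ha => ha.le
      have h1 : ∀ᶠ a in 𝓝[>] (0 : ℝ), a < 1 / 2 :=
        nhdsWithin_le_nhds (eventually_lt_nhds (by norm_num))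
      filter_upwards [hev, h1, self_mem_nhdsWithin] with a ha ha1 ha0
      have ha0' : 0 < a := ha0
      have e : s t + a • v = s (t + a) := by simp only [hs]; module
      rw [e, norm_smul, mul_pow, norm_inv, Real.norm_of_nonneg ha0'.le, inv_pow,
        ← div_eq_inv_mul, le_div_iff₀ (by positivity)] at ha
      have k1 := key t (t + a) ht0 (by linarith) (by linarith) (by linarith)
      have k2 := key' (t + a) t (by linarith) (by linarith) ht0 (by linarith)
      have k3 := mul_le_mul_of_nonneg_left ha hκ0.le
      have k4 : a * (m t + κ * (c / 4) * a) ≤ a * m (t + a) := by nlinarith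
      exact le_of_mul_le_mul_left k4 ha0')
  have k1 := key' 0 (1 / 2) le_rfl (by norm_num) (by norm_num) (by norm_num)
  have k2 := key' (1 / 2) 1 (by norm_num) (by norm_num) (by norm_num) le_rfl
  rw [hs0, hm0, M.logZ_trueParam] at k1
  rw [hs1] at k2
  have e : (64 * (1 + Real.log K) * K ^ 2)⁻¹ * c = κ * (c / 4) * (1 / 2) * (1 / 2) := by
    rw [hκ, show 64 * (1 + Real.log K) * K ^ 2 = 16 * (4 * (1 + Real.log K) * K ^ 2) by ring,
      mul_inv]
    ring
  rw [e]
  nlinarith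

omit [IsProbabilityMeasure M.trueLaw] in
theorem norm_etaL2_sub_le (hNc : Convex ℝ N) (hσ : σ ∈ N) (hτ : τ ∈ N)
    (hd : ∀ τ ∈ N, DifferentiableAt ℝ M.etaL2 τ) {c : ℝ}
    (hup : ∀ ν ∈ N, ‖fderiv ℝ M.etaL2 ν (τ - σ)‖ ≤ c) :
    ‖M.etaL2 τ - M.etaL2 σ‖ ≤ c := by
  have hmem : ∀ t ∈ Icc (0 : ℝ) 1, σ + t • (τ - σ) ∈ N := fun t ht =>
    hNc.add_smul_sub_mem hσ hτ ht
  have h := norm_image_sub_le_of_norm_deriv_le_segment_01'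
    (f := fun t : ℝ => M.etaL2 (σ + t • (τ - σ)))
    (f' := fun t => fderiv ℝ M.etaL2 (σ + t • (τ - σ)) (τ - σ)) (C := c)
    (fun t ht => by
      have h1 : HasDerivAt (fun t : ℝ => σ + t • (τ - σ)) (τ - σ) t := by
        simpa using ((hasDerivAt_id t).smul_const (τ - σ)).const_add σ
      exact ((hd _ (hmem t ht)).hasFDerivAt.comp_hasDerivAt t h1).hasDerivWithinAt)
    (fun t ht => hup _ (hmem t (Ico_subset_Icc_self ht)))
  simpa using h

/-- Under the truth `relLoss` is the constant `logZ` minus a mean-zero function; the two are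
orthogonal, and `logZ` is Lipschitz in η. -/
theorem integral_relLoss_sq_le (hK : 1 ≤ K) (h0 : M.RatioBound K M.τ₀) (hb : M.RatioBound K τ) :
    ∫ x, M.relLoss τ x ^ 2 ∂M.trueLaw ≤ (K ^ 2 + 1) * ‖M.etaL2 τ - M.etaL2 M.τ₀‖ ^ 2 := by
  have h1 : ∫ x, M.relLoss τ x ^ 2 ∂M.trueLaw
      = M.logZ τ ^ 2 + ‖M.etaL2 τ - M.etaL2 M.τ₀‖ ^ 2 := by
    rw [← RatioBound.integral_sq_add_L20]
    refine integral_congr_ae ?_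
    filter_upwards [RatioBound.psi_sub_ae τ M.τ₀] with x hx
    rw [hx, psi_trueParam, relLoss]
    simp
  have h2 := RatioBound.abs_logZ_sub_le hK h0 hb
  rw [M.logZ_trueParam, sub_zero] at h2
  have h3 := pow_le_pow_left₀ (abs_nonneg _) h2 2
  rw [sq_abs] at h3
  rw [h1]
  nlinarith

/-- Since f is centred under the truth, its mean under τ is its inner product with the density ratio
minus one, whose norm is proportional to the distance of η(τ) from η(τ₀). -/
theorem abs_meanL_le_mul (hK : 1 ≤ K) (h0 : M.RatioBound K M.τ₀) (hb : M.RatioBound K τ)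
    (f : M.L20) :
    |hb.meanL f| ≤ K * (K + 1) * ‖M.etaL2 τ - M.etaL2 M.τ₀‖ * ‖f‖ := by
  have hK0 : 0 < K := by linarith
  have hfi := (M.memLp_L20 f).integrable one_le_two
  have hhm : AEStronglyMeasurable (fun x => Real.exp (-M.relLoss τ x) - 1) M.trueLaw :=
    ((M.measurable_relLoss τ).neg.exp.sub_const 1).aestronglyMeasurable
  have hbd : ∀ᵐ x ∂M.trueLaw, |Real.exp (-M.relLoss τ x) - 1| ≤ K * |M.relLoss τ x| := by
    filter_upwards [hb.2] with x hx
    simpa using abs_exp_sub_one_le_mul hK hx.2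
  have hh : MemLp (fun x => Real.exp (-M.relLoss τ x) - 1) 2 M.trueLaw := by
    refine (M.memLp_relLoss τ).of_le_mul (c := K) hhm ?_
    filter_upwards [hbd] with x hx
    simpa using hx
  have hh0 : ∫ x, (Real.exp (-M.relLoss τ x) - 1) ∂M.trueLaw = 0 := by
    rw [integral_sub hb.integrable_exp_neg (integrable_const _), hb.integral_exp_neg]
    simp
  set q : M.L20 := M.toL20 hh hh0 with hq
  have e1 : hb.meanL f = inner ℝ q f := by
    rw [hb.meanL_apply, hb.mean_eq, Submodule.coe_inner, MeasureTheory.L2.inner_def]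
    have e2 : ∫ x, Real.exp (-M.relLoss τ x) * (f : Lp ℝ 2 M.trueLaw) x ∂M.trueLaw
        = ∫ x, (Real.exp (-M.relLoss τ x) - 1) * (f : Lp ℝ 2 M.trueLaw) x ∂M.trueLaw := by
      simp only [sub_mul, one_mul]
      rw [integral_sub (hb.integrable_mul hfi) hfi, M.integral_L20, sub_zero]
    rw [e2]
    refine integral_congr_ae ?_
    filter_upwards [M.coeFn_toL20 hh hh0] with x hx
    rw [hq, hx]
    simp [mul_comm]
  have e3 : ‖q‖ ^ 2 ≤ (K * (K + 1) * ‖M.etaL2 τ - M.etaL2 M.τ₀‖) ^ 2 := by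
    calc ‖q‖ ^ 2 = ∫ x, (Real.exp (-M.relLoss τ x) - 1) ^ 2 ∂M.trueLaw := by
          rw [M.norm_sq_L20]
          refine integral_congr_ae ?_
          filter_upwards [M.coeFn_toL20 hh hh0] with x hx
          rw [hq, hx]
      _ ≤ ∫ x, K ^ 2 * M.relLoss τ x ^ 2 ∂M.trueLaw := by
          refine integral_mono_ae hh.integrable_sq ((M.memLp_relLoss τ).integrable_sq.const_mul _) ?_
          filter_upwards [hbd] with x hx
          have := pow_le_pow_left₀ (abs_nonneg _) hx 2
          rwa [sq_abs, mul_pow, sq_abs] at this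
      _ ≤ K ^ 2 * ((K ^ 2 + 1) * ‖M.etaL2 τ - M.etaL2 M.τ₀‖ ^ 2) := by
          rw [integral_const_mul]
          exact mul_le_mul_of_nonneg_left (integral_relLoss_sq_le hK h0 hb) (by positivity)
      _ ≤ _ := by
          rw [mul_pow, mul_pow, mul_assoc]
          gcongr
          nlinarith
  have e4 : ‖q‖ ≤ K * (K + 1) * ‖M.etaL2 τ - M.etaL2 M.τ₀‖ := le_of_sq_le_sq e3 (by positivity)
  rw [e1]
  exact (abs_real_inner_le_norm _ _).trans (mul_le_mul_of_nonneg_right e4 (norm_nonneg _))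

/-- Bernstein's argument: when the second moment is at most A times the mean and the scale L is at
least 2A, the quadratic term of the exponential consumes at most half of the linear one. -/
theorem lintegral_exp_neg_relLoss_le {A L : ℝ} (hK : 1 ≤ K)
    (hb : M.RatioBound K τ) (hA : ∫ x, M.relLoss τ x ^ 2 ∂M.trueLaw ≤ A * M.logZ τ)
    (hL : 0 < L) (hL1 : Real.log K ≤ L) (hL2 : 2 * A ≤ L) (hZ : 0 ≤ M.logZ τ) :
    ∫⁻ x, ENNReal.ofReal (Real.exp (-(M.relLoss τ x / L))) ∂M.trueLaw
      ≤ ENNReal.ofReal (Real.exp (-(M.logZ τ / (2 * L)))) := by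
  have hi := (M.memLp_relLoss τ).integrable one_le_two
  have hi2 := (M.memLp_relLoss τ).integrable_sq
  have hbd := hb.abs_relLoss_le hK
  have h1 : ∀ᵐ x ∂M.trueLaw, Real.exp (-(M.relLoss τ x / L))
      ≤ 1 - M.relLoss τ x / L + M.relLoss τ x ^ 2 / L ^ 2 := by
    filter_upwards [hbd] with x hx
    have h2 : |-(M.relLoss τ x / L)| ≤ 1 := by
      rw [abs_neg, abs_div, abs_of_pos hL, div_le_one hL]
      exact hx.trans hL1
    have h3 := (abs_le.1 (Real.abs_exp_sub_one_sub_id_le h2)).2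
    have e : (-(M.relLoss τ x / L)) ^ 2 = M.relLoss τ x ^ 2 / L ^ 2 := by rw [neg_sq, div_pow]
    rw [e] at h3
    linarith
  have hi3 : Integrable (fun x => 1 - M.relLoss τ x / L) M.trueLaw :=
    (integrable_const 1).sub (hi.div_const L)
  have hg : Integrable (fun x => 1 - M.relLoss τ x / L + M.relLoss τ x ^ 2 / L ^ 2) M.trueLaw :=
    hi3.add (hi2.div_const _)
  calc ∫⁻ x, ENNReal.ofReal (Real.exp (-(M.relLoss τ x / L))) ∂M.trueLaw
      ≤ ∫⁻ x, ENNReal.ofReal (1 - M.relLoss τ x / L + M.relLoss τ x ^ 2 / L ^ 2) ∂M.trueLaw :=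
        lintegral_mono_ae (h1.mono fun x hx => ENNReal.ofReal_le_ofReal hx)
    _ = ENNReal.ofReal (∫ x, (1 - M.relLoss τ x / L + M.relLoss τ x ^ 2 / L ^ 2) ∂M.trueLaw) :=
        (ofReal_integral_eq_lintegral_ofReal hg
          (h1.mono fun x hx => (Real.exp_pos _).le.trans hx)).symm
    _ ≤ _ := by
        refine ENNReal.ofReal_le_ofReal ?_
        rw [integral_add hi3 (hi2.div_const _), integral_sub (integrable_const _)
          (hi.div_const L), integral_div, integral_div, M.integral_relLoss]
        refine le_trans ?_ (Real.add_one_le_exp _)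
        have h4 : (∫ x, M.relLoss τ x ^ 2 ∂M.trueLaw) / L ^ 2 ≤ M.logZ τ / (2 * L) := by
          rw [div_le_div_iff₀ (by positivity) (by positivity)]
          have h5 : 2 * (∫ x, M.relLoss τ x ^ 2 ∂M.trueLaw) ≤ L * M.logZ τ := by nlinarith
          nlinarith
        have h6 : M.logZ τ / L = M.logZ τ / (2 * L) + M.logZ τ / (2 * L) := by
          field_simp; ring
        simp only [integral_const, smul_eq_mul, probReal_univ, mul_one]
        linarith

end Model

/-! ### Effective dimension -/

theorem sum_rpow_neg_le {r : ℝ} (hr : 1 < r) {j : ℕ} (hj : 0 < j) (m : ℕ) :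
    ∑ i ∈ Finset.range m, ((j : ℝ) + ((i + 1 : ℕ) : ℝ)) ^ (-r) ≤ (j : ℝ) ^ (1 - r) / (r - 1) := by
  have hj' : (0 : ℝ) < j := by exact_mod_cast hj
  have hm : (0 : ℝ) ≤ m := Nat.cast_nonneg m
  have hanti : AntitoneOn (fun x : ℝ => x ^ (-r)) (Icc (j : ℝ) (j + m)) := fun x hx y hy hxy =>
    Real.rpow_le_rpow_of_nonpos (hj'.trans_le hx.1) hxy (by linarith)
  refine (hanti.sum_le_integral).trans ?_
  rw [integral_rpow (Or.inr ⟨by linarith, ?_⟩)]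
  · have h1 : -r + 1 = -(r - 1) := by ring
    have h2 : 1 - r = -(r - 1) := by ring
    rw [h1, h2, div_neg, ← neg_div]
    have h3 : 0 ≤ ((j : ℝ) + m) ^ (-(r - 1)) := Real.rpow_nonneg (by linarith) _
    have h4 : 0 < r - 1 := by linarith
    gcongr
    linarith
  · rw [uIcc_of_le (by linarith)]
    intro h
    linarith [h.1]

/-- With T = λ^(-1/r), about T of the terms are bounded by 1, and the others by T^r k^(-r)/β, whose
sum is again of order T because r > 1. The number q stands for the parametric coordinates, which
carry no penalty. -/
theorem exists_sum_inv_le {ρ : ℕ → ℝ} {r β q : ℝ} (hr : 1 < r) (hβ : 0 < β) (hq : 0 ≤ q)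
    (hρ0 : ∀ k, 0 ≤ ρ k) (hρ : ∀ᶠ ν : ℕ in atTop, β * ((ν : ℝ) + 1) ^ r < ρ ν) :
    ∃ C : ℝ, 1 ≤ C ∧ ∀ lam : ℝ, 0 < lam → lam ≤ 1 → ∀ m : ℕ,
      q + ∑ k ∈ Finset.range m, (1 + lam * ρ k)⁻¹ ≤ C * lam ^ (-(1 / r)) := by
  obtain ⟨k₀, hk₀⟩ := eventually_atTop.1 hρ
  have hr1 : 0 < r - 1 := by linarith
  refine ⟨q + (k₀ + 2) + (β * (r - 1))⁻¹, ?_, fun lam hl hl1 m => ?_⟩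
  · have : 0 < (β * (r - 1))⁻¹ := by positivity
    have : (0 : ℝ) ≤ k₀ := Nat.cast_nonneg _
    linarith
  set T := lam ^ (-(1 / r)) with hT
  have hT1 : 1 ≤ T := Real.one_le_rpow_of_pos_of_le_one_of_nonpos hl hl1
    (by rw [neg_nonpos]; positivity)
  have hT0 : 0 < T := by linarith
  have hTr : T ^ r = lam⁻¹ := by
    rw [hT, ← Real.rpow_mul hl.le, ← Real.rpow_neg_one]
    congr 1
    field_simp
  -- The cut lies beyond T and also beyond k₀, where the eigenvalue growth is in force.
  set j := ⌈T⌉₊ + k₀ with hj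
  have hjT : T ≤ j := by
    rw [hj]; push_cast
    have := Nat.le_ceil T
    have : (0 : ℝ) ≤ k₀ := Nat.cast_nonneg _
    linarith
  have hjT' : (j : ℝ) ≤ T + 1 + k₀ := by
    rw [hj]; push_cast
    have := Nat.ceil_lt_add_one hT0.le
    linarith
  have hj0 : 0 < j := by
    have : (0 : ℝ) < j := by linarith
    exact_mod_cast this
  have hterm : ∀ k, 0 ≤ (1 + lam * ρ k)⁻¹ := fun k => by
    have := hρ0 k
    positivity
  have hterm1 : ∀ k, (1 + lam * ρ k)⁻¹ ≤ 1 := fun k => by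
    have := mul_nonneg hl.le (hρ0 k)
    exact inv_le_one_of_one_le₀ (by linarith)
  have htail : ∀ i, (1 + lam * ρ (j + i))⁻¹
      ≤ T ^ r * β⁻¹ * ((j : ℝ) + ((i + 1 : ℕ) : ℝ)) ^ (-r) := by
    intro i
    have h1 := (hk₀ (j + i) (by omega)).le
    push_cast at h1 ⊢
    have h2 : (0 : ℝ) < (j : ℝ) + i + 1 := by positivity
    have h3 : 0 < ((j : ℝ) + i + 1) ^ r := Real.rpow_pos_of_pos h2 r
    rw [hTr, ← add_assoc, Real.rpow_neg h2.le, ← mul_inv, ← mul_inv]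
    apply inv_anti₀ (by positivity)
    have h4 := mul_le_mul_of_nonneg_left h1 hl.le
    linarith
  have hsum : ∑ k ∈ Finset.range m, (1 + lam * ρ k)⁻¹ ≤ (j : ℝ) + (β * (r - 1))⁻¹ * T := by
    calc ∑ k ∈ Finset.range m, (1 + lam * ρ k)⁻¹
        ≤ ∑ k ∈ Finset.range (j + m), (1 + lam * ρ k)⁻¹ :=
          Finset.sum_le_sum_of_subset_of_nonneg
            (Finset.range_mono (by omega)) fun k _ _ => hterm k
      _ = ∑ k ∈ Finset.range j, (1 + lam * ρ k)⁻¹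
          + ∑ i ∈ Finset.range m, (1 + lam * ρ (j + i))⁻¹ := Finset.sum_range_add _ _ _
      _ ≤ (j : ℝ) + (β * (r - 1))⁻¹ * T := by
        gcongr
        · calc _ ≤ ∑ k ∈ Finset.range j, (1 : ℝ) := Finset.sum_le_sum fun k _ => hterm1 k
            _ = j := by simp
        · calc _ ≤ ∑ i ∈ Finset.range m, T ^ r * β⁻¹ * ((j : ℝ) + ((i + 1 : ℕ) : ℝ)) ^ (-r) :=
              Finset.sum_le_sum fun i _ => htail i
            _ ≤ T ^ r * β⁻¹ * ((j : ℝ) ^ (1 - r) / (r - 1)) := by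
              rw [← Finset.mul_sum]
              exact mul_le_mul_of_nonneg_left (sum_rpow_neg_le hr hj0 m) (by positivity)
            _ ≤ T ^ r * β⁻¹ * (T ^ (1 - r) / (r - 1)) := by
              have := Real.rpow_le_rpow_of_nonpos hT0 hjT (by linarith : 1 - r ≤ 0)
              gcongr
            _ = (β * (r - 1))⁻¹ * (T ^ r * T ^ (1 - r)) := by
              field_simp
            _ = (β * (r - 1))⁻¹ * T := by
              rw [← Real.rpow_add hT0, add_sub_cancel, Real.rpow_one]
  have hk : (0 : ℝ) ≤ k₀ := Nat.cast_nonneg _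
  nlinarith [mul_le_mul_of_nonneg_left hT1 hq, mul_le_mul_of_nonneg_left hT1 hk]

/-! ### Quadratic forms -/

section forms

variable {H : Type*} [NormedAddCommGroup H] [InnerProductSpace ℝ H]
  {J : LinearMap.BilinForm ℝ H}

theorem convexOn_form (hJ : J.IsPosSemidef) : ConvexOn ℝ univ fun h => J h h := by
  refine ⟨convex_univ, fun x _ y _ a b ha hb hab => ?_⟩
  have h1 := hJ.nonneg (x - y)
  have h2 := hJ.eq x y
  simp only [map_add, map_sub, map_smul, LinearMap.add_apply, LinearMap.sub_apply,
    LinearMap.smul_apply, smul_eq_mul] at h1 h2 ⊢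
  obtain rfl : b = 1 - a := by linarith
  nlinarith [mul_nonneg (mul_nonneg ha hb) h1]

/-- Nonnegativity of J at 2x + g absorbs the cross term, so half of J(g) survives. -/
theorem half_sub_le_form_add_sub (hJ : J.IsPosSemidef) (x g : H) :
    J g g / 2 - 2 * J x x ≤ J (x + g) (x + g) - J x x := by
  have h1 := hJ.nonneg ((2 : ℝ) • x + g)
  have h2 := hJ.eq x g
  simp only [map_add, map_smul, LinearMap.add_apply,
    LinearMap.smul_apply, smul_eq_mul] at h1 h2 ⊢
  linarith

/-- The Cauchy-Schwarz inequality for the semidefinite form passes from the diagonal bound to a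
bound on the bilinear form. -/
theorem continuous_form (hJ : J.IsPosSemidef) {C : ℝ} (hC : ∀ g, J g g ≤ C * ‖g‖ ^ 2) :
    Continuous fun h => J h h := by
  have hb : ∀ x y, ‖J x y‖ ≤ C * ‖x‖ * ‖y‖ := by
    intro x y
    have hC0 : 0 ≤ C * ‖x‖ * ‖y‖ := by
      rcases eq_or_ne x 0 with h | h
      · simp [h]
      have h1 := (hJ.nonneg x).trans (hC x)
      have h2 : 0 < ‖x‖ ^ 2 := by positivity
      have := nonneg_of_mul_nonneg_left h1 h2
      positivity
    have h1 := LinearMap.BilinForm.apply_sq_le_of_symm J hJ.nonneg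
      (LinearMap.BilinForm.isPosSemidef_iff.1 hJ).isSymm x y
    have h2 : J x y ^ 2 ≤ (C * ‖x‖ * ‖y‖) ^ 2 := by
      calc J x y ^ 2 ≤ J x x * J y y := h1
        _ ≤ (C * ‖x‖ ^ 2) * (C * ‖y‖ ^ 2) :=
          mul_le_mul (hC x) (hC y) (hJ.nonneg y) ((hJ.nonneg x).trans (hC x))
        _ = _ := by ring
    exact abs_le_of_sq_le_sq h2 hC0
  exact ((LinearMap.mkContinuous₂ J C hb).continuous₂).comp (continuous_id.prodMk continuous_id)

end forms

/-! ### Equivalence of norms -/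

section norms

variable {E H F : Type*} [NormedAddCommGroup E] [NormedSpace ℝ E] [NormedAddCommGroup H]
  [NormedSpace ℝ H] [NormedAddCommGroup F] [NormedSpace ℝ F] {A : E →L[ℝ] F} {B : H →L[ℝ] F}

theorem mul_norm_sq_le_of_separated {c : ℝ} (hc : ∀ ζ g, ‖ζ‖ = 1 → c < ‖A ζ - B g‖ ^ 2)
    (ζ : E) (g : H) : c * ‖ζ‖ ^ 2 ≤ ‖A ζ + B g‖ ^ 2 := by
  rcases eq_or_ne ζ 0 with h | h
  · rw [h]
    simp
  have h0 : 0 < ‖ζ‖ := norm_pos_iff.2 h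
  have h1 := (hc (‖ζ‖⁻¹ • ζ) (-(‖ζ‖⁻¹ • g))
    (by rw [norm_smul, norm_inv, norm_norm, inv_mul_cancel₀ h0.ne'])).le
  rw [map_neg, sub_neg_eq_add, map_smul, map_smul, ← smul_add, norm_smul, mul_pow, norm_inv,
    norm_norm, inv_pow, ← div_eq_inv_mul, le_div_iff₀ (by positivity)] at h1
  exact h1

omit [NormedSpace ℝ F] in
theorem norm_sq_add_le (x y : F) : ‖x + y‖ ^ 2 ≤ 2 * ‖x‖ ^ 2 + 2 * ‖y‖ ^ 2 := by
  have h := pow_le_pow_left₀ (norm_nonneg _) (norm_add_le x y) 2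
  nlinarith [sq_nonneg (‖x‖ - ‖y‖)]

/-- Separation, extended by homogeneity, recovers ‖ζ‖ from the norm of the sum; the triangle
inequality then recovers ‖B g‖. -/
theorem exists_norm_sq_equiv {c : ℝ} (hc0 : 0 < c)
    (hc : ∀ ζ g, ‖ζ‖ = 1 → c < ‖A ζ - B g‖ ^ 2) :
    ∃ a > 0, ∃ b > 0, ∀ ζ g, a * (‖ζ‖ ^ 2 + ‖B g‖ ^ 2) ≤ ‖A ζ + B g‖ ^ 2 ∧
      ‖A ζ + B g‖ ^ 2 ≤ b * (‖ζ‖ ^ 2 + ‖B g‖ ^ 2) := by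
  have hA : ∀ ζ, ‖A ζ‖ ^ 2 ≤ ‖A‖ ^ 2 * ‖ζ‖ ^ 2 := fun ζ => by
    rw [← mul_pow]
    exact pow_le_pow_left₀ (norm_nonneg _) (A.le_opNorm ζ) 2
  set D := c⁻¹ + (2 + 2 * ‖A‖ ^ 2 * c⁻¹) with hD
  have hci : 0 < c⁻¹ := inv_pos.2 hc0
  refine ⟨D⁻¹, by positivity, 2 * ‖A‖ ^ 2 + 2, by positivity, fun ζ g => ⟨?_, ?_⟩⟩
  · rw [inv_mul_le_iff₀ (by positivity)]
    have h1 := mul_norm_sq_le_of_separated hc ζ g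
    have h2 : ‖ζ‖ ^ 2 ≤ c⁻¹ * ‖A ζ + B g‖ ^ 2 := by
      rw [le_inv_mul_iff₀ hc0]; exact h1
    have h3 : ‖B g‖ ^ 2 ≤ 2 * ‖A ζ + B g‖ ^ 2 + 2 * ‖A ζ‖ ^ 2 := by
      have := norm_sq_add_le (A ζ + B g) (-(A ζ))
      rw [norm_neg] at this
      simpa using this
    have h4 := mul_le_mul_of_nonneg_left h2 (sq_nonneg ‖A‖)
    have h5 := hA ζ
    rw [hD]
    nlinarith
  · have h1 := norm_sq_add_le (A ζ) (B g)
    have h5 := hA ζ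
    nlinarith [sq_nonneg ‖ζ‖, sq_nonneg ‖B g‖, mul_nonneg (sq_nonneg ‖A‖) (sq_nonneg ‖B g‖)]

end norms

/-! ### Uniform lower bound for the empirical loss in coordinates -/

namespace Model

variable {p : ℕ} {H : Type*} [NormedAddCommGroup H] [InnerProductSpace ℝ H]
  {𝒳 : Type*} [MeasurableSpace 𝒳]

/-- The regularity of the relative loss, scaled by `L⁻¹`, with respect to the quadratic form `W`:
bounded oscillation, an exponential moment, and affine minorants whose gradients are small in mean
near the true parameter. -/
structure RegularLoss (M : Model p H 𝒳) (N : Set (EuclideanSpace ℝ (Fin p) × H))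
    (W : EuclideanSpace ℝ (Fin p) × H → ℝ) (c C L : ℝ) : Prop where
  neg_one_le : ∀ σ ∈ N, ∀ τ ∈ N, ∀ᵐ x ∂M.trueLaw, -1 ≤ M.relLoss τ x / L - M.relLoss σ x / L
  lintegral_le : ∀ τ ∈ N, ∫⁻ x, ENNReal.ofReal (Real.exp (-(M.relLoss τ x / L))) ∂M.trueLaw
    ≤ ENNReal.ofReal (Real.exp (-(c * W (τ - M.τ₀))))
  exists_minorant : ∀ σ ∈ N, ∃ (ξ : EuclideanSpace ℝ (Fin p) × H →ₗ[ℝ] M.L20)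
    (a : EuclideanSpace ℝ (Fin p) × H →ₗ[ℝ] ℝ),
    (∀ τ ∈ N, ∀ᵐ x ∂M.trueLaw, a (τ - σ) - (ξ (τ - σ) : Lp ℝ 2 M.trueLaw) x
      ≤ M.relLoss τ x / L - M.relLoss σ x / L) ∧
    (∀ w, |a w| ≤ C * √(W (σ - M.τ₀)) * √(W w)) ∧
    (∀ w, a w ^ 2 + ‖ξ w‖ ^ 2 ≤ C * W w)

variable {M : Model p H 𝒳} [IsProbabilityMeasure M.trueLaw]
  {N : Set (EuclideanSpace ℝ (Fin p) × H)}

/-- The population facts are rescaled so that bounded oscillation becomes the lower bound -1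
required by the truncation. The minorant at σ is the scaled subgradient: its deterministic part `a`
is the mean under σ, which is small when σ is near τ₀. -/
theorem exists_regularLoss (hconv : M.ConvexityAssumption N) (hNc : Convex ℝ N)
    {K : ℝ} (hK : 1 ≤ K) (hb : ∀ τ ∈ N, M.RatioBound K τ) (h0 : M.τ₀ ∈ N)
    (hd : ∀ τ ∈ N, DifferentiableAt ℝ M.etaL2 τ)
    {W : EuclideanSpace ℝ (Fin p) × H → ℝ} (hW : ∀ w, 0 ≤ W w) {c₁ c₂ : ℝ} (hc₁ : 0 < c₁)
    (hc₂ : 0 < c₂) (hD : ∀ σ ∈ N, ∀ w, c₁ * W w ≤ ‖fderiv ℝ M.etaL2 σ w‖ ^ 2 ∧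
      ‖fderiv ℝ M.etaL2 σ w‖ ^ 2 ≤ c₂ * W w) :
    ∃ c > 0, ∃ C > 0, ∃ L : ℝ, 1 ≤ L ∧ M.RegularLoss N W c C L := by
  have hlog := Real.log_nonneg hK
  have hK0 : 0 < K := by linarith
  set κ := (64 * (1 + Real.log K) * K ^ 2)⁻¹ with hκ
  have hκ0 : 0 < κ := by positivity
  set A := (K ^ 2 + 1) * c₂ / (κ * c₁) with hA
  have hA0 : 0 < A := by positivity
  -- The term 2 log K bounds the oscillation of `relLoss`, and 2A meets the requirement of
  -- Bernstein's argument, A bounding the ratio of second moment to mean.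
  set L := 1 + 2 * Real.log K + 2 * A with hL
  have hL1 : 1 ≤ L := by rw [hL]; linarith
  have hL0 : 0 < L := by linarith
  have hLi : L⁻¹ ≤ 1 := inv_le_one_of_one_le₀ hL1
  have hLi0 : 0 < L⁻¹ := inv_pos.2 hL0
  have hnorm : ∀ σ ∈ N, ∀ w, ‖fderiv ℝ M.etaL2 σ w‖ ≤ √(c₂ * W w) := fun σ hσ w =>
    Real.le_sqrt_of_sq_le (hD σ hσ w).2
  have heta : ∀ τ ∈ N, ‖M.etaL2 τ - M.etaL2 M.τ₀‖ ≤ √(c₂ * W (τ - M.τ₀)) := fun τ hτ =>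
    norm_etaL2_sub_le hNc h0 hτ hd fun ν hν => hnorm ν hν _
  have hZlow : ∀ τ ∈ N, κ * (c₁ * W (τ - M.τ₀)) ≤ M.logZ τ := fun τ hτ =>
    mul_le_logZ hconv hNc hK hb h0 hτ hd (mul_nonneg hc₁.le (hW _)) fun σ hσ => (hD σ hσ _).1
  refine ⟨κ * c₁ / (2 * L), by positivity, 2 * K * (K + 1) * c₂, by positivity, L, hL1, ?_, ?_, ?_⟩
  · intro σ hσ τ hτ
    filter_upwards [(hb σ hσ).abs_relLoss_le hK, (hb τ hτ).abs_relLoss_le hK] with x h1 h2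
    rw [← sub_div, le_div_iff₀ hL0]
    have := abs_le.1 h1
    have := abs_le.1 h2
    linarith
  · intro τ hτ
    have hZ0 : 0 ≤ M.logZ τ :=
      le_trans (mul_nonneg hκ0.le (mul_nonneg hc₁.le (hW _))) (hZlow τ hτ)
    have h1 : ∫ x, M.relLoss τ x ^ 2 ∂M.trueLaw ≤ A * M.logZ τ := by
      have h2 := integral_relLoss_sq_le hK (hb _ h0) (hb τ hτ)
      have h3 := pow_le_pow_left₀ (norm_nonneg _) (heta τ hτ) 2
      rw [Real.sq_sqrt (mul_nonneg hc₂.le (hW _))] at h3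
      have h4 := mul_le_mul_of_nonneg_left (hZlow τ hτ) hA0.le
      have h5 : A * (κ * (c₁ * W (τ - M.τ₀))) = (K ^ 2 + 1) * (c₂ * W (τ - M.τ₀)) := by
        rw [hA]; field_simp
      have h6 := mul_le_mul_of_nonneg_left h3 (by positivity : 0 ≤ K ^ 2 + 1)
      linarith
    refine (lintegral_exp_neg_relLoss_le hK (hb τ hτ) h1 hL0 (by rw [hL]; linarith)
      (by rw [hL]; linarith) hZ0).trans ?_
    refine ENNReal.ofReal_le_ofReal (Real.exp_le_exp.2 (neg_le_neg ?_))
    have h7 := hZlow τ hτ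
    rw [div_mul_eq_mul_div, mul_assoc]
    gcongr
  · intro σ hσ
    refine ⟨L⁻¹ • (fderiv ℝ M.etaL2 σ).toLinearMap,
      L⁻¹ • ((hb σ hσ).meanL.comp (fderiv ℝ M.etaL2 σ)).toLinearMap, ?_, ?_, ?_⟩
    · intro τ hτ
      filter_upwards [relLoss_linearization hconv hNc hK hb hσ hτ (hd σ hσ),
        Lp.coeFn_smul L⁻¹ ((fderiv ℝ M.etaL2 σ (τ - σ) : M.L20) : Lp ℝ 2 M.trueLaw)] with x h1 h2
      have e : ((L⁻¹ • (fderiv ℝ M.etaL2 σ).toLinearMap) (τ - σ) : M.L20)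
          = L⁻¹ • (fderiv ℝ M.etaL2 σ (τ - σ)) := rfl
      have e' : (L⁻¹ • ((hb σ hσ).meanL.comp (fderiv ℝ M.etaL2 σ)).toLinearMap) (τ - σ)
          = L⁻¹ * (hb σ hσ).meanL (fderiv ℝ M.etaL2 σ (τ - σ)) := rfl
      rw [e, e', Submodule.coe_smul, h2, Pi.smul_apply, smul_eq_mul, ← sub_div, ← mul_sub,
        div_eq_inv_mul]
      exact mul_le_mul_of_nonneg_left h1 hLi0.le
    · intro w
      have e' : (L⁻¹ • ((hb σ hσ).meanL.comp (fderiv ℝ M.etaL2 σ)).toLinearMap) w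
          = L⁻¹ * (hb σ hσ).meanL (fderiv ℝ M.etaL2 σ w) := rfl
      rw [e', abs_mul, abs_of_pos hLi0]
      have h1 := abs_meanL_le_mul hK (hb _ h0) (hb σ hσ) (fderiv ℝ M.etaL2 σ w)
      have h2 := mul_le_mul (heta σ hσ) (hnorm σ hσ w) (norm_nonneg _) (Real.sqrt_nonneg _)
      rw [Real.sqrt_mul hc₂.le, Real.sqrt_mul hc₂.le] at h2
      have h3 : √c₂ * √(W (σ - M.τ₀)) * (√c₂ * √(W w)) = c₂ * (√(W (σ - M.τ₀)) * √(W w)) := by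
        rw [mul_mul_mul_comm, Real.mul_self_sqrt hc₂.le]
      rw [h3] at h2
      have h4 : 0 ≤ √(W (σ - M.τ₀)) * √(W w) := by positivity
      have h5 : 0 ≤ K * (K + 1) := by positivity
      calc L⁻¹ * |(hb σ hσ).meanL (fderiv ℝ M.etaL2 σ w)|
          ≤ |(hb σ hσ).meanL (fderiv ℝ M.etaL2 σ w)| :=
            mul_le_of_le_one_left (abs_nonneg _) hLi
        _ ≤ K * (K + 1) * (‖M.etaL2 σ - M.etaL2 M.τ₀‖ * ‖fderiv ℝ M.etaL2 σ w‖) := by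
            rw [← mul_assoc]; exact h1
        _ ≤ K * (K + 1) * (c₂ * (√(W (σ - M.τ₀)) * √(W w))) :=
            mul_le_mul_of_nonneg_left h2 h5
        _ ≤ 2 * (K * (K + 1) * (c₂ * (√(W (σ - M.τ₀)) * √(W w)))) :=
            le_mul_of_one_le_left (by positivity) one_le_two
        _ = _ := by ring
    · intro w
      have e : ((L⁻¹ • (fderiv ℝ M.etaL2 σ).toLinearMap) w : M.L20)
          = L⁻¹ • (fderiv ℝ M.etaL2 σ w) := rfl
      have e' : (L⁻¹ • ((hb σ hσ).meanL.comp (fderiv ℝ M.etaL2 σ)).toLinearMap) w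
          = L⁻¹ * (hb σ hσ).meanL (fderiv ℝ M.etaL2 σ w) := rfl
      have h1 := pow_le_pow_left₀ (abs_nonneg _)
        ((hb σ hσ).abs_meanL_le (fderiv ℝ M.etaL2 σ w)) 2
      rw [sq_abs] at h1
      have h2 := (hD σ hσ w).2
      rw [e, e', norm_smul, mul_pow, mul_pow, norm_inv, Real.norm_of_nonneg hL0.le, ← mul_add]
      have h3 : L⁻¹ ^ 2 ≤ 1 := pow_le_one₀ hLi0.le hLi
      have h4 : 0 ≤ c₂ * W w := mul_nonneg hc₂.le (hW _)
      refine (mul_le_of_le_one_left (by positivity) h3).trans ?_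
      nlinarith [mul_nonneg hK0.le h4, mul_nonneg (mul_nonneg hK0.le hK0.le) h4,
        mul_le_mul_of_nonneg_left h2 (sq_nonneg K), mul_le_mul_of_nonneg_right hK h4]

omit [IsProbabilityMeasure M.trueLaw] in
theorem coeFn_sum_smul {ι : Type*} (s : Finset ι) (w : ι → ℝ) (f : ι → M.L20) :
    ∀ᵐ x ∂M.trueLaw, ((∑ k ∈ s, w k • f k : M.L20) : Lp ℝ 2 M.trueLaw) x
      = ∑ k ∈ s, w k * (f k : Lp ℝ 2 M.trueLaw) x := by
  classical
  induction s using Finset.induction_on with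
  | empty =>
    filter_upwards [Lp.coeFn_zero ℝ 2 M.trueLaw] with x hx
    simpa using hx
  | insert i s hi ih =>
    filter_upwards [ih, Lp.coeFn_add ((w i • f i : M.L20) : Lp ℝ 2 M.trueLaw)
        ((∑ k ∈ s, w k • f k : M.L20) : Lp ℝ 2 M.trueLaw),
      Lp.coeFn_smul (w i) ((f i : M.L20) : Lp ℝ 2 M.trueLaw)] with x h1 h2 h3
    rw [Finset.sum_insert hi, Finset.sum_insert hi, Submodule.coe_add, h2, Pi.add_apply, h1,
      Submodule.coe_smul, h3, Pi.smul_apply, smul_eq_mul]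

/-- A linear parametrization B carrying the Euclidean square to W translates the regularity of the
loss into the hypotheses of `exists_uniform_lower_bound`. Rational coordinates keep the index set
countable, so the almost sure minorant relations hold simultaneously. -/
theorem RegularLoss.exists_lower_bound {W : EuclideanSpace ℝ (Fin p) × H → ℝ} {c C L : ℝ}
    (hR : M.RegularLoss N W c C L) (h0 : M.τ₀ ∈ N) (hc : 0 < c) (hC : 0 < C)
    {Ω : Type*} [MeasurableSpace Ω] {P : Measure Ω} [IsProbabilityMeasure P]
    {X : ℕ → Ω → 𝒳} (hX : ∀ i, Measurable (X i)) (hlaw : ∀ i, P.map (X i) = M.trueLaw)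
    (hind : iIndepFun X P) {ε : ℝ} (hε : 0 < ε) :
    ∃ K > 0, ∃ c₀ > 0, ∀ (ι : Type) [Fintype ι]
      (B : (ι → ℝ) →ₗ[ℝ] EuclideanSpace ℝ (Fin p) × H) (b : ι → ℝ) (D δ : ℝ) (n : ℕ),
      (∀ v, W (B v) = ∑ k, v k ^ 2) → (∀ k, 1 ≤ b k) → ∑ k, (b k)⁻¹ ≤ D → 1 ≤ D → 0 < δ →
      K * D ≤ n * δ ^ 2 →
      P {ω | ∃ v : ι → ℝ, (∃ q : ι → ℚ, v = fun k => (q k : ℝ)) ∧ M.τ₀ + B v ∈ N ∧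
        δ ^ 2 / 4 < ∑ k, v k ^ 2 ∧ ∑ k, v k ^ 2 < 4 * δ ^ 2 ∧
        ∑ i ∈ Finset.range n, M.relLoss (M.τ₀ + B v) (X i ω) / L
          + n / 4 * ∑ k, (b k - 1) * v k ^ 2 ≤ n * (c₀ * δ ^ 2)} ≤ ENNReal.ofReal ε := by
  classical
  obtain ⟨K, hK, c₀, hc₀, h⟩ := exists_uniform_lower_bound hX hlaw hind hc hC hε
  refine ⟨K, hK, c₀, hc₀, fun ι _ B b D δ n hW hb hD hD1 hδ hn => ?_⟩
  set U : Set (ι → ℝ) := {v | (∃ q : ι → ℚ, v = fun k => (q k : ℝ)) ∧ M.τ₀ + B v ∈ N} with hU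
  choose! ξ a hmin ha hξ using hR.exists_minorant
  set e : ι → EuclideanSpace ℝ (Fin p) × H := fun k => B (Pi.single k 1) with he
  set y : (ι → ℝ) → ι → 𝒳 → ℝ := fun u k x =>
    a (M.τ₀ + B u) (e k) - (ξ (M.τ₀ + B u) (e k) : Lp ℝ 2 M.trueLaw) x with hy
  have hBe : ∀ w : ι → ℝ, B w = ∑ k, w k • e k := fun w => by
    conv_lhs => rw [pi_eq_sum_univ' w]
    rw [map_sum]
    simp only [map_smul, he]
  have hsum : ∀ u w, ∀ᵐ x ∂M.trueLaw, ∑ k, w k * y u k x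
      = a (M.τ₀ + B u) (B w) - (ξ (M.τ₀ + B u) (B w) : Lp ℝ 2 M.trueLaw) x := by
    intro u w
    filter_upwards [coeFn_sum_smul Finset.univ w fun k => ξ (M.τ₀ + B u) (e k)] with x hx
    rw [hBe w, map_sum, map_sum]
    simp only [map_smul, hx, smul_eq_mul, hy, mul_sub, Finset.sum_sub_distrib]
  have hy2 : ∀ u k, MemLp (y u k) 2 M.trueLaw := fun u k =>
    (memLp_const _).sub (M.memLp_L20 _)
  have hyint : ∀ u k, ∫ x, y u k x ∂M.trueLaw = a (M.τ₀ + B u) (e k) := fun u k => by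
    simp only [hy]
    rw [integral_sub (integrable_const _) ((M.memLp_L20 _).integrable one_le_two),
      M.integral_L20]
    simp
  have hcancel : ∀ u : ι → ℝ, M.τ₀ + B u - M.τ₀ = B u := fun u => by abel
  have hmain := h ι U (fun v x => M.relLoss (M.τ₀ + B v) x / L) y b D δ n ?_ ?_ ?_ ?_ ?_ ?_ ?_ ?_
    ?_ ?_ ?_ hb hD hD1 hδ hn
  · refine (measure_mono ?_).trans hmain
    rintro ω ⟨v, hq, hv, h1, h2, h3⟩
    exact ⟨v, ⟨hq, hv⟩, h1, h2, h3⟩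
  · refine (countable_range fun (q : ι → ℚ) (k : ι) => (q k : ℝ)).mono ?_
    rintro v ⟨⟨q, hq⟩, -⟩
    exact ⟨q, hq.symm⟩
  · exact ⟨⟨0, by ext; simp⟩, by simpa using h0⟩
  · ext x
    simp [relLoss_trueParam]
  · exact fun v _ => (M.measurable_relLoss _).div_const _
  · exact fun u _ k => measurable_const.sub (M.measurable_L20 _)
  · exact fun u _ k => hy2 u k
  · exact fun u hu v hv => hR.neg_one_le _ hu.2 _ hv.2
  · intro v hv
    have := hR.lintegral_le _ hv.2
    rwa [hcancel, hW] at this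
  · intro u hu v hv
    filter_upwards [hsum u (v - u), hmin _ hu.2 _ hv.2] with x h1 h2
    have h3 : M.τ₀ + B v - (M.τ₀ + B u) = B (v - u) := by rw [map_sub]; abel
    rw [h3, ← h1] at h2
    exact h2
  · intro u hu w
    have h1 : ∑ k, w k * ∫ x, y u k x ∂M.trueLaw = a (M.τ₀ + B u) (B w) := by
      rw [hBe w, map_sum]
      simp only [map_smul, smul_eq_mul, hyint]
    have h2 := (abs_le.1 (ha _ hu.2 (B w))).1
    rw [hcancel, hW, hW] at h2
    rw [h1]
    exact h2
  · intro u hu w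
    have h1 := hξ _ hu.2 (B w)
    rw [hW] at h1
    rw [integral_congr_ae ((hsum u w).mono fun x hx => by rw [hx]),
      RatioBound.integral_sq_add_L20]
    exact h1

end Model

/-! ### Expansions in the eigensystem -/

section expansion

variable {H : Type*} [NormedAddCommGroup H] [InnerProductSpace ℝ H]

theorem form_sum_smul {J : LinearMap.BilinForm ℝ H} {φ : ℕ → H} {ρ : ℕ → ℝ}
    (hφ : ∀ i j, J (φ i) (φ j) = if i = j then ρ i else 0) (m : ℕ) (c : ℕ → ℝ) :
    J (∑ k ∈ Finset.range m, c k • φ k) (∑ k ∈ Finset.range m, c k • φ k)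
      = ∑ k ∈ Finset.range m, ρ k * c k ^ 2 := by
  simp only [map_sum, map_smul, LinearMap.sum_apply, LinearMap.smul_apply, smul_eq_mul, hφ]
  refine Finset.sum_congr rfl fun i hi => ?_
  rw [Finset.sum_eq_single i]
  · simp only [if_true]; ring
  · intro j _ hj
    simp [hj]
  · exact fun h => absurd hi h

/-- The points of the parameter space with rational coordinates in `ℝᵖ` and with respect to the
first `m` members of `φ`. -/
def ratPoints (p : ℕ) (φ : ℕ → H) (m : ℕ) : Set (EuclideanSpace ℝ (Fin p) × H) :=
  range fun qc : (Fin p → ℚ) × (ℕ → ℚ) =>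
    (WithLp.toLp 2 fun i => (qc.1 i : ℝ), ∑ k ∈ Finset.range m, (qc.2 k : ℝ) • φ k)

theorem ratPoints_mono (p : ℕ) (φ : ℕ → H) : Monotone (ratPoints p φ) := by
  intro m m' hm
  rintro _ ⟨⟨q, c⟩, rfl⟩
  refine ⟨(q, fun k => if k < m then c k else 0), ?_⟩
  simp only [Prod.mk.injEq, true_and]
  rw [← Finset.sum_subset (Finset.range_mono hm)]
  · refine Finset.sum_congr rfl fun k hk => ?_
    rw [if_pos (Finset.mem_range.1 hk)]
  · intro k _ hk
    rw [if_neg (fun h => hk (Finset.mem_range.2 h))]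
    simp

theorem countable_ratPoints (p : ℕ) (φ : ℕ → H) (m : ℕ) : (ratPoints p φ m).Countable := by
  refine (countable_range fun qc : (Fin p → ℚ) × (Fin m → ℚ) =>
    ((WithLp.toLp 2 fun i => (qc.1 i : ℝ), ∑ k : Fin m, (qc.2 k : ℝ) • φ k) :
      EuclideanSpace ℝ (Fin p) × H)).mono ?_
  rintro _ ⟨⟨q, c⟩, rfl⟩
  refine ⟨(q, fun k => c k), ?_⟩
  simp only [Prod.mk.injEq, true_and]
  exact (Finset.sum_range fun k => (c k : ℝ) • φ k).symm

theorem dense_iUnion_ratPoints (p : ℕ) {φ : ℕ → H}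
    (hφ : (Submodule.span ℝ (range φ)).topologicalClosure = ⊤) :
    Dense (⋃ m, ratPoints p φ m) := by
  have hd : DenseRange fun qc : (Fin p → ℚ) × (ℕ → ℚ) =>
      ((fun i => (qc.1 i : ℝ), fun k => (qc.2 k : ℝ)) : (Fin p → ℝ) × (ℕ → ℝ)) :=
    (DenseRange.piMap fun _ => Rat.denseRange_cast).prodMap
      (DenseRange.piMap fun _ => Rat.denseRange_cast)
  have h1 : ∀ (m : ℕ) (q : Fin p → ℝ) (c : ℕ → ℝ),
      ((WithLp.toLp 2 q, ∑ k ∈ Finset.range m, c k • φ k) : EuclideanSpace ℝ (Fin p) × H)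
        ∈ closure (⋃ m, ratPoints p φ m) := by
    intro m q c
    have hcont : Continuous fun z : (Fin p → ℝ) × (ℕ → ℝ) =>
        ((WithLp.toLp 2 z.1, ∑ k ∈ Finset.range m, z.2 k • φ k) :
          EuclideanSpace ℝ (Fin p) × H) := by
      refine ((PiLp.continuous_toLp 2 _).comp continuous_fst).prodMk ?_
      refine continuous_finsetSum _ fun k _ => ?_
      exact ((continuous_apply k).comp continuous_snd).smul continuous_const
    have hmaps : ∀ z ∈ range fun qc : (Fin p → ℚ) × (ℕ → ℚ) =>
        ((fun i => (qc.1 i : ℝ), fun k => (qc.2 k : ℝ)) : (Fin p → ℝ) × (ℕ → ℝ)),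
        ((WithLp.toLp 2 z.1, ∑ k ∈ Finset.range m, z.2 k • φ k) : EuclideanSpace ℝ (Fin p) × H)
          ∈ ⋃ m, ratPoints p φ m := ?_
    · have h := map_mem_closure hcont (hd (q, c)) hmaps
      exact h
    rintro _ ⟨qc, rfl⟩
    exact mem_iUnion.2 ⟨m, ⟨qc, rfl⟩⟩
  have hspan : Dense (Submodule.span ℝ (range φ) : Set H) :=
    Submodule.dense_iff_topologicalClosure_eq_top.2 hφ
  have h2 : (univ : Set (EuclideanSpace ℝ (Fin p))) ×ˢ (Submodule.span ℝ (range φ) : Set H)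
      ⊆ closure (⋃ m, ratPoints p φ m) := by
    rintro ⟨ζ, g⟩ ⟨-, hg⟩
    obtain ⟨c, hc⟩ := (Finsupp.mem_span_range_iff_exists_finsupp).1 hg
    obtain ⟨m, hm⟩ : ∃ m, c.support ⊆ Finset.range m :=
      ⟨c.support.sup id + 1, fun k hk => Finset.mem_range.2
        (Nat.lt_succ_of_le (Finset.le_sup (f := id) hk))⟩
    have := h1 m (WithLp.ofLp ζ) c
    have e : ∑ k ∈ Finset.range m, c k • φ k = g := by
      change _ = ((ζ, g) : EuclideanSpace ℝ (Fin p) × H).2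
      rw [← hc, Finsupp.sum]
      refine (Finset.sum_subset hm fun k _ hk => ?_).symm
      rw [Finsupp.notMem_support_iff.1 hk, zero_smul]
    rw [e] at this
    exact this
  have h3 := (dense_univ.prod hspan).mono h2
  exact dense_closure.1 h3

end expansion

namespace Model

variable {p : ℕ} {H : Type*} [NormedAddCommGroup H] [InnerProductSpace ℝ H]
  {𝒳 : Type*} [MeasurableSpace 𝒳]

variable {M : Model p H 𝒳} [IsProbabilityMeasure M.trueLaw]
  {N : Set (EuclideanSpace ℝ (Fin p) × H)} {J : LinearMap.BilinForm ℝ H} {Lh : H →L[ℝ] M.L20}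

omit [IsProbabilityMeasure M.trueLaw] in
theorem IsEigensystem.norm_sq_sum {φ : ℕ → H} {ρ : ℕ → ℝ} (hE : M.IsEigensystem J Lh φ ρ)
    (m : ℕ) (c : ℕ → ℝ) :
    ‖Lh (∑ k ∈ Finset.range m, c k • φ k)‖ ^ 2 = ∑ k ∈ Finset.range m, c k ^ 2 := by
  have h := form_sum_smul (J := (innerₗ M.L20).compl₁₂ Lh.toLinearMap Lh.toLinearMap) (φ := φ)
    (ρ := fun _ => 1) (fun i j => by
      rw [← hE.orthonormal i j, cov_true]
      rfl) m c
  simp only [one_mul] at h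
  rw [← h, ← real_inner_self_eq_norm_sq]
  rfl

/-- The constants do not depend on the number m of eigenfunctions, and the bad events increase with
m; continuity of the measure along increasing unions therefore gives the bound for all m together.
-/
theorem RegularLoss.exists_lower_bound_ratPoints {c C L : ℝ}
    (hR : M.RegularLoss N (fun w => ‖w.1‖ ^ 2 + ‖Lh w.2‖ ^ 2) c C L) (h0 : M.τ₀ ∈ N)
    (hc : 0 < c) (hC : 0 < C) {φ : ℕ → H} {ρ : ℕ → ℝ} (hE : M.IsEigensystem J Lh φ ρ)
    (hρ : ∀ k, 0 ≤ ρ k)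
    {Ω : Type*} [MeasurableSpace Ω] {P : Measure Ω} [IsProbabilityMeasure P]
    {X : ℕ → Ω → 𝒳} (hX : ∀ i, Measurable (X i)) (hlaw : ∀ i, P.map (X i) = M.trueLaw)
    (hind : iIndepFun X P) {ε : ℝ} (hε : 0 < ε) :
    ∃ K > 0, ∃ c₀ > 0, ∀ (lam D δ : ℝ) (n : ℕ), 0 < lam →
      (∀ m, (p : ℝ) + ∑ k ∈ Finset.range m, (1 + lam * ρ k)⁻¹ ≤ D) → 1 ≤ D → 0 < δ →
      K * D ≤ n * δ ^ 2 →
      P {ω | ∃ w ∈ ⋃ m, ratPoints p φ m, M.τ₀ + w ∈ N ∧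
        δ ^ 2 / 4 < ‖w.1‖ ^ 2 + ‖Lh w.2‖ ^ 2 ∧ ‖w.1‖ ^ 2 + ‖Lh w.2‖ ^ 2 < 4 * δ ^ 2 ∧
        ∑ i ∈ Finset.range n, M.relLoss (M.τ₀ + w) (X i ω) / L
          + n / 4 * (lam * J w.2 w.2) ≤ n * (c₀ * δ ^ 2)} ≤ ENNReal.ofReal ε := by
  obtain ⟨K, hK, c₀, hc₀, h⟩ := hR.exists_lower_bound h0 hc hC hX hlaw hind hε
  refine ⟨K, hK, c₀, hc₀, fun lam D δ n hl hD hD1 hδ hn => ?_⟩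
  set A : ℕ → Set Ω := fun m => {ω | ∃ w ∈ ratPoints p φ m, M.τ₀ + w ∈ N ∧
        δ ^ 2 / 4 < ‖w.1‖ ^ 2 + ‖Lh w.2‖ ^ 2 ∧ ‖w.1‖ ^ 2 + ‖Lh w.2‖ ^ 2 < 4 * δ ^ 2 ∧
        ∑ i ∈ Finset.range n, M.relLoss (M.τ₀ + w) (X i ω) / L
          + n / 4 * (lam * J w.2 w.2) ≤ n * (c₀ * δ ^ 2)} with hA
  have hAmono : Monotone A := by
    rintro m m' hm ω ⟨w, hw, h⟩
    exact ⟨w, ratPoints_mono p φ hm hw, h⟩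
  have hsub : {ω | ∃ w ∈ ⋃ m, ratPoints p φ m, M.τ₀ + w ∈ N ∧
        δ ^ 2 / 4 < ‖w.1‖ ^ 2 + ‖Lh w.2‖ ^ 2 ∧ ‖w.1‖ ^ 2 + ‖Lh w.2‖ ^ 2 < 4 * δ ^ 2 ∧
        ∑ i ∈ Finset.range n, M.relLoss (M.τ₀ + w) (X i ω) / L
          + n / 4 * (lam * J w.2 w.2) ≤ n * (c₀ * δ ^ 2)} ⊆ ⋃ m, A m := by
    rintro ω ⟨w, hw, h⟩
    obtain ⟨m, hm⟩ := mem_iUnion.1 hw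
    exact mem_iUnion.2 ⟨m, w, hm, h⟩
  refine (measure_mono hsub).trans ?_
  rw [hAmono.measure_iUnion]
  refine iSup_le fun m => ?_
  set B : (Fin p ⊕ Fin m → ℝ) →ₗ[ℝ] EuclideanSpace ℝ (Fin p) × H :=
    { toFun := fun v => (WithLp.toLp 2 fun i => v (Sum.inl i), ∑ k, v (Sum.inr k) • φ k)
      map_add' := fun v w => by
        refine Prod.ext ?_ ?_
        · ext i; simp
        · simp [add_smul, Finset.sum_add_distrib]
      map_smul' := fun a v => by
        refine Prod.ext ?_ ?_
        · ext i; simp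
        · simp [mul_smul, Finset.smul_sum] } with hB
  -- With these weights ∑ (b - 1) v² is the penalty and ∑ b⁻¹ is the truncated effective dimension.
  set b : Fin p ⊕ Fin m → ℝ := Sum.elim (fun _ => 1) (fun k => 1 + lam * ρ k) with hb
  have hW : ∀ v, ‖(B v).1‖ ^ 2 + ‖Lh (B v).2‖ ^ 2 = ∑ k, v k ^ 2 := by
    intro v
    have h1 : ‖(B v).1‖ ^ 2 = ∑ i, v (Sum.inl i) ^ 2 := by
      simp only [hB, LinearMap.coe_mk, AddHom.coe_mk]
      rw [EuclideanSpace.norm_sq_eq]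
      simp
    have h2 : (B v).2 = ∑ k ∈ Finset.range m,
        (if hk : k < m then v (Sum.inr ⟨k, hk⟩) else 0) • φ k := by
      simp only [hB, LinearMap.coe_mk, AddHom.coe_mk]
      rw [Finset.sum_range]
      simp
    rw [h1, h2, hE.norm_sq_sum, Fintype.sum_sum_type, Finset.sum_range]
    simp
  refine (measure_mono ?_).trans (h (Fin p ⊕ Fin m) B b D δ n hW ?_ ?_ hD1 hδ hn)
  · rintro ω ⟨_, ⟨⟨q, d⟩, rfl⟩, hN, h1, h2, h3⟩
    set v : Fin p ⊕ Fin m → ℝ := Sum.elim (fun i => (q i : ℝ)) (fun k => (d k : ℝ)) with hv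
    have hBv : B v = (WithLp.toLp 2 fun i => (q i : ℝ), ∑ k ∈ Finset.range m, (d k : ℝ) • φ k) := by
      simp only [hB, LinearMap.coe_mk, AddHom.coe_mk, hv, Sum.elim_inl, Sum.elim_inr]
      rw [Finset.sum_range]
    have hWv := hW v
    rw [hBv] at hWv
    refine ⟨v, ⟨Sum.elim q (fun k => d k), ?_⟩, ?_, ?_, ?_, ?_⟩
    · ext k
      rcases k with k | k <;> simp [hv]
    · rw [hBv]; exact hN
    · rw [← hWv]; exact h1
    · rw [← hWv]; exact h2
    · rw [hBv]
      refine le_trans (le_of_eq ?_) h3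
      congr 2
      rw [form_sum_smul hE.diagonal, Fintype.sum_sum_type, Finset.sum_range, Finset.mul_sum]
      simp only [hb, hv, Sum.elim_inl, Sum.elim_inr, sub_self, zero_mul, Finset.sum_const_zero,
        zero_add, add_sub_cancel_left]
      exact Finset.sum_congr rfl fun k _ => by ring
  · rintro (k | k)
    · simp [hb]
    · simp only [hb, Sum.elim_inr]
      have := mul_nonneg hl.le (hρ k)
      linarith
  · have := hD m
    rw [Finset.sum_range] at this
    rw [Fintype.sum_sum_type]
    simpa [hb] using this

-- Convexity localizes the minimization: a far minimizer yields a point with W = δ² that is no worse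
-- than τ₀. There the penalized comparison contradicts the lower bound, which is assumed only on a
-- dense set but over an open shell, so that continuity can be used.
omit [IsProbabilityMeasure M.trueLaw] in
theorem form_lt_of_isEstimate {n : ℕ} {x : Fin n → 𝒳} {lam : ℝ} (hl : 0 < lam)
    (hNo : IsOpen N) (h0 : M.τ₀ ∈ N) (hJ : J.IsPosSemidef)
    (hJc : Continuous fun h => J h h) (hcont : ContinuousOn (M.loss n x) N)
    (hconv : ConvexOn ℝ N (M.loss n x)) {τ : EuclideanSpace ℝ (Fin p) × H}
    (hτ : M.IsEstimate J N lam n x τ) {R : Set (EuclideanSpace ℝ (Fin p) × H)} (hRd : Dense R)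
    {L c₀ δ : ℝ} (hL : 0 < L) (hδ : 0 < δ)
    (hlow : ∀ w ∈ R, M.τ₀ + w ∈ N → δ ^ 2 / 4 < ‖w.1‖ ^ 2 + ‖Lh w.2‖ ^ 2 →
      ‖w.1‖ ^ 2 + ‖Lh w.2‖ ^ 2 < 4 * δ ^ 2 →
      c₀ * δ ^ 2 < (M.loss n x (M.τ₀ + w) - M.loss n x M.τ₀) / L + lam / L / 4 * J w.2 w.2)
    (hpen : lam / L * J M.τ₀.2 M.τ₀.2 < c₀ * δ ^ 2) :
    ‖(τ - M.τ₀).1‖ ^ 2 + ‖Lh (τ - M.τ₀).2‖ ^ 2 < δ ^ 2 := by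
  by_contra! hge
  set W : EuclideanSpace ℝ (Fin p) × H → ℝ := fun w => ‖w.1‖ ^ 2 + ‖Lh w.2‖ ^ 2 with hW
  have hWc : Continuous W := by fun_prop
  have hpc : ConvexOn ℝ N (M.penLoss J lam n x) := by
    have h1 : ConvexOn ℝ N fun τ : EuclideanSpace ℝ (Fin p) × H => lam / 2 * J τ.2 τ.2 := by
      have h2 := (convexOn_form hJ).comp_linearMap (LinearMap.snd ℝ (EuclideanSpace ℝ (Fin p)) H)
      exact (h2.subset (subset_univ _) hconv.1).smul (by positivity : 0 ≤ lam / 2)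
    exact hconv.add h1
  have hmin : M.penLoss J lam n x τ ≤ M.penLoss J lam n x M.τ₀ :=
    IsMinOn.of_isLocalMinOn_of_convexOn hτ.1 (hτ.2.1.on N) hpc h0
  set v := τ - M.τ₀ with hv
  set s := √(W v) with hs
  have hsδ : δ ≤ s := Real.le_sqrt_of_sq_le hge
  have hs0 : 0 < s := by linarith
  have hs2 : s ^ 2 = W v := Real.sq_sqrt (by positivity)
  -- W is quadratic, so this scaling of τ - τ₀ lands exactly on W = δ²; t ≤ 1 keeps the point on the
  -- segment.
  set t := δ / s with ht
  have ht0 : 0 ≤ t := by positivity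
  have ht1 : t ≤ 1 := (div_le_one hs0).2 hsδ
  set w := t • v with hw
  have hWw : W w = δ ^ 2 := by
    have : W w = t ^ 2 * W v := by
      simp only [hW, hw, Prod.smul_fst, Prod.smul_snd, map_smul, norm_smul, mul_pow,
        Real.norm_of_nonneg ht0]
      ring
    rw [this, ← hs2, ht, div_pow]
    field_simp
  have hmem : M.τ₀ + w ∈ N := hconv.1.add_smul_sub_mem h0 hτ.1 ⟨ht0, ht1⟩
  have h1 : M.penLoss J lam n x (M.τ₀ + w) ≤ M.penLoss J lam n x M.τ₀ := by
    have e : M.τ₀ + w = (1 - t) • M.τ₀ + t • τ := by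
      rw [hw, hv]; module
    rw [e]
    refine (hpc.2 h0 hτ.1 (by linarith) ht0 (by ring)).trans ?_
    simp only [smul_eq_mul]
    nlinarith
  have h2 := half_sub_le_form_add_sub hJ M.τ₀.2 w.2
  have h3 : M.loss n x (M.τ₀ + w) - M.loss n x M.τ₀ + lam / 4 * J w.2 w.2
      ≤ lam * J M.τ₀.2 M.τ₀.2 := by
    simp only [penLoss, Prod.snd_add] at h1
    nlinarith
  set Φ : EuclideanSpace ℝ (Fin p) × H → ℝ := fun w =>
    (M.loss n x (M.τ₀ + w) - M.loss n x M.τ₀) / L + lam / L / 4 * J w.2 w.2 with hΦ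
  have h4 : Φ w < c₀ * δ ^ 2 := by
    refine lt_of_le_of_lt ?_ hpen
    have e : Φ w = (M.loss n x (M.τ₀ + w) - M.loss n x M.τ₀ + lam / 4 * J w.2 w.2) / L := by
      simp only [hΦ]; ring
    have e' : lam / L * J M.τ₀.2 M.τ₀.2 = lam * J M.τ₀.2 M.τ₀.2 / L := by ring
    rw [e, e']
    exact div_le_div_of_nonneg_right h3 hL.le
  have hΦc : ContinuousAt Φ w := by
    have h5 : ContinuousAt (M.loss n x) (M.τ₀ + w) := hcont.continuousAt (hNo.mem_nhds hmem)
    have h6 : ContinuousAt (fun w => M.loss n x (M.τ₀ + w)) w :=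
      ContinuousAt.comp (g := M.loss n x) (f := fun w => M.τ₀ + w) h5 (by fun_prop)
    have h7 : Continuous fun w : EuclideanSpace ℝ (Fin p) × H => J w.2 w.2 :=
      hJc.comp continuous_snd
    exact ((h6.sub continuousAt_const).div_const L).add (h7.continuousAt.const_mul _)
  have hnhds : ∀ᶠ u in 𝓝 w, M.τ₀ + u ∈ N ∧ δ ^ 2 / 4 < W u ∧ W u < 4 * δ ^ 2 ∧
      Φ u < c₀ * δ ^ 2 := by
    have hδ2 : 0 < δ ^ 2 := by positivity
    refine ((?_ : Continuous fun u => M.τ₀ + u).continuousAt.eventually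
      (hNo.mem_nhds hmem)).and (((hWc.continuousAt (x := w)).eventually
      (lt_mem_nhds (by rw [hWw]; linarith))).and (((hWc.continuousAt (x := w)).eventually
      (gt_mem_nhds (by rw [hWw]; linarith))).and (hΦc.eventually (gt_mem_nhds h4))))
    fun_prop
  obtain ⟨u, ⟨hu1, hu2, hu3, hu4⟩, huR⟩ := mem_closure_iff_nhds.1 (hRd w) _ hnhds
  exact lt_irrefl _ ((hlow u huR hu1 hu2 hu3).trans hu4)

end Model

/-! ### The rate of convergence -/

namespace Model

variable {p : ℕ} {H : Type*} [NormedAddCommGroup H] [InnerProductSpace ℝ H]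
  {𝒳 : Type*} [MeasurableSpace 𝒳]

variable {M : Model p H 𝒳} [IsProbabilityMeasure M.trueLaw]
  {N : Set (EuclideanSpace ℝ (Fin p) × H)} {J : LinearMap.BilinForm ℝ H} {Lh : H →L[ℝ] M.L20}

theorem continuousOn_loss {K : ℝ} (hK : 1 ≤ K) (hb : ∀ τ ∈ N, M.RatioBound K τ)
    (hc : ContinuousOn M.etaL2 N) {n : ℕ} {x : Fin n → 𝒳}
    (hx : ∀ i, ContinuousOn (fun τ => M.η τ (x i)) N) : ContinuousOn (M.loss n x) N := by
  have hZ : ContinuousOn M.logZ N := by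
    intro τ hτ
    have h1 : Tendsto (fun σ => K * ‖M.etaL2 σ - M.etaL2 τ‖) (𝓝[N] τ) (𝓝 0) := by
      have h2 : Tendsto (fun σ => K * ‖M.etaL2 σ - M.etaL2 τ‖) (𝓝[N] τ)
          (𝓝 (K * ‖M.etaL2 τ - M.etaL2 τ‖)) :=
        (((hc τ hτ).tendsto.sub_const _).norm).const_mul K
      simpa using h2
    refine tendsto_iff_norm_sub_tendsto_zero.2 (squeeze_zero' (Eventually.of_forall fun σ =>
      norm_nonneg _) ?_ h1)
    filter_upwards [self_mem_nhdsWithin] with σ hσ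
    exact RatioBound.abs_logZ_sub_le hK (hb τ hτ) (hb σ hσ)
  have hlog : ContinuousOn (fun τ => Real.log (∫ y, Real.exp (M.η τ y) ∂M.base)) N := by
    refine (hZ.add_const (Real.log (∫ y, Real.exp (M.η M.τ₀ y) ∂M.base))).congr fun τ hτ => ?_
    have := log_integral_sub (hb τ hτ).1
    linarith
  exact ((continuousOn_finsetSum _ fun i _ => hx i).const_mul _ |>.neg).add hlog

omit [IsProbabilityMeasure M.trueLaw] in
theorem convexOn_loss_ae (hconv : M.ConvexityAssumption N)
    {Ω : Type*} [MeasurableSpace Ω] {P : Measure Ω} [IsProbabilityMeasure P]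
    {X : ℕ → Ω → 𝒳} (hX : ∀ i, Measurable (X i)) (hlaw : ∀ i, P.map (X i) = M.trueLaw)
    (hind : iIndepFun X P) {n : ℕ} (hn : 0 < n) :
    ∀ᵐ ω ∂P, ConvexOn ℝ N (M.loss n fun i : Fin n => X i ω) := by
  have h1 : iIndepFun (fun i : Fin n => X i) P := hind.precomp Fin.val_injective
  have h2 := (iIndepFun_iff_map_fun_eq_pi_map fun i : Fin n => (hX i).aemeasurable).1 h1
  simp only [hlaw] at h2
  have h3 := hconv n hn
  rw [← h2] at h3
  exact ae_of_ae_map (f := fun ω (i : Fin n) => X i ω) (by fun_prop) h3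

theorem inv_mul_add_le_sq_rate {n l r : ℝ} (hn : 0 < n) (hl : 0 < l) :
    n⁻¹ * l ^ (-(1 / r)) + l
      ≤ (n ^ (-(1 / 2) : ℝ) * l ^ (-(1 / (2 * r))) + l ^ (1 / 2 : ℝ)) ^ 2 := by
  have h1 : 0 < n ^ (-(1 / 2) : ℝ) * l ^ (-(1 / (2 * r))) :=
    mul_pos (Real.rpow_pos_of_pos hn _) (Real.rpow_pos_of_pos hl _)
  have h2 : 0 < l ^ (1 / 2 : ℝ) := Real.rpow_pos_of_pos hl _
  have e1 : (n ^ (-(1 / 2) : ℝ) * l ^ (-(1 / (2 * r)))) ^ 2 = n⁻¹ * l ^ (-(1 / r)) := by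
    have k1 : (n ^ (-(1 / 2) : ℝ)) ^ 2 = n⁻¹ := by
      rw [← Real.rpow_mul_natCast hn.le, ← Real.rpow_neg_one]
      norm_num
    have k2 : (l ^ (-(1 / (2 * r)))) ^ 2 = l ^ (-(1 / r)) := by
      rw [← Real.rpow_mul_natCast hl.le]
      congr 1
      push_cast
      ring
    rw [mul_pow, k1, k2]
  have e2 : (l ^ (1 / 2 : ℝ)) ^ 2 = l := by
    rw [← Real.rpow_mul_natCast hl.le]
    norm_num
  rw [add_sq, e1, e2]
  have := mul_pos h1 h2
  linarith

/-- The constant in the rate can be chosen such that the squared radius dominates the variance and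
the penalty at the true parameter. -/
theorem exists_radius {r L K D c₀ J₀ : ℝ} (hL : 1 ≤ L) (hK : 0 < K) (hD : 1 ≤ D)
    (hc₀ : 0 < c₀) (hJ₀ : 0 ≤ J₀) :
    ∃ A : ℝ, 0 < A ∧ ∀ n l : ℝ, 0 < n → 0 < l →
      K * (D * (l / L) ^ (-(1 / r)))
        ≤ n * (A * (n ^ (-(1 / 2) : ℝ) * l ^ (-(1 / (2 * r))) + l ^ (1 / 2 : ℝ))) ^ 2 ∧
      l / L * J₀
        < c₀ * (A * (n ^ (-(1 / 2) : ℝ) * l ^ (-(1 / (2 * r))) + l ^ (1 / 2 : ℝ))) ^ 2 := by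
  have hL0 : 0 < L := by linarith
  have hD0 : 0 < D := by linarith
  have hLr : 0 < L ^ (1 / r) := Real.rpow_pos_of_pos hL0 _
  -- The second and third summands serve the two requirements; the 1 ensures A ≤ A², so that A²
  -- times the squared rate dominates A times (n⁻¹ λ^(-1/r) + λ).
  set A := 1 + K * D * L ^ (1 / r) + J₀ / c₀ with hA
  have h1 : 0 ≤ K * D * L ^ (1 / r) := by positivity
  have h2 : 0 ≤ J₀ / c₀ := by positivity
  have hA1 : 1 ≤ A := by linarith
  have hA0 : 0 < A := by linarith
  refine ⟨A, hA0, fun n l hn hl => ?_⟩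
  have hT0 : 0 < l ^ (-(1 / r)) := Real.rpow_pos_of_pos hl _
  have hsq := inv_mul_add_le_sq_rate (r := r) hn hl
  set T := l ^ (-(1 / r))
  have hδ2 : A * (n⁻¹ * T + l)
      ≤ (A * (n ^ (-(1 / 2) : ℝ) * l ^ (-(1 / (2 * r))) + l ^ (1 / 2 : ℝ))) ^ 2 := by
    rw [mul_pow]
    exact mul_le_mul (by nlinarith) hsq (by positivity) (by positivity)
  constructor
  · refine le_trans ?_ (mul_le_mul_of_nonneg_left hδ2 hn.le)
    have e : (l / L) ^ (-(1 / r)) = L ^ (1 / r) * T := by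
      rw [Real.div_rpow hl.le hL0.le, Real.rpow_neg hL0.le, div_inv_eq_mul, mul_comm]
    have e2 : n * (A * (n⁻¹ * T + l)) = A * T + n * A * l := by
      field_simp
    have h3 : 0 ≤ n * A * l := by positivity
    have h4 : K * D * L ^ (1 / r) * T ≤ A * T :=
      mul_le_mul_of_nonneg_right (by linarith) hT0.le
    rw [e, e2]
    linarith
  · refine lt_of_lt_of_le ?_ (mul_le_mul_of_nonneg_left hδ2 hc₀.le)
    have h3 : l / L * J₀ ≤ l * J₀ := mul_le_mul_of_nonneg_right (div_le_self hl.le hL) hJ₀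
    have h4 : 0 < c₀ * (A * (n⁻¹ * T)) := by positivity
    have h5 : J₀ ≤ c₀ * A := by
      have h6 : c₀ * (J₀ / c₀) = J₀ := by field_simp
      nlinarith
    nlinarith [mul_le_mul_of_nonneg_left h5 hl.le]

/-- Almost surely the loss is convex and continuous on N, and `relLoss`, defined from L²
representatives, agrees with the actual log-likelihood ratio at every sample point and every member
of the countable set R. On such outcomes the deterministic argument applies. -/
theorem ae_form_lt_of_isEstimate {L : ℝ} (hL : 0 < L) (hNo : IsOpen N) (h0 : M.τ₀ ∈ N)
    (hconv : M.ConvexityAssumption N) {K : ℝ} (hK : 1 ≤ K) (hb : ∀ τ ∈ N, M.RatioBound K τ)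
    (heta : ContinuousOn M.etaL2 N)
    (hdiff : ∀ᵐ x ∂M.base, DifferentiableOn ℝ (fun τ => M.η τ x) N)
    (hJ : J.IsPosSemidef) (hJc : Continuous fun h => J h h)
    {R : Set (EuclideanSpace ℝ (Fin p) × H)} (hRc : R.Countable) (hRd : Dense R)
    {Ω : Type*} [MeasurableSpace Ω] {P : Measure Ω} [IsProbabilityMeasure P]
    {X : ℕ → Ω → 𝒳} (hX : ∀ i, Measurable (X i)) (hlaw : ∀ i, P.map (X i) = M.trueLaw)
    (hind : iIndepFun X P) {n : ℕ} (hn : 0 < n) {lam c₀ δ : ℝ} (hl : 0 < lam) (hδ : 0 < δ)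
    (hpen : lam / L * J M.τ₀.2 M.τ₀.2 < c₀ * δ ^ 2) :
    ∀ᵐ ω ∂P, ∀ τ, M.IsEstimate J N lam n (fun i : Fin n => X i ω) τ →
      (¬ ∃ w ∈ R, M.τ₀ + w ∈ N ∧
        δ ^ 2 / 4 < ‖w.1‖ ^ 2 + ‖Lh w.2‖ ^ 2 ∧ ‖w.1‖ ^ 2 + ‖Lh w.2‖ ^ 2 < 4 * δ ^ 2 ∧
        ∑ i ∈ Finset.range n, M.relLoss (M.τ₀ + w) (X i ω) / L
          + n / 4 * (lam / L * J w.2 w.2) ≤ n * (c₀ * δ ^ 2)) →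
      ‖(τ - M.τ₀).1‖ ^ 2 + ‖Lh (τ - M.τ₀).2‖ ^ 2 < δ ^ 2 := by
  have hn' : (0 : ℝ) < n := by exact_mod_cast hn
  have hgood2 : ∀ᵐ ω ∂P, ∀ i, ContinuousOn (fun τ => M.η τ (X i ω)) N := by
    refine ae_all_iff.2 fun i => ?_
    have h1 : ∀ᵐ x ∂M.trueLaw, ContinuousOn (fun τ => M.η τ x) N :=
      (tilted_absolutelyContinuous _ _).ae_le (hdiff.mono fun x hx => hx.continuousOn)
    rw [← hlaw i] at h1
    exact ae_of_ae_map (hX i).aemeasurable h1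
  have hgood3 : ∀ᵐ ω ∂P, ∀ w ∈ R, ∀ i, M.relLoss (M.τ₀ + w) (X i ω)
      = M.logZ (M.τ₀ + w) - (M.η (M.τ₀ + w) (X i ω) - M.η M.τ₀ (X i ω)) := by
    refine (ae_ball_iff hRc).2 fun w _ => ae_all_iff.2 fun i => ?_
    have h1 := relLoss_ae (M := M) (M.τ₀ + w)
    rw [← hlaw i] at h1
    exact ae_of_ae_map (hX i).aemeasurable h1
  filter_upwards [hgood2, hgood3, convexOn_loss_ae hconv hX hlaw hind hn]
    with ω g2 g3 g4 τ hτ hnb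
  refine form_lt_of_isEstimate hl hNo h0 hJ hJc (continuousOn_loss hK hb heta fun i => g2 i) g4 hτ
    hRd hL hδ (c₀ := c₀) ?_ hpen
  intro w hw hwN h1 h2
  by_contra hle
  rw [not_lt] at hle
  refine hnb ⟨w, hw, hwN, h1, h2, ?_⟩
  have h3 := loss_sub (hb _ hwN).1 hn (fun i : Fin n => X i ω)
  have h4 : ∑ i ∈ Finset.range n, M.relLoss (M.τ₀ + w) (X i ω)
      = n * (M.loss n (fun i : Fin n => X i ω) (M.τ₀ + w)
        - M.loss n (fun i : Fin n => X i ω) M.τ₀) := by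
    rw [h3, ← mul_assoc, mul_one_div_cancel hn'.ne', one_mul, Finset.sum_range]
    exact Finset.sum_congr rfl fun i _ => g3 w hw i
  rw [← Finset.sum_div, h4]
  refine le_trans (le_of_eq ?_) (mul_le_mul_of_nonneg_left hle hn'.le)
  ring

theorem RegularLoss.exists_rate {c C L : ℝ}
    (hR : M.RegularLoss N (fun w => ‖w.1‖ ^ 2 + ‖Lh w.2‖ ^ 2) c C L)
    (hc : 0 < c) (hC : 0 < C) (hL : 1 ≤ L) (hNo : IsOpen N) (h0 : M.τ₀ ∈ N)
    (hconv : M.ConvexityAssumption N) {K : ℝ} (hK : 1 ≤ K) (hb : ∀ τ ∈ N, M.RatioBound K τ)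
    (heta : ContinuousOn M.etaL2 N)
    (hdiff : ∀ᵐ x ∂M.base, DifferentiableOn ℝ (fun τ => M.η τ x) N)
    (hJ : J.IsPosSemidef) (hJc : Continuous fun h => J h h)
    {φ : ℕ → H} {ρ : ℕ → ℝ} (hE : M.IsEigensystem J Lh φ ρ) {r β : ℝ} (hr : 1 < r) (hβ : 0 < β)
    (hρ : ∀ᶠ ν : ℕ in atTop, β * ((ν : ℝ) + 1) ^ r < ρ ν)
    {Ω : Type*} [MeasurableSpace Ω] {P : Measure Ω} [IsProbabilityMeasure P]
    {X : ℕ → Ω → 𝒳} (hlaw : ∀ i, HasLaw (X i) M.trueLaw P) (hind : iIndepFun X P)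
    {lam : ℕ → ℝ} (hl : ∀ n, 0 < lam n) (hl0 : Tendsto lam atTop (𝓝 0))
    {τhat : ℕ → Ω → EuclideanSpace ℝ (Fin p) × H}
    (hest : Tendsto (fun n : ℕ => P {ω | ¬ M.IsEstimate J N (lam n) n
        (fun i : Fin n => X i ω) (τhat n ω)}) atTop (𝓝 0)) {ε : ℝ} (hε : 0 < ε) :
    ∃ A : ℝ, 0 < A ∧ ∀ᶠ n : ℕ in atTop,
      P {ω | ¬ (‖(τhat n ω - M.τ₀).1‖ ^ 2 + ‖Lh (τhat n ω - M.τ₀).2‖ ^ 2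
        < (A * ((n : ℝ) ^ (-(1 / 2) : ℝ) * lam n ^ (-(1 / (2 * r)))
          + lam n ^ (1 / 2 : ℝ))) ^ 2)} ≤ ENNReal.ofReal ε := by
  have hL0 : 0 < L := by linarith
  have hρ0 : ∀ k, 0 ≤ ρ k := fun k => by
    have := hJ.nonneg (φ k)
    rwa [hE.diagonal, if_pos rfl] at this
  -- `HasLaw` provides only almost everywhere measurability, so the observations are replaced by
  -- measurable versions.
  set Y : ℕ → Ω → 𝒳 := fun i => (hlaw i).aemeasurable.mk (X i) with hY
  have hYm : ∀ i, Measurable (Y i) := fun i => (hlaw i).aemeasurable.measurable_mk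
  have hYX : ∀ i, X i =ᵐ[P] Y i := fun i => (hlaw i).aemeasurable.ae_eq_mk
  have hYlaw : ∀ i, P.map (Y i) = M.trueLaw := fun i => by
    rw [← Measure.map_congr (hYX i), (hlaw i).map_eq]
  have hYind : iIndepFun Y P := hind.congr hYX
  obtain ⟨K₁, hK₁, c₀, hc₀, hbad⟩ := hR.exists_lower_bound_ratPoints h0 hc hC hE hρ0 hYm hYlaw
    hYind (half_pos hε)
  obtain ⟨CD, hCD1, hCD⟩ := exists_sum_inv_le hr hβ (Nat.cast_nonneg p) hρ0 hρ
  have hCD0 : 0 < CD := by linarith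
  obtain ⟨A, hA0, hA⟩ := exists_radius (r := r) hL hK₁ hCD1 hc₀ (hJ.nonneg M.τ₀.2)
  refine ⟨A, hA0, ?_⟩
  have hε2 : (0 : ℝ≥0∞) < ENNReal.ofReal (ε / 2) := ENNReal.ofReal_pos.2 (half_pos hε)
  filter_upwards [hest.eventually (gt_mem_nhds hε2), eventually_gt_atTop 0,
    hl0.eventually (gt_mem_nhds one_pos)] with n hn1 hn0 hln1
  have hn0' : (0 : ℝ) < n := by exact_mod_cast hn0
  have hln := hl n
  obtain ⟨hKD, hpen⟩ := hA n (lam n) hn0' hln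
  have hδ0 : 0 < A * ((n : ℝ) ^ (-(1 / 2) : ℝ) * lam n ^ (-(1 / (2 * r)))
      + lam n ^ (1 / 2 : ℝ)) :=
    mul_pos hA0 (add_pos (mul_pos (Real.rpow_pos_of_pos hn0' _) (Real.rpow_pos_of_pos hln _))
      (Real.rpow_pos_of_pos hln _))
  set δ := A * ((n : ℝ) ^ (-(1 / 2) : ℝ) * lam n ^ (-(1 / (2 * r))) + lam n ^ (1 / 2 : ℝ))
  -- The loss was divided by L, so the smoothing parameter is divided by L too; this changes the
  -- effective dimension only by a constant factor.
  have hl'0 : 0 < lam n / L := div_pos hln hL0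
  have hl'1 : lam n / L ≤ 1 := (div_le_one hL0).2 (by linarith)
  have hD1 : 1 ≤ CD * (lam n / L) ^ (-(1 / r)) :=
    one_le_mul_of_one_le_of_one_le hCD1
      (Real.one_le_rpow_of_pos_of_le_one_of_nonpos hl'0 hl'1 (by rw [neg_nonpos]; positivity))
  have hprob := hbad (lam n / L) _ δ n hl'0 (hCD _ hl'0 hl'1) hD1 hδ0 hKD
  have hae := ae_form_lt_of_isEstimate (Lh := Lh) hL0 hNo h0 hconv hK hb heta hdiff hJ hJc
    (countable_iUnion fun m => countable_ratPoints p φ m) (dense_iUnion_ratPoints p hE.complete)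
    hYm hYlaw hYind hn0 hln hδ0 hpen
  refine le_trans (measure_mono_ae ?_) ((measure_union_le _ _).trans
    ((add_le_add hprob hn1.le).trans (le_of_eq ?_)))
  · filter_upwards [ae_all_iff.2 hYX, hae] with ω g1 g2 hω
    by_contra hnot
    obtain ⟨hnb, hes⟩ := not_or.1 hnot
    have hes' := not_not.1 hes
    have e : (fun i : Fin n => X i ω) = fun i : Fin n => Y i ω := funext fun i => g1 i
    rw [e] at hes'
    exact hω (g2 _ hes' hnb)
  · rw [← ENNReal.ofReal_add (half_pos hε).le (half_pos hε).le, add_halves]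

end Model

theorem isBigOp_of_abs_le {Ω : Type*} [MeasurableSpace Ω] {P : Measure Ω} {Y W : ℕ → Ω → ℝ}
    {a : ℕ → ℝ} {c : ℝ} (hc : 0 ≤ c) (ha : ∀ n, 0 ≤ a n)
    (hY : ∀ n ω, |Y n ω| ≤ c * √(W n ω))
    (h : ∀ ε : ℝ, 0 < ε → ∃ A : ℝ, 0 < A ∧ ∀ᶠ n : ℕ in atTop,
      P {ω | ¬ (W n ω < (A * a n) ^ 2)} ≤ ENNReal.ofReal ε) : IsBigOp P Y a := by
  intro ε hε
  obtain ⟨A, hA, h⟩ := h ε hε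
  refine ⟨c * A, h.mono fun n hn => (measure_mono fun ω hω => ?_).trans hn⟩
  intro hlt
  have h1 : √(W n ω) ≤ A * a n := by
    rw [← Real.sqrt_sq (mul_nonneg hA.le (ha n))]
    exact Real.sqrt_le_sqrt hlt.le
  have h2 := (hY n ω).trans (mul_le_mul_of_nonneg_left h1 hc)
  have h3 : c * A * a n < |Y n ω| := hω
  linarith

end SemiparDensity

end

/-! ### Norm equivalence and the rate for the parametric component -/

open SemiparDensity in
theorem corollary1 {p : ℕ} {H : Type*} [NormedAddCommGroup H] [InnerProductSpace ℝ H]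
    [CompleteSpace H] {𝒳 : Type*} [MeasurableSpace 𝒳] (M : Model p H 𝒳)
    (J : LinearMap.BilinForm ℝ H)
    (Lθ : EuclideanSpace ℝ (Fin p) →L[ℝ] M.L20) (Lh : H →L[ℝ] M.L20)
    (Nθ : Set (EuclideanSpace ℝ (Fin p))) (Nh : Set H)
    (hNθ : IsOpen Nθ) (hNh : IsOpen Nh) (hθ₀ : M.τ₀.1 ∈ Nθ) (hh₀ : M.τ₀.2 ∈ Nh)
    (hconvθ : Convex ℝ Nθ) (hconvh : Convex ℝ Nh)
    (hpen : Model.PenaltyAssumption J)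
    (hop : M.OperatorAssumption J Lθ Lh)
    (hsmooth : M.SmoothnessAssumption (Nθ ×ˢ Nh))
    (C₁ C₂ : ℝ) (hC₁ : 0 < C₁) (hC₂ : 0 < C₂)
    (hderiv : M.DerivativeAssumption (Nθ ×ˢ Nh) Lθ Lh C₁ C₂)
    (hosc : M.OscillationAssumption (Nθ ×ˢ Nh) Lθ Lh C₁)
    (hvar : M.VarianceAssumption (Nθ ×ˢ Nh))
    (hcc : M.CompleteContinuityAssumption J Lh)
    (r : ℝ) (hr : 1 < r) (heig : M.EigenvalueAssumption J Lh r)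
    (hconv : M.ConvexityAssumption (Nθ ×ˢ Nh)) :
    (∃ c₁ > 0, ∃ c₂ > 0, ∀ ζ : EuclideanSpace ℝ (Fin p),
      c₁ * ‖ζ‖ ≤ M.normRp Lθ ζ ∧ M.normRp Lθ ζ ≤ c₂ * ‖ζ‖) ∧
    ∀ {Ω : Type*} [MeasurableSpace Ω] (P : Measure Ω) [IsProbabilityMeasure P]
      (X : ℕ → Ω → 𝒳), (∀ i, HasLaw (X i) M.trueLaw P) → iIndepFun X P →
      ∀ lam : ℕ → ℝ, (∀ n, 0 < lam n) → Tendsto lam atTop (𝓝 0) →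
      Tendsto (fun n : ℕ => (n : ℝ) * lam n ^ (1 / r)) atTop atTop →
      ∀ (θhat : ℕ → Ω → EuclideanSpace ℝ (Fin p)) (hhat : ℕ → Ω → H),
      Tendsto (fun n : ℕ => P {ω | ¬ M.IsEstimate J (Nθ ×ˢ Nh) (lam n) n
        (fun i : Fin n => X i ω) (θhat n ω, hhat n ω)}) atTop (𝓝 0) →
      IsBigOp P (fun n ω => ‖θhat n ω - M.τ₀.1‖)
        (fun n => (n : ℝ) ^ (-(1 / 2) : ℝ) * lam n ^ (-(1 / (2 * r)))
          + lam n ^ (1 / 2 : ℝ)) ∧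
      IsBigOp P (fun n ω => M.normRp Lθ (θhat n ω - M.τ₀.1))
        (fun n => (n : ℝ) ^ (-(1 / 2) : ℝ) * lam n ^ (-(1 / (2 * r)))
          + lam n ^ (1 / 2 : ℝ)) := by
  obtain ⟨φ, ρ, hE, β₁, hβ₁, β₂, -, hρ⟩ := heig
  obtain ⟨-, -, hnorm, cs, hcs, hsep⟩ := hop
  -- An element of unit variance shows that the true law is nonzero, hence a probability measure,
  -- and that it is not degenerate, as the density-ratio bound requires.
  have hf₀ : M.var M.τ₀ (Lh (φ 0)) = 1 := by
    have := hE.orthonormal 0 0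
    rwa [if_pos rfl] at this
  have hprob : IsProbabilityMeasure M.trueLaw := M.isProbabilityMeasure_trueLaw
    (M.trueLaw_ne_zero_of_var_ne_zero (f := Lh (φ 0)) (by rw [hf₀]; exact one_ne_zero))
  have hNo : IsOpen (Nθ ×ˢ Nh) := hNθ.prod hNh
  have hNc : Convex ℝ (Nθ ×ˢ Nh) := hconvθ.prod hconvh
  have h0 : M.τ₀ ∈ Nθ ×ˢ Nh := ⟨hθ₀, hh₀⟩
  obtain ⟨-, hsm, hdiff, -⟩ := hsmooth
  have hd : ∀ τ ∈ Nθ ×ˢ Nh, DifferentiableAt ℝ M.etaL2 τ := fun τ hτ =>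
    (hsm.contDiffAt (hNo.mem_nhds hτ)).differentiableAt (by norm_num)
  obtain ⟨K, hK, hb⟩ := M.exists_ratioBound hvar hf₀
  simp only [M.var_true] at hsep hnorm
  obtain ⟨a, ha, b, hb0, hab⟩ := exists_norm_sq_equiv hcs hsep
  have hR : ∀ ζ : EuclideanSpace ℝ (Fin p), M.normRp Lθ ζ = ‖Lθ ζ‖ := fun ζ => by
    rw [Model.normRp, M.var_true, Real.sqrt_sq (norm_nonneg _)]
  have hequiv : ∀ ζ : EuclideanSpace ℝ (Fin p),
      √a * ‖ζ‖ ≤ M.normRp Lθ ζ ∧ M.normRp Lθ ζ ≤ √b * ‖ζ‖ := by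
    intro ζ
    -- The joint equivalence at g = 0 is the equivalence of the two norms on the parametric space.
    have h1 := hab ζ 0
    simp only [map_zero, norm_zero, add_zero, ne_eq, OfNat.ofNat_ne_zero, not_false_eq_true,
      zero_pow] at h1
    rw [hR]
    constructor
    · refine le_of_sq_le_sq ?_ (norm_nonneg _)
      rw [mul_pow, Real.sq_sqrt ha.le]
      exact h1.1
    · refine le_of_sq_le_sq ?_ (by positivity)
      rw [mul_pow, Real.sq_sqrt hb0.le]
      exact h1.2
  refine ⟨⟨√a, Real.sqrt_pos.2 ha, √b, Real.sqrt_pos.2 hb0, hequiv⟩, ?_⟩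
  intro Ω _ P _ X hlaw hind lam hl hl0 _ θhat hhat hest
  obtain ⟨c, hc, C, hC, L, hL, hreg⟩ := Model.exists_regularLoss hconv hNc hK hb h0 hd
    (W := fun w => ‖w.1‖ ^ 2 + ‖Lh w.2‖ ^ 2) (fun w => by positivity) (mul_pos hC₁ ha)
    (mul_pos hC₂ hb0) (fun σ hσ w => by
      have h1 := hderiv σ hσ w.1 w.2
      rw [Model.Dθ_add_Dh (hd σ hσ), M.var_true, M.var_true] at h1
      have h2 := hab w.1 w.2
      constructor
      · rw [mul_assoc]
        exact (mul_le_mul_of_nonneg_left h2.1 hC₁.le).trans h1.1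
      · rw [mul_assoc]
        exact h1.2.trans (mul_le_mul_of_nonneg_left h2.2 hC₂.le))
  -- A single smoothing parameter suffices here: the upper bound serves only to make J continuous.
  obtain ⟨M₁, -, M₂, -, hM⟩ := hnorm 1 one_pos
  have hJc : Continuous fun h => J h h := continuous_form hpen.1 (C := M₂) fun g => by
    have h1 := (hM g).2
    have h2 := sq_nonneg ‖Lh g‖
    linarith
  have hrate := fun (ε : ℝ) (hε : 0 < ε) => hreg.exists_rate hc hC hL hNo h0 hconv hK hb
    hsm.continuousOn hdiff hpen.1 hJc hE hr hβ₁ (hρ.mono fun ν hν => hν.1) hlaw hind hl hl0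
    (τhat := fun n ω => (θhat n ω, hhat n ω)) hest hε
  have hrn : ∀ n : ℕ, 0 ≤ (n : ℝ) ^ (-(1 / 2) : ℝ) * lam n ^ (-(1 / (2 * r)))
      + lam n ^ (1 / 2 : ℝ) := fun n =>
    add_nonneg (mul_nonneg (Real.rpow_nonneg (Nat.cast_nonneg n) _)
      (Real.rpow_nonneg (hl n).le _)) (Real.rpow_nonneg (hl n).le _)
  have hle : ∀ n ω, ‖θhat n ω - M.τ₀.1‖ ≤ √(‖((θhat n ω, hhat n ω) - M.τ₀).1‖ ^ 2
      + ‖Lh ((θhat n ω, hhat n ω) - M.τ₀).2‖ ^ 2) := fun n ω =>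
    Real.le_sqrt_of_sq_le (le_add_of_nonneg_right (sq_nonneg _))
  refine ⟨isBigOp_of_abs_le zero_le_one hrn (fun n ω => ?_) hrate,
    isBigOp_of_abs_le (Real.sqrt_nonneg b) hrn (fun n ω => ?_) hrate⟩
  · rw [abs_norm, one_mul]
    exact hle n ω
  · rw [abs_of_nonneg (show 0 ≤ M.normRp Lθ (θhat n ω - M.τ₀.1) from Real.sqrt_nonneg _)]
    exact (hequiv _).2.trans (mul_le_mul_of_nonneg_left (hle n ω) (Real.sqrt_nonneg b))
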